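/- Let $X_1,X_2,\dots$ be i.i.d. real random variables with $\mathbf E|X_1|<\infty$ and $\mathbf E X_1=-a$, where $a>0$. Put $\overline F(x)=\mathbf P(X_1>x)$, $S_0=0$, $S_n=X_1+\dots+X_n$, $\tau=\min\{n\ge1: S_n\le 0\}$, $A_\tau=\sum_{k=0}^{\tau-1}S_k$ and $M_\tau=\max_{0\le n<\tau}S_n$. Then $\mathbf E\tau<\infty$ and the following two statements hold. (a) Suppose that $\overline F(x)=x^{-\alpha}L(x)$ for all large $x$, where $\alpha\ge1$ and $L$ is slowly varying at infinity. Then for every $\varepsilon>0$, as $x\to\infty$, $$\mathbf P(A_\tau>x,\,M_\tau>y)\sim \mathbf E\tau\,\overline F(\sqrt{2ax})\qquad(1)$$ uniformly in $y\in[\varepsilon\sqrt x,\sqrt{2ax}]$. Consequently $$\liminf_{x\to\infty}\frac{\mathbf P(A_\tau>x)}{\overline F(\sqrt{2ax})}\ge\mathbf E\tau .\qquad(2)$$ If moreover $\alpha>1$, then $\mathbf P(A_\tau>x)\sim\mathbf E\tau\,\overline F(\sqrt{2ax})$ as $x\to\infty$. (b) Suppose that $\overline F(x)\sim x^{-\varkappa}e^{-g(x)}$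 as $x\to\infty$, where, for some $\beta\in(0,1/2)$, $\varkappa>1/(1-\beta)$ and $x_0\ge0$, the function $g$ is monotone and continuously differentiable on $(x_0,\infty)$, $g(x)/x^\beta$ is nonincreasing on $(x_0,\infty)$, and $\mathbf E|X_1|^{\varkappa}<\infty$ (with the same $\varkappa$). Then for every $R>0$, (1) holds as $x\to\infty$, uniformly in $$y\in\Bigl[\sqrt{2ax}-\frac{R\sqrt{2ax}}{g(\sqrt{2ax})},\ \sqrt{2ax}\Bigr],$$ and (2) holds. Here "$f(x,y)\sim h(x)$ uniformly in $y\in I(x)$" means $\sup_{y\in I(x)}|f(x,y)/h(x)-1|\to0$ as $x\to\infty$. -/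

import Mathlib

open MeasureTheory ProbabilityTheory Filter Topology Set Asymptotics

noncomputable section

namespace WalkArea

variable {Ω : Type*}

/-- The random walk with increments `X 0, X 1, X 2, …` (so `X k` stands for `X_{k+1}`):
`S 0 = 0` and `S n = X 0 + ⋯ + X (n - 1)`. -/
def walk (X : ℕ → Ω → ℝ) (n : ℕ) (ω : Ω) : ℝ := ∑ k ∈ Finset.range n, X k ω

/-- The first time `n ≥ 1` at which `S n ≤ 0` (equal to `⊤` if there is none). -/
def exitTime (X : ℕ → Ω → ℝ) : Ω → ℕ∞ := hittingAfter (walk X) (Iic 0) 1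

/-- The area `∑_{k < τ} S k` under the excursion. Where `τ = ⊤`, which is a null event for a walk
with negative drift, the value is `0`. -/
def area (X : ℕ → Ω → ℝ) (ω : Ω) : ℝ :=
  ∑ k ∈ Finset.range (exitTime X ω).toNat, walk X k ω

/-- The maximum `max_{n < τ} S n` of the excursion (a maximum over a finite set, nonempty since
`1 ≤ τ`). Where `τ = ⊤`, the value is `0`. -/
def maximum (X : ℕ → Ω → ℝ) (ω : Ω) : ℝ :=
  ⨆ n : Fin (exitTime X ω).toNat, walk X n ω

variable [MeasurableSpace Ω]

/-- The expectation of the exit time, in `[0, ∞]`. -/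
def meanExitTime (μ : Measure Ω) (X : ℕ → Ω → ℝ) : ENNReal :=
  ∫⁻ ω, (exitTime X ω : ENNReal) ∂μ

/-- The tail `P(X_1 > x)` of the increments. -/
def tail (μ : Measure Ω) (X : ℕ → Ω → ℝ) (x : ℝ) : ℝ := μ.real {ω | x < X 0 ω}

/-- Slow variation at infinity: measurable, eventually positive, and `L (t x) / L x → 1` for
every `t > 0`. -/
structure SlowlyVarying (L : ℝ → ℝ) : Prop where
  measurable : Measurable L
  eventually_pos : ∀ᶠ x in atTop, 0 < L x
  tendsto_ratio : ∀ t : ℝ, 0 < t → Tendsto (fun x => L (t * x) / L x) atTop (𝓝 1)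

/-- `f x y ∼ h x` as `x → ∞`, uniformly in `y ∈ I x`. -/
def UniformEquiv (f : ℝ → ℝ → ℝ) (h : ℝ → ℝ) (I : ℝ → Set ℝ) : Prop :=
  ∀ δ : ℝ, 0 < δ → ∀ᶠ x in atTop, ∀ y ∈ I x, |f x y / h x - 1| < δ

end WalkArea

end

/-!
The proof is the principle of one big jump. A walk with drift `-a` that reaches height `z` by a
single jump goes down along a line of slope `-a` afterwards, so that it sweeps out an area of
about `z² / (2a)`; hence `A_τ > x` goes with `M_τ > z`, `z = √(2ax)`. Each time `k < τ` is an
opportunity for such a jump, and `∑ₖ P(τ > k) = E τ`, which yields `E τ · F(z)`, with `F` the tail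
of the increments.

*Lower bound.* The events that the walk is alive and below `z` at time `k`, that the next
increment exceeds `z + η s(z)`, and that the walk follows its mean up to an error of order `s(z)`
during a time of order `z` after that, are independent; their intersections for different
`k` are disjoint.
Here `s` is an insensitivity scale of `F` (`InsensitivityScale`): `F(z ± η s(z))` is close to
`F(z)`. The fluctuations are controlled by Kolmogorov's inequality after truncation at level
`s(z)`, provided that `z E min(|X|/s(z), (X/s(z))²) → 0`. For a regularly varying tail, `s(z) = z`
will do and a finite mean suffices. For a semi-exponential tail, `s(z) = z^{1-β}`, and a moment of
order `ϰ > 1/(1-β)` is what is needed. See `NegativeDrift.eventually_le_measureReal_area`.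

*Upper bound.* The tail of the maximum satisfies `P(M_τ > y) ≤ (E τ + o(1)) F(y)`
(`NegativeDrift.eventually_measureReal_crossing_le`). This is proved by summing the drift of the
test function `q(u) = ∫₀^{min(u, b)} F(y - s) ds` along the walk: for a strongly subexponential
tail (`HeavyTail`) the drift of `q` at `u` is at most about `-a F(y - u)`. It follows that the
crossings of `y` at late times are negligible. If `y` is crossed early then, by the strong Markov
property, the walk follows its mean after the crossing, outside an event of relative probability
`o(1)`, and on the complement an area above `z² / (2a)` forces the maximum to be nearly `z`
(`NegativeDrift.eventually_measureReal_area_le`). This applies to every level `y` with `F(y) =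
O(F(z))`, whence the two ranges of levels; uniformity follows from monotonicity in `y`.

*No condition on the maximum.* For `α > 1` there is a moment of order `p > 1`. If the maximum is
at most `ε √x` and the area is above `x`, then `τ > √x / ε` and no increment exceeds `ε √x`.
Chernoff's bound, with parameter of order `log x / √x`, makes this as small a power of `x` as
desired when `ε` is small (`NegativeDrift.exists_measureReal_area_low_le`).
-/

noncomputable section

namespace WalkArea

/-! ### Walks with negative drift: past, future and the exit time -/

section

variable {Ω : Type*}

/-- The σ-algebra generated by the increments `X i` with `i < k`. -/
abbrev past (X : ℕ → Ω → ℝ) (k : ℕ) : MeasurableSpace Ω :=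
  ⨆ i ∈ Set.Iio k, MeasurableSpace.comap (X i) inferInstance

/-- The σ-algebra generated by the increments `X i` with `k ≤ i`. -/
abbrev future (X : ℕ → Ω → ℝ) (k : ℕ) : MeasurableSpace Ω :=
  ⨆ i ∈ Set.Ici k, MeasurableSpace.comap (X i) inferInstance

/-- The event that the walk has not exited by time `k`, that is `{τ > k}`. -/
def alive (X : ℕ → Ω → ℝ) (k : ℕ) : Set Ω := {ω | ∀ j, 1 ≤ j → j ≤ k → 0 < walk X j ω}

/-- The event that up to time `k` the walk has neither exited nor exceeded the level `y`. -/
def confined (X : ℕ → Ω → ℝ) (y : ℝ) (k : ℕ) : Set Ω :=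
  alive X k ∩ {ω | ∀ j ≤ k, walk X j ω ≤ y}

/-- The event that the walk exceeds the level `y` at time `k`, before its exit and for the first
time. -/
def crossing (X : ℕ → Ω → ℝ) (y : ℝ) (k : ℕ) : Set Ω :=
  alive X k ∩ {ω | y < walk X k ω ∧ ∀ j < k, walk X j ω ≤ y}

lemma measurable_past (X : ℕ → Ω → ℝ) {i k : ℕ} (h : i < k) : Measurable[past X k] (X i) := by
  have h1 : MeasurableSpace.comap (X i) inferInstance ≤ past X k :=
    le_iSup₂_of_le (f := fun i (_ : i ∈ Set.Iio k) => MeasurableSpace.comap (X i) inferInstance)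
      i h le_rfl
  exact (comap_measurable (X i)).mono h1 le_rfl

lemma measurable_future (X : ℕ → Ω → ℝ) {i k : ℕ} (h : k ≤ i) : Measurable[future X k] (X i) := by
  have h1 : MeasurableSpace.comap (X i) inferInstance ≤ future X k :=
    le_iSup₂_of_le (f := fun i (_ : i ∈ Set.Ici k) => MeasurableSpace.comap (X i) inferInstance)
      i h le_rfl
  exact (comap_measurable (X i)).mono h1 le_rfl

lemma measurable_walk_past (X : ℕ → Ω → ℝ) {j k : ℕ} (h : j ≤ k) :
    Measurable[past X k] (walk X j) := by
  unfold walk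
  refine @Finset.measurable_fun_sum _ _ _ _ _ _ (past X k) _ _ fun i hi => ?_
  exact measurable_past X (lt_of_lt_of_le (Finset.mem_range.1 hi) h)

lemma measurableSet_alive_past (X : ℕ → Ω → ℝ) (k : ℕ) : MeasurableSet[past X k] (alive X k) := by
  have : alive X k = ⋂ j ∈ Finset.Icc 1 k, {ω | 0 < walk X j ω} := by
    ext ω; simp [alive]
  rw [this]
  refine @Finset.measurableSet_biInter _ _ (past X k) _ _ fun j hj => ?_
  exact measurable_walk_past X (Finset.mem_Icc.1 hj).2 measurableSet_Ioi

lemma measurableSet_confined_past (X : ℕ → Ω → ℝ) (y : ℝ) (k : ℕ) :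
    MeasurableSet[past X k] (confined X y k) := by
  refine @MeasurableSet.inter _ (past X k) _ _ (measurableSet_alive_past X k) ?_
  have : {ω | ∀ j ≤ k, walk X j ω ≤ y} = ⋂ j ∈ Finset.Iic k, {ω | walk X j ω ≤ y} := by
    ext ω; simp
  rw [this]
  refine @Finset.measurableSet_biInter _ _ (past X k) _ _ fun j hj => ?_
  exact measurable_walk_past X (Finset.mem_Iic.1 hj) measurableSet_Iic

lemma measurableSet_crossing_past (X : ℕ → Ω → ℝ) (y : ℝ) (k : ℕ) :
    MeasurableSet[past X k] (crossing X y k) := by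
  refine @MeasurableSet.inter _ (past X k) _ _ (measurableSet_alive_past X k) ?_
  have : {ω | y < walk X k ω ∧ ∀ j < k, walk X j ω ≤ y} =
      {ω | y < walk X k ω} ∩ ⋂ j ∈ Finset.Iio k, {ω | walk X j ω ≤ y} := by
    ext ω; simp
  rw [this]
  refine @MeasurableSet.inter _ (past X k) _ _ ?_ ?_
  · exact measurable_walk_past X le_rfl measurableSet_Ioi
  refine @Finset.measurableSet_biInter _ _ (past X k) _ _ fun j hj => ?_
  exact measurable_walk_past X (Finset.mem_Iio.1 hj).le measurableSet_Iic

lemma alive_iff {X : ℕ → Ω → ℝ} {k : ℕ} {ω : Ω} : ω ∈ alive X k ↔ (k : ℕ∞) < exitTime X ω := by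
  have h := hittingAfter_le_iff (u := walk X) (s := Iic 0) (n := 1) (i := k) (ω := ω)
  have h2 : ω ∈ alive X k ↔ ¬ ∃ j ∈ Set.Icc 1 k, walk X j ω ∈ Iic 0 := by simp [alive]
  rw [h2, ← h]
  exact not_le

lemma alive_zero (X : ℕ → Ω → ℝ) : alive X 0 = univ := by
  ext ω; simp only [alive, mem_ofPred_eq, mem_univ, iff_true]; intro j h1 h2; omega

lemma alive_antitone (X : ℕ → Ω → ℝ) : Antitone (alive X) := fun _ _ h _ hω j h1 h2 =>
  hω j h1 (h2.trans h)

@[simp] lemma walk_zero (X : ℕ → Ω → ℝ) (ω : Ω) : walk X 0 ω = 0 := by simp [walk]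

lemma walk_succ (X : ℕ → Ω → ℝ) (n : ℕ) (ω : Ω) : walk X (n + 1) ω = walk X n ω + X n ω := by
  simp [walk, Finset.sum_range_succ]

lemma walk_nonneg_of_alive {X : ℕ → Ω → ℝ} {k j : ℕ} {ω : Ω} (h : ω ∈ alive X k) (hj : j ≤ k) :
    0 ≤ walk X j ω := by
  rcases Nat.eq_zero_or_pos j with rfl | h0
  · simp
  · exact (h j h0 hj).le

lemma walk_add (X : ℕ → Ω → ℝ) (k j : ℕ) (ω : Ω) :
    walk X (k + j) ω = walk X k ω + walk (fun i => X (k + i)) j ω := by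
  simp [walk, Finset.sum_range_add]

lemma crossing_disjoint (X : ℕ → Ω → ℝ) (y : ℝ) :
    Pairwise (Function.onFun Disjoint (crossing X y)) := by
  have key : ∀ i j, i < j → Disjoint (crossing X y i) (crossing X y j) := fun i j hij =>
    Set.disjoint_left.2 fun ω h1 h2 => absurd h1.2.1 (not_lt.2 (h2.2.2 i hij))
  intro i j hij
  rcases lt_or_gt_of_ne hij with h | h
  · exact key i j h
  · exact (key j i h).symm

/-- On `{τ < ∞}` the exit time is a natural number `N ≥ 1` with `S_N ≤ 0`, and `area` and
`maximum` are a sum and a maximum over `n < N`. -/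
lemma exists_exit {X : ℕ → Ω → ℝ} {ω : Ω} (hω : ∃ k, ω ∉ alive X k) :
    ∃ N, 1 ≤ N ∧ (∀ k, ω ∈ alive X k ↔ k < N) ∧ walk X N ω ≤ 0 ∧
      area X ω = ∑ k ∈ Finset.range N, walk X k ω ∧
      ∀ y, y < maximum X ω ↔ ∃ k < N, y < walk X k ω := by
  obtain ⟨k, hk⟩ := hω
  have hne : exitTime X ω ≠ ⊤ := fun ht =>
    hk (alive_iff.2 (by rw [ht]; exact ENat.natCast_lt_top k))
  obtain ⟨N, hN⟩ := ENat.ne_top_iff_exists.1 hne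
  have hal : ∀ k, ω ∈ alive X k ↔ k < N := fun k => by
    rw [alive_iff, ← hN]; exact_mod_cast Iff.rfl
  have hN1 : 1 ≤ N := (hal 0).1 (by simp [alive_zero])
  refine ⟨N, hN1, hal, ?_, ?_, ?_⟩
  · by_contra! hpos
    refine lt_irrefl N ((hal N).1 fun j h1 hj => ?_)
    rcases hj.eq_or_lt with rfl | hj
    · exact hpos
    · exact (hal j).2 hj j h1 le_rfl
  · simp [area, ← hN]
  · intro y
    have hmax : maximum X ω = ⨆ n : Fin N, walk X n ω := by
      have : (exitTime X ω).toNat = N := by rw [← hN]; simp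
      unfold maximum
      rw [this]
    have : Nonempty (Fin N) := ⟨⟨0, hN1⟩⟩
    rw [hmax, lt_ciSup_iff (Set.finite_range _).bddAbove]
    exact ⟨fun ⟨i, hi⟩ => ⟨i, i.2, hi⟩, fun ⟨k, hk, h⟩ => ⟨⟨k, hk⟩, h⟩⟩

/-- On `{τ < ∞}` the maximum exceeds `y` exactly when `y` is crossed. -/
lemma lt_maximum_iff {X : ℕ → Ω → ℝ} {ω : Ω} (hω : ∃ k, ω ∉ alive X k) (y : ℝ) :
    y < maximum X ω ↔ ∃ k, ω ∈ crossing X y k := by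
  obtain ⟨N, -, hal, -, -, hmax⟩ := exists_exit hω
  rw [hmax]
  classical
  constructor
  · intro hex
    refine ⟨Nat.find hex, (hal _).2 (Nat.find_spec hex).1, (Nat.find_spec hex).2, fun j hj => ?_⟩
    have := Nat.find_min hex hj
    push Not at this
    exact this (hj.trans (Nat.find_spec hex).1)
  · rintro ⟨k, hk, hy, -⟩
    exact ⟨k, (hal k).1 hk, hy⟩

lemma neg_le_sum_indicator_alive {X : ℕ → Ω → ℝ} {K : ℝ} (hK : 0 ≤ K) (ω : Ω) (n : ℕ) :
    -K ≤ ∑ k ∈ Finset.range n, (alive X k).indicator (fun ω => max (X k ω) (-K)) ω := by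
  have key : ∀ n, (ω ∈ alive X n → walk X n ω ≤
      ∑ k ∈ Finset.range n, (alive X k).indicator (fun ω => max (X k ω) (-K)) ω) ∧
      -K ≤ ∑ k ∈ Finset.range n, (alive X k).indicator (fun ω => max (X k ω) (-K)) ω := by
    intro n
    induction n with
    | zero => simp [hK]
    | succ n ih =>
      rw [Finset.sum_range_succ]
      by_cases h : ω ∈ alive X n
      · rw [indicator_of_mem h, walk_succ]
        have h1 := ih.1 h
        have h0 := walk_nonneg_of_alive h le_rfl
        exact ⟨fun _ => by linarith [le_max_left (X n ω) (-K)],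
          by linarith [le_max_right (X n ω) (-K)]⟩
      · rw [indicator_of_notMem h, add_zero]
        exact ⟨fun h' => absurd (alive_antitone X n.le_succ h') h, ih.2⟩
  exact (key n).2

variable [MeasurableSpace Ω] {μ : Measure Ω} {X : ℕ → Ω → ℝ} {a : ℝ}

/-- A sequence of independent, identically distributed, integrable increments with mean `-a < 0`. -/
structure NegativeDrift (μ : Measure Ω) (X : ℕ → Ω → ℝ) (a : ℝ) : Prop where
  meas : ∀ k, Measurable (X k)
  indep : iIndepFun X μ
  ident : ∀ k, IdentDistrib (X k) (X 0) μ μ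
  int : Integrable (X 0) μ
  pos : 0 < a
  mean : ∫ ω, X 0 ω ∂μ = -a

lemma past_le (hX : ∀ k, Measurable (X k)) (k : ℕ) : past X k ≤ ‹MeasurableSpace Ω› :=
  iSup₂_le fun i _ => (hX i).comap_le

lemma future_le (hX : ∀ k, Measurable (X k)) (k : ℕ) : future X k ≤ ‹MeasurableSpace Ω› :=
  iSup₂_le fun i _ => (hX i).comap_le

lemma indep_past_future (hX : ∀ k, Measurable (X k)) (hi : iIndepFun X μ) (k : ℕ) :
    Indep (past X k) (future X k) μ := by
  refine indep_iSup_of_disjoint (fun i => (hX i).comap_le) hi ?_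
  exact Set.disjoint_left.2 fun i h1 h2 => not_lt.2 (mem_Ici.1 h2) (mem_Iio.1 h1)

lemma measure_past_inter_future (hX : ∀ k, Measurable (X k)) (hi : iIndepFun X μ) {k : ℕ}
    {A B : Set Ω} (hA : MeasurableSet[past X k] A) (hB : MeasurableSet[future X k] B) :
    μ.real (A ∩ B) = μ.real A * μ.real B := by
  rw [measureReal_def, (Indep_iff _ _ _).1 (indep_past_future hX hi k) A B hA hB,
    ENNReal.toReal_mul]
  rfl

lemma measurable_walk (hX : ∀ k, Measurable (X k)) (j : ℕ) : Measurable (walk X j) :=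
  (measurable_walk_past X le_rfl).mono (past_le hX j) le_rfl

lemma measurableSet_alive (hX : ∀ k, Measurable (X k)) (k : ℕ) : MeasurableSet (alive X k) :=
  past_le hX k _ (measurableSet_alive_past X k)

lemma measurableSet_confined (hX : ∀ k, Measurable (X k)) (y : ℝ) (k : ℕ) :
    MeasurableSet (confined X y k) :=
  past_le hX k _ (measurableSet_confined_past X y k)

lemma measurableSet_crossing (hX : ∀ k, Measurable (X k)) (y : ℝ) (k : ℕ) :
    MeasurableSet (crossing X y k) :=
  past_le hX k _ (measurableSet_crossing_past X y k)

namespace NegativeDrift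

lemma shift (h : NegativeDrift μ X a) (k : ℕ) : NegativeDrift μ (fun i => X (k + i)) a where
  meas i := h.meas _
  indep := h.indep.precomp (add_right_injective k)
  ident i := (h.ident (k + i)).trans (h.ident (k + 0)).symm
  int := ((h.ident (k + 0)).integrable_iff).2 h.int
  pos := h.pos
  mean := by rw [(h.ident (k + 0)).integral_eq]; exact h.mean

lemma measureReal_lt (h : NegativeDrift μ X a) (k : ℕ) (x : ℝ) :
    μ.real {ω | x < X k ω} = tail μ X x := by
  unfold tail
  rw [measureReal_def, measureReal_def]
  congr 1
  exact (h.ident k).measure_mem_eq measurableSet_Ioi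

lemma integrable_comp (h : NegativeDrift μ X a) (k : ℕ) {f : ℝ → ℝ} (hf : Measurable f)
    (hi : Integrable (fun ω => f (X 0 ω)) μ) : Integrable (fun ω => f (X k ω)) μ :=
  (((h.ident k).comp hf).integrable_iff).2 hi

lemma integral_comp (h : NegativeDrift μ X a) (k : ℕ) {f : ℝ → ℝ} (hf : Measurable f) :
    ∫ ω, f (X k ω) ∂μ = ∫ ω, f (X 0 ω) ∂μ :=
  ((h.ident k).comp hf).integral_eq

variable [IsProbabilityMeasure μ]

/-- The increment `X k` is integrated out against an event and a random variable from its past. -/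
lemma setIntegral_past (h : NegativeDrift μ X a) {k : ℕ} {A : Set Ω}
    (hA : MeasurableSet[past X k] A) {W : Ω → ℝ} (hW : Measurable[past X k] W) {f : ℝ → ℝ → ℝ}
    (hf : Measurable (Function.uncurry f))
    (hint : Integrable (fun ω => A.indicator (fun ω => f (W ω) (X k ω)) ω) μ) :
    ∫ ω in A, f (W ω) (X k ω) ∂μ = ∫ ω in A, (∫ ω', f (W ω) (X 0 ω') ∂μ) ∂μ := by
  have hAm := past_le h.meas k _ hA
  have hWm : Measurable W := hW.mono (past_le h.meas k) le_rfl
  let I : Ω → ℝ := A.indicator fun _ => 1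
  have hI : Measurable[past X k] I := (@measurable_const _ _ _ (past X k) (1 : ℝ)).indicator hA
  have hIm : Measurable I := hI.mono (past_le h.meas k) le_rfl
  have hWI : Measurable[past X k] (fun ω => (W ω, I ω)) := hW.prodMk hI
  have hWIm : Measurable (fun ω => (W ω, I ω)) := hWm.prodMk hIm
  have hind : IndepFun (fun ω => (W ω, I ω)) (X k) μ := by
    rw [IndepFun_iff_Indep]
    refine indep_of_indep_of_le (indep_past_future h.meas h.indep k) ?_ ?_
    · exact hWI.comap_le
    · exact (measurable_future X le_rfl).comap_le
  have hmap := (indepFun_iff_map_prod_eq_prod_map_map hWIm.aemeasurable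
    (h.meas k).aemeasurable).1 hind
  let F : (ℝ × ℝ) × ℝ → ℝ := fun p => p.1.2 * f p.1.1 p.2
  have hF : Measurable F := by
    have : Measurable (fun p : (ℝ × ℝ) × ℝ => Function.uncurry f (p.1.1, p.2)) :=
      hf.comp (by fun_prop)
    exact (measurable_fst.snd).mul this
  have heq : ∀ ω, F ((W ω, I ω), X k ω) = A.indicator (fun ω => f (W ω) (X k ω)) ω := by
    intro ω
    by_cases hω : ω ∈ A <;> simp [F, I, hω]
  have hFint : Integrable F ((μ.map (fun ω => (W ω, I ω))).prod (μ.map (X k))) := by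
    rw [← hmap, integrable_map_measure hF.aestronglyMeasurable
      (hWIm.prodMk (h.meas k)).aemeasurable]
    exact hint.congr (ae_of_all _ fun ω => (heq ω).symm)
  have := Measure.isProbabilityMeasure_map (μ := μ) (h.meas k).aemeasurable
  have := Measure.isProbabilityMeasure_map (μ := μ) hWIm.aemeasurable
  calc ∫ ω in A, f (W ω) (X k ω) ∂μ = ∫ ω, F ((W ω, I ω), X k ω) ∂μ := by
        rw [← integral_indicator hAm]; exact integral_congr_ae (ae_of_all _ fun ω => (heq ω).symm)
    _ = ∫ p, F p ∂((μ.map (fun ω => (W ω, I ω))).prod (μ.map (X k))) := by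
        rw [← hmap, integral_map (hWIm.prodMk (h.meas k)).aemeasurable hF.aestronglyMeasurable]
    _ = ∫ p, ∫ x, F (p, x) ∂(μ.map (X k)) ∂(μ.map (fun ω => (W ω, I ω))) :=
        integral_prod F hFint
    _ = ∫ ω, ∫ x, F ((W ω, I ω), x) ∂(μ.map (X k)) ∂μ := by
        rw [integral_map hWIm.aemeasurable]
        exact (hF.stronglyMeasurable.integral_prod_right').aestronglyMeasurable
    _ = ∫ ω in A, (∫ ω', f (W ω) (X 0 ω') ∂μ) ∂μ := by
        rw [← integral_indicator hAm]
        refine integral_congr_ae (ae_of_all _ fun ω => ?_)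
        simp only
        rw [(h.ident k).map_eq, integral_map (h.meas 0).aemeasurable]
        · by_cases hω : ω ∈ A <;> simp [F, I, hω]
        · exact (hF.comp (measurable_const.prodMk measurable_id)).aestronglyMeasurable

/-- Wald's identity for one increment. -/
lemma setIntegral_past_comp (h : NegativeDrift μ X a) {k : ℕ} {A : Set Ω}
    (hA : MeasurableSet[past X k] A) {f : ℝ → ℝ} (hf : Measurable f)
    (hint : Integrable (fun ω => f (X 0 ω)) μ) :
    ∫ ω in A, f (X k ω) ∂μ = μ.real A * ∫ ω, f (X 0 ω) ∂μ := by
  rw [h.setIntegral_past hA (@measurable_const _ _ _ (past X k) (0 : ℝ)) (f := fun _ x => f x)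
    (hf.comp measurable_snd)]
  · simp
  · exact (h.integrable_comp k hf hint).indicator (past_le h.meas k _ hA)

end NegativeDrift

lemma meanExitTime_eq_tsum (hX : ∀ k, Measurable (X k)) :
    meanExitTime μ X = ∑' k, μ (alive X k) := by
  have h1 : ∀ ω, (exitTime X ω : ENNReal) =
      ∑' k, (alive X k).indicator (fun _ => (1 : ENNReal)) ω := by
    intro ω
    cases hτ : exitTime X ω with
    | top =>
      have : ∀ k, (alive X k).indicator (fun _ => (1 : ENNReal)) ω = 1 := fun k =>
        indicator_of_mem (alive_iff.2 (by rw [hτ]; exact ENat.natCast_lt_top k)) _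
      simp [this]
    | coe n =>
      rw [tsum_eq_sum (s := Finset.range n)]
      · rw [Finset.sum_congr rfl (g := fun _ => (1 : ENNReal))]
        · simp
        · intro k hk
          exact indicator_of_mem (alive_iff.2 (by
            rw [hτ]; exact_mod_cast Finset.mem_range.1 hk)) _
      · intro k hk
        refine indicator_of_notMem (fun hh => hk ?_) _
        have := alive_iff.1 hh
        rw [hτ] at this
        exact Finset.mem_range.2 (by exact_mod_cast this)
  unfold meanExitTime
  simp_rw [h1]
  rw [lintegral_tsum]
  · simp_rw [lintegral_indicator_const (measurableSet_alive hX _), one_mul]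
  · exact fun k => (measurable_const.indicator (measurableSet_alive hX k)).aemeasurable

end

/-! ### The exit time has finite mean -/

section

variable {Ω : Type*} [MeasurableSpace Ω] {μ : Measure Ω} {X : ℕ → Ω → ℝ} {a : ℝ}

lemma exists_integral_max_neg {Y : Ω → ℝ} (hY : Integrable Y μ) (hneg : ∫ ω, Y ω ∂μ < 0) :
    ∃ K : ℝ, 0 ≤ K ∧ ∫ ω, max (Y ω) (-K) ∂μ < 0 := by
  have hlim : Tendsto (fun n : ℕ => ∫ ω, max (Y ω) (-(n : ℝ)) ∂μ) atTop (𝓝 (∫ ω, Y ω ∂μ)) := by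
    refine tendsto_integral_of_dominated_convergence (fun ω => |Y ω|) (fun n => ?_) hY.abs
      (fun n => ae_of_all _ fun ω => ?_) (ae_of_all _ fun ω => ?_)
    · exact hY.aestronglyMeasurable.sup aestronglyMeasurable_const
    · have : (0 : ℝ) ≤ n := n.cast_nonneg
      rw [Real.norm_eq_abs, abs_le]
      constructor
      · exact (neg_abs_le _).trans (le_max_left _ _)
      · exact max_le (le_abs_self _) (by linarith [abs_nonneg (Y ω)])
    · refine tendsto_const_nhds.congr' ?_
      filter_upwards [eventually_ge_atTop ⌈-Y ω⌉₊] with n hn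
      rw [max_eq_left]
      have : -Y ω ≤ n := Nat.ceil_le.1 hn
      linarith
  obtain ⟨n, hn⟩ := (hlim.eventually (gt_mem_nhds hneg)).exists
  exact ⟨n, n.cast_nonneg, hn⟩

namespace NegativeDrift
variable [IsProbabilityMeasure μ]

lemma integrable_max (h : NegativeDrift μ X a) (K : ℝ) :
    Integrable (fun ω => max (X 0 ω) (-K)) μ :=
  h.int.sup (integrable_const _)

/-- The mean of `τ` is finite: with the increments truncated below at `-K`, where their mean is
still negative, the walk stopped at `min τ n` is at least `-K`. -/
lemma summable_alive (h : NegativeDrift μ X a) : Summable fun k => μ.real (alive X k) := by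
  obtain ⟨K, hK, hneg⟩ := exists_integral_max_neg h.int (by rw [h.mean]; linarith [h.pos])
  set b := -∫ ω, max (X 0 ω) (-K) ∂μ with hb
  have hbpos : 0 < b := by linarith
  refine summable_of_sum_range_le (c := K / b) (fun _ => measureReal_nonneg) fun n => ?_
  have hint : ∀ k, Integrable ((alive X k).indicator (fun ω => max (X k ω) (-K))) μ := fun k =>
    (h.integrable_comp k (f := fun x => max x (-K)) (by fun_prop) (h.integrable_max K)).indicator
      (measurableSet_alive h.meas k)
  have h1 : -K ≤ ∫ ω, ∑ k ∈ Finset.range n,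
      (alive X k).indicator (fun ω => max (X k ω) (-K)) ω ∂μ := by
    calc -K = ∫ _, -K ∂μ := by simp
      _ ≤ _ := integral_mono (integrable_const _) (integrable_finsetSum _ fun k _ => hint k)
        fun ω => neg_le_sum_indicator_alive hK ω n
  rw [integral_finsetSum _ fun k _ => hint k] at h1
  have h2 : ∀ k, ∫ ω, (alive X k).indicator (fun ω => max (X k ω) (-K)) ω ∂μ =
      μ.real (alive X k) * -b := by
    intro k
    rw [integral_indicator (measurableSet_alive h.meas k),
      h.setIntegral_past_comp (measurableSet_alive_past X k) (f := fun x => max x (-K))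
        (by fun_prop) (h.integrable_max K), hb, neg_neg]
  simp_rw [h2] at h1
  rw [← Finset.sum_mul] at h1
  rw [le_div_iff₀ hbpos]
  linarith

/-- The mean exit time as a real number, `E τ = ∑ P(τ > k)`. -/
lemma toReal_meanExitTime (h : NegativeDrift μ X a) :
    meanExitTime μ X ≠ ⊤ ∧ (meanExitTime μ X).toReal = ∑' k, μ.real (alive X k) := by
  rw [meanExitTime_eq_tsum h.meas]
  constructor
  · have := h.summable_alive.tsum_ofReal_ne_top
    simpa [measureReal_def] using this
  · rw [ENNReal.tsum_toReal_eq fun k => measure_ne_top _ _]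
    rfl

lemma one_le_tsum_alive (h : NegativeDrift μ X a) : 1 ≤ ∑' k, μ.real (alive X k) := by
  have := h.summable_alive.le_tsum 0 (fun _ _ => measureReal_nonneg)
  simpa [alive_zero] using this

lemma ae_exists_not_alive (h : NegativeDrift μ X a) : ∀ᵐ ω ∂μ, ∃ k, ω ∉ alive X k := by
  have h0 : Tendsto (fun k => μ.real (alive X k)) atTop (𝓝 0) := h.summable_alive.tendsto_atTop_zero
  have h1 : μ.real (⋂ k, alive X k) ≤ 0 :=
    ge_of_tendsto' h0 fun k => measureReal_mono (iInter_subset _ k)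
  have h2 : μ (⋂ k, alive X k) = 0 := by
    have := le_antisymm h1 measureReal_nonneg
    rwa [measureReal_eq_zero_iff] at this
  rw [ae_iff]
  convert h2 using 2
  ext ω
  simp

end NegativeDrift

/-- The probability that `y` is crossed before the exit, as a sum over the crossing time. -/
lemma hasSum_crossing [IsFiniteMeasure μ] (hX : ∀ k, Measurable (X k)) (y : ℝ) :
    HasSum (fun k => μ.real (crossing X y k)) (μ.real (⋃ k, crossing X y k)) :=
  by
  have h := measure_iUnion (μ := μ) (crossing_disjoint X y) fun k => measurableSet_crossing hX y k
  rw [measureReal_def, h, ENNReal.tsum_toReal_eq fun k => measure_ne_top _ _]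
  exact (ENNReal.summable_toReal (by rw [← h]; exact measure_ne_top _ _)).hasSum

end

/-! ### Fluctuations around the mean -/

section

variable {Ω : Type*}

lemma past_mono (Y : ℕ → Ω → ℝ) : Monotone (past Y) := fun _ _ h =>
  biSup_mono fun _ hi => lt_of_lt_of_le hi h

lemma abs_walk_le {Y : ℕ → Ω → ℝ} {B : ℝ} (hB : ∀ i ω, |Y i ω| ≤ B) (n : ℕ)
    (ω : Ω) : |walk Y n ω| ≤ n * B := by
  refine (Finset.abs_sum_le_sum_abs _ _).trans ?_
  calc ∑ k ∈ Finset.range n, |Y k ω| ≤ ∑ _k ∈ Finset.range n, B :=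
        Finset.sum_le_sum fun k _ => hB k ω
    _ = n * B := by simp

variable [MeasurableSpace Ω] {μ : Measure Ω} {X : ℕ → Ω → ℝ} {a : ℝ}

section Kolmogorov
variable [IsProbabilityMeasure μ] {Y : ℕ → Ω → ℝ}

lemma integrable_walk_sq (hY : ∀ i, Measurable (Y i)) {B : ℝ} (hB : ∀ i ω, |Y i ω| ≤ B) (n : ℕ) :
    Integrable (fun ω => walk Y n ω ^ 2) μ := by
  refine Integrable.of_bound ((measurable_walk hY n).pow_const 2).aestronglyMeasurable
    ((n * B) ^ 2) (ae_of_all _ fun ω => ?_)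
  rw [Real.norm_eq_abs, abs_pow]
  exact pow_le_pow_left₀ (abs_nonneg _) (abs_walk_le hB n ω) 2

lemma integrable_sq_of_abs_le (hY : ∀ i, Measurable (Y i)) {B : ℝ} (hB : ∀ i ω, |Y i ω| ≤ B)
    (n : ℕ) : Integrable (fun ω => Y n ω ^ 2) μ := by
  refine Integrable.of_bound ((hY n).pow_const 2).aestronglyMeasurable (B ^ 2)
    (ae_of_all _ fun ω => ?_)
  rw [Real.norm_eq_abs, abs_pow]
  exact pow_le_pow_left₀ (abs_nonneg _) (hB n ω) 2

lemma setIntegral_walk_succ_sq (hY : ∀ i, Measurable (Y i)) (hi : iIndepFun Y μ) {B : ℝ}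
    (hB : ∀ i ω, |Y i ω| ≤ B) (h0 : ∀ i, ∫ ω, Y i ω ∂μ = 0) {n : ℕ} {s : Set Ω}
    (hs : MeasurableSet[past Y n] s) :
    ∫ ω in s, walk Y (n + 1) ω ^ 2 ∂μ = ∫ ω in s, walk Y n ω ^ 2 ∂μ + ∫ ω in s, Y n ω ^ 2 ∂μ := by
  have hsm := past_le hY n _ hs
  have hW : Measurable[past Y n] (s.indicator (walk Y n)) :=
    (measurable_walk_past Y le_rfl).indicator hs
  have hind : IndepFun (s.indicator (walk Y n)) (Y n) μ := by
    rw [IndepFun_iff_Indep]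
    exact indep_of_indep_of_le (indep_past_future hY hi n) hW.comap_le
      (measurable_future Y le_rfl).comap_le
  have hzero : ∫ ω in s, walk Y n ω * Y n ω ∂μ = 0 := by
    have h1 := hind.integral_fun_mul_eq_mul_integral
      (hW.mono (past_le hY n) le_rfl).aestronglyMeasurable (hY n).aestronglyMeasurable
    rw [h0 n, mul_zero] at h1
    rw [← integral_indicator hsm, ← h1]
    refine integral_congr_ae (ae_of_all _ fun ω => ?_)
    by_cases hω : ω ∈ s <;> simp [hω]
  have hint : Integrable (fun ω => walk Y n ω * Y n ω) μ := by
    refine Integrable.of_bound ((measurable_walk hY n).mul (hY n)).aestronglyMeasurable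
      (n * B * B) (ae_of_all _ fun ω => ?_)
    rw [Real.norm_eq_abs, abs_mul]
    have := abs_walk_le hB n ω
    exact mul_le_mul this (hB n ω) (abs_nonneg _) ((abs_nonneg _).trans this)
  have hexp : ∀ ω, walk Y (n + 1) ω ^ 2 =
      walk Y n ω ^ 2 + 2 * (walk Y n ω * Y n ω) + Y n ω ^ 2 := fun ω => by
    rw [walk_succ]; ring
  simp_rw [hexp]
  have i1 := (integrable_walk_sq (μ := μ) hY hB n).integrableOn (s := s)
  have i2 := (hint.const_mul 2).integrableOn (s := s)
  have i3 := (integrable_sq_of_abs_le (μ := μ) hY hB n).integrableOn (s := s)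
  have i12 : IntegrableOn (fun ω => walk Y n ω ^ 2 + 2 * (walk Y n ω * Y n ω)) s μ := i1.add i2
  rw [integral_add i12 i3, integral_add i1 i2, integral_const_mul, hzero]
  ring

/-- Kolmogorov's maximal inequality for bounded increments. -/
lemma measureReal_exists_le_abs_walk (hY : ∀ i, Measurable (Y i)) (hi : iIndepFun Y μ) {B : ℝ}
    (hB : ∀ i ω, |Y i ω| ≤ B) (h0 : ∀ i, ∫ ω, Y i ω ∂μ = 0) {v : ℝ}
    (hv : ∀ i, ∫ ω, Y i ω ^ 2 ∂μ ≤ v) {c : ℝ} (hc : 0 < c) (n : ℕ) :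
    μ.real {ω | ∃ j ≤ n, c ≤ |walk Y j ω|} ≤ n * v / c ^ 2 := by
  let 𝒢 : Filtration ℕ ‹MeasurableSpace Ω› := ⟨past Y, past_mono Y, past_le hY⟩
  have hsub : Submartingale (fun j ω => walk Y j ω ^ 2) 𝒢 μ := by
    refine submartingale_of_setIntegral_le_succ
      (fun j => ((measurable_walk_past Y le_rfl).pow_const 2).stronglyMeasurable)
      (fun j => integrable_walk_sq hY hB j) fun j s hs => ?_
    rw [setIntegral_walk_succ_sq hY hi hB h0 hs]
    linarith [integral_nonneg (μ := μ.restrict s) (f := fun ω => Y j ω ^ 2) fun ω => sq_nonneg _]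
  have hmean : ∀ n, ∫ ω, walk Y n ω ^ 2 ∂μ ≤ n * v := by
    intro n
    induction n with
    | zero => simp
    | succ n ih =>
      have := setIntegral_walk_succ_sq hY hi hB h0 (n := n) (@MeasurableSet.univ _ (past Y n))
      simp only [Measure.restrict_univ] at this
      rw [this]; push_cast; linarith [hv n]
  have hmax := maximal_ineq hsub (fun j ω => sq_nonneg _) (ε := ⟨c ^ 2, sq_nonneg c⟩) n
  set A := {ω | ((⟨c ^ 2, sq_nonneg c⟩ : NNReal) : ℝ) ≤
    (Finset.range (n + 1)).sup' Finset.nonempty_range_add_one fun k => walk Y k ω ^ 2} with hA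
  have hAeq : {ω | ∃ j ≤ n, c ≤ |walk Y j ω|} = A := by
    ext ω
    simp only [hA, mem_ofPred_eq, Finset.le_sup'_iff, Finset.mem_range,
      Nat.lt_succ_iff]
    refine exists_congr fun j => and_congr_right fun _ => ?_
    rw [← sq_abs (walk Y j ω)]
    exact (pow_le_pow_iff_left₀ hc.le (abs_nonneg _) two_ne_zero).symm
  rw [hAeq, le_div_iff₀ (by positivity)]
  have h1 : ∫ ω in A, walk Y n ω ^ 2 ∂μ ≤ n * v :=
    (setIntegral_le_integral (integrable_walk_sq hY hB n) (ae_of_all _ fun ω => sq_nonneg _)).trans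
      (hmean n)
  have h2 := ENNReal.toReal_mono ENNReal.ofReal_ne_top hmax
  rw [ENNReal.toReal_mul, ENNReal.toReal_ofReal (integral_nonneg fun ω => sq_nonneg _)] at h2
  have h3 : c ^ 2 * μ.real A ≤ ∫ ω in A, walk Y n ω ^ 2 ∂μ := h2
  linarith

end Kolmogorov

/-- `E min(|X|/c, (X/c)²)`, which controls the fluctuations of the walk at scale `c`. -/
def truncMoment (μ : Measure Ω) (X : ℕ → Ω → ℝ) (c : ℝ) : ℝ :=
  ∫ ω, min (|X 0 ω| / c) ((X 0 ω / c) ^ 2) ∂μ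

/-- The event that one of the first `n` values of the walk is further than `d` from its mean. -/
def deviates (X : ℕ → Ω → ℝ) (a d : ℝ) (n : ℕ) : Set Ω :=
  {ω | ∃ j ≤ n, d < |walk X j ω + a * j|}

namespace NegativeDrift

lemma integrable_truncMoment (h : NegativeDrift μ X a) {c : ℝ} (hc : 0 < c) :
    Integrable (fun ω => min (|X 0 ω| / c) ((X 0 ω / c) ^ 2)) μ := by
  have hm := h.meas 0
  refine (h.int.abs.div_const c).mono' (by fun_prop) (ae_of_all _ fun ω => ?_)
  rw [Real.norm_of_nonneg (by positivity)]
  exact min_le_left _ _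

lemma truncMoment_shift (h : NegativeDrift μ X a) (k : ℕ) (c : ℝ) :
    truncMoment μ (fun i => X (k + i)) c = truncMoment μ X c :=
  h.integral_comp (k + 0) (f := fun x => min (|x| / c) ((x / c) ^ 2)) (by fun_prop)

variable [IsProbabilityMeasure μ]

/-- Truncation at `c` followed by Kolmogorov's inequality. -/
lemma measureReal_deviates_le (h : NegativeDrift μ X a) {c : ℝ} (hc : 0 < c) (n : ℕ) :
    μ.real (deviates X a (2 * c) n) ≤ 2 * (n * truncMoment μ X c) := by
  set ρ := truncMoment μ X c with hρ
  have hρ0 : 0 ≤ ρ := integral_nonneg fun ω => by positivity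
  rcases lt_or_ge 1 (n * ρ) with hbig | hsmall
  · exact measureReal_le_one.trans (by linarith)
  let t : ℝ → ℝ := fun x => if |x| ≤ c then x else 0
  have ht : Measurable t := Measurable.ite (measurableSet_le (by fun_prop) (by fun_prop))
    measurable_id measurable_const
  have htb : ∀ x, |t x| ≤ c := fun x => by
    by_cases hx : |x| ≤ c <;> simp [t, hx, hc.le]
  have htint : ∀ i, Integrable (fun ω => t (X i ω)) μ := fun i =>
    Integrable.of_bound (ht.comp (h.meas i)).aestronglyMeasurable c (ae_of_all _ fun ω => htb _)
  set m := ∫ ω, t (X 0 ω) ∂μ with hm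
  let Y : ℕ → Ω → ℝ := fun i ω => t (X i ω) - m
  have hY : ∀ i, Measurable (Y i) := fun i => (ht.comp (h.meas i)).sub_const m
  have hYi : iIndepFun Y μ := h.indep.comp (fun _ x => t x - m) fun _ => ht.sub_const m
  have hYB : ∀ i ω, |Y i ω| ≤ c + |m| := fun i ω =>
    (abs_sub _ _).trans (add_le_add_left (htb _) _)
  have hY0 : ∀ i, ∫ ω, Y i ω ∂μ = 0 := fun i => by
    simp only [Y]
    rw [integral_sub (htint i) (integrable_const _), h.integral_comp i ht]
    simp [hm]
  have hkey := h.integrable_truncMoment hc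
  -- the variance of the truncated increments
  have hYv : ∀ i, ∫ ω, Y i ω ^ 2 ∂μ ≤ c ^ 2 * ρ := fun i => by
    have htsq : Integrable (fun ω => t (X i ω) ^ 2) μ := by
      have := integrable_sq_of_abs_le (μ := μ) (Y := fun i ω => t (X i ω))
        (fun i => ht.comp (h.meas i)) (fun i ω => htb (X i ω)) i
      exact this
    have e1 : ∫ ω, Y i ω ^ 2 ∂μ = ∫ ω, t (X i ω) ^ 2 ∂μ - m ^ 2 := by
      have : ∀ ω, Y i ω ^ 2 = t (X i ω) ^ 2 - 2 * m * t (X i ω) + m ^ 2 := fun ω => by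
        simp only [Y]; ring
      simp_rw [this]
      have i12 : Integrable (fun ω => t (X i ω) ^ 2 - 2 * m * t (X i ω)) μ :=
        htsq.sub ((htint i).const_mul _)
      rw [integral_add i12 (integrable_const _),
        integral_sub htsq ((htint i).const_mul _), integral_const_mul, h.integral_comp i ht, ← hm]
      simp; ring
    have e2 : ∫ ω, t (X i ω) ^ 2 ∂μ ≤ c ^ 2 * ρ := by
      rw [h.integral_comp i (f := fun x => t x ^ 2) (ht.pow_const 2), hρ, truncMoment,
        ← integral_const_mul]
      refine integral_mono_of_nonneg (ae_of_all _ fun ω => sq_nonneg _) (hkey.const_mul _)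
        (ae_of_all _ fun ω => ?_)
      simp only [t]
      split_ifs with hx
      · have h1 : |X 0 ω| / c ≤ 1 := (div_le_one hc).2 hx
        have h2 : (X 0 ω / c) ^ 2 ≤ |X 0 ω| / c := by
          have : (X 0 ω / c) ^ 2 = (|X 0 ω| / c) ^ 2 := by rw [div_pow, div_pow, sq_abs]
          rw [this, sq]
          exact mul_le_of_le_one_left (by positivity) h1
        rw [min_eq_right h2, div_pow, mul_div_cancel₀ _ (by positivity)]
      · have : 0 ≤ min (|X 0 ω| / c) ((X 0 ω / c) ^ 2) := by positivity
        nlinarith [sq_nonneg c]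
    linarith [sq_nonneg m]
  -- outside `[-c, c]`
  have hout : ∀ ω, c < |X 0 ω| →
      min (|X 0 ω| / c) ((X 0 ω / c) ^ 2) = |X 0 ω| / c ∧ 1 < |X 0 ω| / c := fun ω hx => by
    have h1 : 1 < |X 0 ω| / c := (one_lt_div hc).2 hx
    refine ⟨min_eq_left ?_, h1⟩
    have : (X 0 ω / c) ^ 2 = (|X 0 ω| / c) ^ 2 := by rw [div_pow, div_pow, sq_abs]
    rw [this, sq]
    exact le_mul_of_one_le_left (by positivity) h1.le
  have hbias : |m + a| ≤ c * ρ := by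
    have e1 : m + a = ∫ ω, (t (X 0 ω) - X 0 ω) ∂μ := by
      rw [integral_sub (htint 0) h.int, h.mean, ← hm]; ring
    rw [e1, hρ, truncMoment, ← integral_const_mul]
    refine (abs_integral_le_integral_abs).trans (integral_mono_of_nonneg
      (ae_of_all _ fun ω => abs_nonneg _) (hkey.const_mul _) (ae_of_all _ fun ω => ?_))
    simp only [t]
    split_ifs with hx
    · rw [sub_self, abs_zero]; positivity
    · rw [(hout ω (not_le.1 hx)).1, mul_div_cancel₀ _ hc.ne', zero_sub, abs_neg]
  have hjump : ∀ i, μ.real {ω | c < |X i ω|} ≤ ρ := fun i => by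
    have e0 : μ.real {ω | c < |X i ω|} = μ.real {ω | c < |X 0 ω|} := by
      rw [measureReal_def, measureReal_def]
      congr 1
      exact (h.ident i).measure_mem_eq (s := {x | c < |x|})
        (measurableSet_lt (by fun_prop) (by fun_prop))
    have hms : MeasurableSet {ω | c < |X 0 ω|} := measurableSet_lt measurable_const (h.meas 0).abs
    rw [e0, ← integral_indicator_one hms, hρ, truncMoment]
    refine integral_mono_of_nonneg
      (ae_of_all _ fun ω => indicator_nonneg (fun _ _ => zero_le_one) _) hkey
      (ae_of_all _ fun ω => ?_)
    by_cases hx : c < |X 0 ω|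
    · have := hout ω hx
      simp only [indicator, mem_ofPred_eq, hx, if_true, Pi.one_apply, this.1]
      exact this.2.le
    · simp only [indicator, mem_ofPred_eq, hx, if_false]; positivity
  have hsub : deviates X a (2 * c) n ⊆
      (⋃ i ∈ Finset.range n, {ω | c < |X i ω|}) ∪ {ω | ∃ j ≤ n, c ≤ |walk Y j ω|} := by
    rintro ω ⟨j, hj, hd⟩
    by_cases hω : ∃ i < n, c < |X i ω|
    · left; simpa using hω
    push Not at hω
    refine Or.inr ⟨j, hj, ?_⟩
    have e1 : walk Y j ω = walk X j ω - j * m := by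
      simp only [walk, Y]
      have e0 : ∀ i ∈ Finset.range j, t (X i ω) = X i ω := fun i hi => by
        simp [t, hω i ((Finset.mem_range.1 hi).trans_le hj)]
      rw [Finset.sum_sub_distrib, Finset.sum_congr rfl e0]
      simp
    have e2 : walk X j ω + a * j = walk Y j ω + j * (m + a) := by rw [e1]; ring
    rw [e2] at hd
    have e3 : |(j : ℝ) * (m + a)| ≤ c := by
      rw [abs_mul, Nat.abs_cast]
      calc (j : ℝ) * |m + a| ≤ n * (c * ρ) :=
            mul_le_mul (by exact_mod_cast hj) hbias (abs_nonneg _) (by positivity)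
        _ = c * (n * ρ) := by ring
        _ ≤ c := mul_le_of_le_one_right hc.le hsmall
    linarith [abs_add_le (walk Y j ω) (j * (m + a))]
  calc μ.real (deviates X a (2 * c) n)
      ≤ μ.real (⋃ i ∈ Finset.range n, {ω | c < |X i ω|}) +
        μ.real {ω | ∃ j ≤ n, c ≤ |walk Y j ω|} :=
        (measureReal_mono hsub).trans (measureReal_union_le _ _)
    _ ≤ n * ρ + n * (c ^ 2 * ρ) / c ^ 2 := by
        refine add_le_add ?_ (measureReal_exists_le_abs_walk hY hYi hYB hY0 hYv hc n)
        refine (measureReal_biUnion_finset_le _ _).trans ?_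
        calc _ ≤ ∑ _i ∈ Finset.range n, ρ := Finset.sum_le_sum fun i _ => hjump i
          _ = n * ρ := by simp
    _ = 2 * (n * ρ) := by field_simp; ring

/-- If `z E min(|X|/s, (X/s)²) → 0` for a scale `s = s(z)`, then over a time of order `z` the walk
started afresh at any time stays within `θ s` of its mean, up to a small probability. -/
lemma eventually_measureReal_deviates_le (h : NegativeDrift μ X a) {s : ℝ → ℝ}
    (hs : ∀ᶠ z in atTop, 0 < s z)
    (hlim : Tendsto (fun z => z * truncMoment μ X (s z)) atTop (𝓝 0)) {θ C δ : ℝ}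
    (hθ : 0 < θ) (hθ2 : θ ≤ 2) (hC : 0 < C) (hδ : 0 < δ) :
    ∀ᶠ z in atTop, ∀ (k n : ℕ), (n : ℝ) ≤ C * z →
      μ.real (deviates (fun i => X (k + i)) a (θ * s z) n) ≤ δ := by
  have h1 : ∀ᶠ z in atTop, z * truncMoment μ X (s z) < δ / (2 * C * (2 / θ) ^ 2) :=
    hlim.eventually (gt_mem_nhds (by positivity))
  filter_upwards [h1, hs, eventually_gt_atTop 0] with z hz hsz hz0 k n hn
  have hc : 0 < θ / 2 * s z := by positivity
  have h2 := (h.shift k).measureReal_deviates_le hc n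
  rw [h.truncMoment_shift, show 2 * (θ / 2 * s z) = θ * s z by ring] at h2
  have h3 : truncMoment μ X (θ / 2 * s z) ≤ (2 / θ) ^ 2 * truncMoment μ X (s z) := by
    unfold truncMoment
    rw [← integral_const_mul]
    refine integral_mono (h.integrable_truncMoment hc)
      ((h.integrable_truncMoment hsz).const_mul _) fun ω => ?_
    have hge : 1 ≤ 2 / θ := (one_le_div hθ).2 hθ2
    simp only
    rw [mul_min_of_nonneg _ _ (by positivity)]
    refine min_le_min ?_ (le_of_eq ?_)
    · calc |X 0 ω| / (θ / 2 * s z) = (2 / θ) * (|X 0 ω| / s z) := by field_simp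
        _ ≤ (2 / θ) ^ 2 * (|X 0 ω| / s z) :=
          mul_le_mul_of_nonneg_right (le_self_pow₀ hge two_ne_zero) (by positivity)
    · field_simp
  have hρ0 : 0 ≤ truncMoment μ X (s z) := integral_nonneg fun ω => by positivity
  calc _ ≤ 2 * (n * truncMoment μ X (θ / 2 * s z)) := h2
    _ ≤ 2 * (C * z * ((2 / θ) ^ 2 * truncMoment μ X (s z))) := by
        have : 0 ≤ truncMoment μ X (θ / 2 * s z) := integral_nonneg fun ω => by positivity
        gcongr
    _ = (2 * C * (2 / θ) ^ 2) * (z * truncMoment μ X (s z)) := by ring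
    _ ≤ (2 * C * (2 / θ) ^ 2) * (δ / (2 * C * (2 / θ) ^ 2)) := by gcongr
    _ = δ := by field_simp

end NegativeDrift

end

/-! ### Strongly subexponential tails -/

section

variable {Ω : Type*}

/-- The two properties of a tail `F` behind the single big jump principle: `F` is long-tailed, and
`F t F(w - t) / F w` is dominated by an integrable function of `t ∈ (0, w/2]`. They imply
`∫₀ʷ F(t) F(w - t) dt ∼ 2 F(w) ∫₀^∞ F`, i.e. that `F` is strongly subexponential. -/
structure HeavyTail (F : ℝ → ℝ) : Prop where
  pos : ∀ w, 0 < F w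
  long : ∀ K δ : ℝ, 0 < δ → ∀ᶠ w in atTop, F (w - K) ≤ (1 + δ) * F w
  dom : ∃ D : ℝ → ℝ, IntegrableOn D (Ioi 0) ∧
    ∀ᶠ w in atTop, ∀ t, 0 < t → t ≤ w / 2 → F t * F (w - t) ≤ D t * F w

lemma HeavyTail.eventually_convolution_le {F : ℝ → ℝ} (hF : HeavyTail F) (hanti : Antitone F)
    {η : ℝ} (hη : 0 < η) :
    ∀ᶠ w in atTop, ∫ t in (0 : ℝ)..w, F t * F (w - t) ≤ (2 * (∫ t in Ioi 0, F t) + η) * F w := by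
  obtain ⟨D, hD, hdom⟩ := hF.dom
  have hmeas : Measurable F := hanti.measurable
  have hratio : ∀ t, 0 ≤ t → Tendsto (fun w => F (w - t) / F w) atTop (𝓝 1) := fun t ht => by
    rw [Metric.tendsto_nhds]
    intro ε hε
    filter_upwards [hF.long t (ε / 2) (by positivity)] with w hw
    have h1 : 1 ≤ F (w - t) / F w := (one_le_div (hF.pos w)).2 (hanti (by linarith))
    have h2 : F (w - t) / F w ≤ 1 + ε / 2 := (div_le_iff₀ (hF.pos w)).2 hw
    rw [Real.dist_eq, abs_of_nonneg (by linarith)]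
    linarith
  have hlim : Tendsto (fun w : ℝ => ∫ t in Ioi 0,
      (Iic (w / 2)).indicator (fun t => F t * F (w - t) / F w) t) atTop
      (𝓝 (∫ t in Ioi 0, F t)) := by
    refine tendsto_integral_filter_of_dominated_convergence D ?_ ?_ hD ?_
    · refine Eventually.of_forall fun w => ?_
      refine (Measurable.indicator ?_ measurableSet_Iic).aestronglyMeasurable
      have : Measurable fun t => F (w - t) := hmeas.comp (by fun_prop)
      fun_prop
    · filter_upwards [hdom] with w hw
      refine (ae_restrict_iff' measurableSet_Ioi).2 (ae_of_all _ fun t ht => ?_)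
      by_cases h2 : t ≤ w / 2
      · rw [indicator_of_mem (by exact h2), Real.norm_of_nonneg (by
          have := hF.pos t; have := hF.pos (w - t); have := hF.pos w; positivity)]
        exact (div_le_iff₀ (hF.pos w)).2 (hw t ht h2)
      · rw [indicator_of_notMem (by exact h2), norm_zero]
        -- the dominating function is nonnegative: look at a large argument
        obtain ⟨v, hv1, hv2⟩ := (hdom.and (eventually_ge_atTop (2 * t))).exists
        have := hv1 t ht (by linarith)
        have h3 : 0 < D t * F v := (mul_pos (hF.pos t) (hF.pos (v - t))).trans_le this
        exact (pos_of_mul_pos_left h3 (hF.pos v).le).le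
    · refine (ae_restrict_iff' measurableSet_Ioi).2 (ae_of_all _ fun t ht => ?_)
      have h1 := (hratio t (le_of_lt ht)).const_mul (F t)
      rw [mul_one] at h1
      refine h1.congr' ?_
      filter_upwards [eventually_ge_atTop (2 * t)] with w hw
      rw [indicator_of_mem (by show t ≤ w / 2; linarith), mul_div_assoc]
  filter_upwards [hlim.eventually (gt_mem_nhds (by linarith : (∫ t in Ioi 0, F t) <
    (∫ t in Ioi 0, F t) + η / 2)), eventually_gt_atTop 0] with w hw hw0
  have e1 : ∫ t in Ioi 0, (Iic (w / 2)).indicator (fun t => F t * F (w - t) / F w) t =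
      (∫ t in (0 : ℝ)..(w / 2), F t * F (w - t)) / F w := by
    rw [setIntegral_indicator measurableSet_Iic, Ioi_inter_Iic,
      ← intervalIntegral.integral_of_le (by linarith), intervalIntegral.integral_div]
  have hint : ∀ p q, IntervalIntegrable (fun t => F t * F (w - t)) volume p q := fun p q => by
    have h1 : IntervalIntegrable F volume p q := hanti.intervalIntegrable
    rw [intervalIntegrable_iff] at h1 ⊢
    refine h1.mul_bdd (c := max |F (w - p)| |F (w - q)|) ?_ ?_
    · exact (hmeas.comp (by fun_prop)).aestronglyMeasurable
    · refine (ae_restrict_iff' measurableSet_uIoc).2 (ae_of_all _ fun t ht => ?_)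
      rw [Real.norm_eq_abs, abs_of_pos (hF.pos _), abs_of_pos (hF.pos _), abs_of_pos (hF.pos _)]
      rcases mem_uIoc.1 ht with h | h
      · exact le_max_of_le_right (hanti (by linarith [h.2]))
      · exact le_max_of_le_left (hanti (by linarith [h.2]))
  have e2 : ∫ t in (w / 2)..w, F t * F (w - t) = ∫ t in (0 : ℝ)..(w / 2), F t * F (w - t) := by
    have := intervalIntegral.integral_comp_sub_left (a := 0) (b := w / 2)
      (fun t => F t * F (w - t)) w
    rw [show w - w / 2 = w / 2 by ring, sub_zero] at this
    rw [← this]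
    refine intervalIntegral.integral_congr fun t _ => ?_
    simp only [sub_sub_cancel]; ring
  rw [← intervalIntegral.integral_add_adjacent_intervals (hint 0 (w / 2)) (hint (w / 2) w), e2]
  rw [e1, div_lt_iff₀ (hF.pos w)] at hw
  linarith

/-! ### The test function -/

/-- The test function `q(u) = ∫₀^{min(u, b)} F(y - s) ds`. -/
def testFun (F : ℝ → ℝ) (y b u : ℝ) : ℝ := ∫ s in (0 : ℝ)..(min u b), F (y - s)

lemma intervalIntegrable_sub {F : ℝ → ℝ} (hanti : Antitone F) (y p q : ℝ) :
    IntervalIntegrable (fun s => F (y - s)) volume p q :=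
  Monotone.intervalIntegrable fun _ _ h => hanti (by linarith)

lemma testFun_zero (F : ℝ → ℝ) (y : ℝ) {b : ℝ} (hb : 0 ≤ b) : testFun F y b 0 = 0 := by
  simp [testFun, hb]

lemma testFun_of_le (F : ℝ → ℝ) (y : ℝ) {b u : ℝ} (hu : b ≤ u) :
    testFun F y b u = ∫ s in (0 : ℝ)..b, F (y - s) := by
  simp [testFun, hu]

lemma mul_le_testFun {F : ℝ → ℝ} (hanti : Antitone F) (y : ℝ) {b u : ℝ} (hb : 0 ≤ b) (hu : u ≤ 0) :
    F y * u ≤ testFun F y b u := by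
  rw [testFun, min_eq_left (hu.trans hb), intervalIntegral.integral_symm]
  have : ∫ s in u..0, F (y - s) ≤ ∫ _ in u..0, F y := by
    -- on `(u, 0)` the argument `y - s` is at least `y`
    refine intervalIntegral.integral_mono_on hu (intervalIntegrable_sub hanti y _ _) (by simp)
      fun s hs => hanti (by linarith [hs.2])
  simp only [intervalIntegral.integral_const, smul_eq_mul] at this
  linarith

lemma abs_testFun_sub_le {F : ℝ → ℝ} (hanti : Antitone F) (h0 : ∀ w, 0 ≤ F w) (h1 : ∀ w, F w ≤ 1)
    (y b u v : ℝ) : |testFun F y b u - testFun F y b v| ≤ |u - v| := by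
  unfold testFun
  rw [intervalIntegral.integral_interval_sub_left (intervalIntegrable_sub hanti y _ _)
    (intervalIntegrable_sub hanti y _ _)]
  have := intervalIntegral.norm_integral_le_of_norm_le_const (a := min v b) (b := min u b)
    (f := fun s => F (y - s)) (C := 1) fun s _ => by
      rw [Real.norm_eq_abs, abs_of_nonneg (h0 _)]; exact h1 _
  rw [one_mul, Real.norm_eq_abs] at this
  refine this.trans ((abs_min_sub_min_le_max u b v b).trans ?_)
  simp

lemma measurable_testFun {F : ℝ → ℝ} (hanti : Antitone F) (h0 : ∀ w, 0 ≤ F w) (h1 : ∀ w, F w ≤ 1)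
    (y b : ℝ) : Measurable (testFun F y b) := by
  refine (LipschitzWith.of_dist_le_mul (K := 1) fun u v => ?_).continuous.measurable
  simpa [Real.dist_eq] using abs_testFun_sub_le hanti h0 h1 y b u v

lemma testFun_add_sub {F : ℝ → ℝ} (hanti : Antitone F) (y : ℝ) {b u : ℝ} (hu : u ≤ b) (x : ℝ) :
    testFun F y b (u + x) - testFun F y b u =
      ∫ t in (0 : ℝ)..(min x (b - u)), F (y - u - t) := by
  unfold testFun
  rw [intervalIntegral.integral_interval_sub_left (intervalIntegrable_sub hanti y _ _)
    (intervalIntegrable_sub hanti y _ _), min_eq_left hu]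
  have := intervalIntegral.integral_comp_add_right (a := 0) (b := min x (b - u))
    (fun s => F (y - s)) u
  rw [zero_add, ← min_add_add_right, sub_add_cancel, add_comm x u] at this
  rw [← this]
  exact intervalIntegral.integral_congr fun t _ => by
    show F _ = F _
    congr 1; ring

/-- An upper bound for an increment of the test function: a positive part, to be integrated with the
layer cake formula, and a negative part that is linear down to `-K`. -/
lemma testFun_add_sub_le {F : ℝ → ℝ} (hanti : Antitone F) (h0 : ∀ w, 0 ≤ F w) (y : ℝ) {b u K : ℝ}
    (hu : u ≤ b) (hK : 0 ≤ K) (x : ℝ) :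
    testFun F y b (u + x) - testFun F y b u ≤
      (∫ t in (0 : ℝ)..(max x 0), (Iic (b - u)).indicator (fun t => F (y - u - t)) t) -
        F (y - u + K) * min (max (-x) 0) K := by
  rw [testFun_add_sub hanti y hu]
  set w := y - u
  have hc : 0 ≤ b - u := by linarith
  rcases le_total 0 x with hx | hx
  · rw [max_eq_left hx, max_eq_right (by linarith : -x ≤ 0), min_eq_left hK, mul_zero, sub_zero,
      intervalIntegral.integral_of_le (le_min hx hc), intervalIntegral.integral_of_le hx,
      setIntegral_indicator measurableSet_Iic, Ioc_inter_Iic]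
  · rw [max_eq_right hx, max_eq_left (by linarith : 0 ≤ -x), intervalIntegral.integral_same,
      min_eq_left (hx.trans hc), intervalIntegral.integral_symm, zero_sub, neg_le_neg_iff]
    set k := min (-x) K
    have hk0 : 0 ≤ k := le_min (by linarith) hK
    have hkx : k ≤ -x := min_le_left _ _
    have hkK : k ≤ K := min_le_right _ _
    calc F (w + K) * k = ∫ _ in (-k)..0, F (w + K) := by simp; ring
      _ ≤ ∫ t in (-k)..0, F (w - t) :=
          intervalIntegral.integral_mono_on (by linarith) (by simp)
            (intervalIntegrable_sub hanti w _ _) fun t ht => hanti (by linarith [ht.1])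
      _ ≤ ∫ t in x..0, F (w - t) :=
          intervalIntegral.integral_mono_interval (by linarith) (by linarith) le_rfl
            (ae_of_all _ fun t => h0 _) (intervalIntegrable_sub hanti w _ _)

variable [MeasurableSpace Ω] {μ : Measure Ω} {X : ℕ → Ω → ℝ} {a : ℝ}

lemma tail_antitone [IsFiniteMeasure μ] : Antitone (tail μ X) := fun _ _ h =>
  measureReal_mono fun _ hω => lt_of_le_of_lt h hω

lemma tail_nonneg (w : ℝ) : 0 ≤ tail μ X w := measureReal_nonneg

lemma tail_le_one [IsProbabilityMeasure μ] (w : ℝ) : tail μ X w ≤ 1 := measureReal_le_one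

/-- A layer cake formula for the positive part of `X 0`. -/
lemma integral_primitive_max [IsProbabilityMeasure μ] (hX : Measurable (X 0)) {g : ℝ → ℝ}
    (hg : Measurable g) (hg0 : ∀ t, 0 ≤ g t)
    (hgint : ∀ t > 0, IntervalIntegrable g volume 0 t)
    (hint : Integrable (fun ω => ∫ t in (0 : ℝ)..(max (X 0 ω) 0), g t) μ) :
    ∫ ω, (∫ t in (0 : ℝ)..(max (X 0 ω) 0), g t) ∂μ = ∫ t in Ioi 0, tail μ X t * g t := by
  have hlayer := lintegral_comp_eq_lintegral_meas_lt_mul μ (f := fun ω => max (X 0 ω) 0) (g := g)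
    (ae_of_all _ fun ω => le_max_right _ _) (by fun_prop) hgint (ae_of_all _ hg0)
  have ht : Measurable (tail μ X) := tail_antitone.measurable
  rw [integral_eq_lintegral_of_nonneg_ae (ae_of_all _ fun ω =>
      intervalIntegral.integral_nonneg (le_max_right _ _) fun _ _ => hg0 _)
      hint.aestronglyMeasurable,
    hlayer, integral_eq_lintegral_of_nonneg_ae (ae_of_all _ fun t =>
      mul_nonneg (tail_nonneg t) (hg0 t)) (ht.mul hg).aestronglyMeasurable]
  congr 1
  refine setLIntegral_congr_fun measurableSet_Ioi fun t ht => ?_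
  rw [ENNReal.ofReal_mul (tail_nonneg t)]
  congr 1
  have : {ω | t < max (X 0 ω) 0} = {ω | t < X 0 ω} := by
    ext ω
    have h0 : 0 < t := ht
    simp [not_lt.2 h0.le]
  rw [this, tail, ofReal_measureReal]

lemma integrableOn_tail [IsProbabilityMeasure μ] (hint : Integrable (X 0) μ) :
    IntegrableOn (tail μ X) (Ioi 0) := by
  have hm : Measurable (tail μ X) := tail_antitone.measurable
  refine ⟨hm.aestronglyMeasurable, ?_⟩
  have h1 := lintegral_eq_lintegral_meas_lt μ (f := fun ω => |X 0 ω|)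
    (ae_of_all _ fun ω => abs_nonneg _) hint.abs.aemeasurable
  have h2 : ∫⁻ ω, ENNReal.ofReal |X 0 ω| ∂μ < ⊤ := hint.abs.lintegral_lt_top
  rw [h1] at h2
  refine lt_of_le_of_lt (lintegral_mono fun t => ?_) h2
  rw [Real.enorm_eq_ofReal (tail_nonneg t), tail, ofReal_measureReal]
  exact measure_mono fun ω (hω : t < X 0 ω) =>
    show t < |X 0 ω| from hω.trans_le (le_abs_self _)

lemma integral_tail [IsProbabilityMeasure μ] (hX : Measurable (X 0)) (hint : Integrable (X 0) μ) :
    ∫ t in Ioi 0, tail μ X t = ∫ ω, max (X 0 ω) 0 ∂μ := by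
  have := integral_primitive_max (μ := μ) (X := X) hX (g := fun _ => 1) measurable_const
    (fun _ => zero_le_one) (fun t _ => by simp) (by
      have : Integrable (fun ω => max (X 0 ω) 0) μ := hint.sup (integrable_const (0 : ℝ))
      simpa using this)
  simpa using this.symm

lemma tendsto_integral_min [IsProbabilityMeasure μ] (hint : Integrable (X 0) μ) :
    Tendsto (fun n : ℕ => ∫ ω, min (max (-X 0 ω) 0) (n : ℝ) ∂μ) atTop
      (𝓝 (∫ ω, max (-X 0 ω) 0 ∂μ)) := by
  have hi : Integrable (fun ω => max (-X 0 ω) 0) μ := hint.neg.sup (integrable_const 0)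
  refine tendsto_integral_of_dominated_convergence _ (fun n => ?_) hi
    (fun n => ae_of_all _ fun ω => ?_) (ae_of_all _ fun ω => ?_)
  · exact (hi.inf (integrable_const (n : ℝ))).aestronglyMeasurable
  · rw [Real.norm_of_nonneg (le_min (le_max_right _ _) n.cast_nonneg)]
    exact min_le_left _ _
  · refine tendsto_const_nhds.congr' ?_
    filter_upwards [eventually_ge_atTop ⌈max (-X 0 ω) 0⌉₊] with n hn
    rw [min_eq_left (Nat.ceil_le.1 hn)]

/-- The drift of the test function at `u`, where `w = y - u` is the distance to `y`: every
contribution is a multiple of `F w`. The mean of the increment contributes `-a`, and the jumps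
above `b = y - R` contribute at most `∫_R^∞ F`. -/
lemma NegativeDrift.exists_drift_le [IsProbabilityMeasure μ] (h : NegativeDrift μ X a)
    (hF : HeavyTail (tail μ X)) {η : ℝ} (hη : 0 < η) :
    ∃ w₀ : ℝ, ∀ y R u, 0 ≤ R → R ≤ y - u → w₀ ≤ y - u →
      ∫ ω, (testFun (tail μ X) y (y - R) (u + X 0 ω) - testFun (tail μ X) y (y - R) u) ∂μ ≤
        (-a + ((∫ t in Ioi 0, tail μ X t) - ∫ t in (0 : ℝ)..R, tail μ X t) + η) *
          tail μ X (y - u) := by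
  set F := tail μ X with hFdef
  have hanti : Antitone F := tail_antitone
  have h0 : ∀ w, 0 ≤ F w := tail_nonneg
  have h1 : ∀ w, F w ≤ 1 := tail_le_one
  set m := ∫ t in Ioi 0, F t with hm
  set m' := ∫ ω, max (-X 0 ω) 0 ∂μ with hm'
  have ip : Integrable (fun ω => max (X 0 ω) 0) μ := h.int.sup (integrable_const 0)
  have iq : Integrable (fun ω => max (-X 0 ω) 0) μ := h.int.neg.sup (integrable_const 0)
  have hmm : m - m' = -a := by
    rw [hm, hm', hFdef, integral_tail (h.meas 0) h.int, ← h.mean,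
      ← integral_sub ip iq]
    refine integral_congr_ae (ae_of_all _ fun ω => ?_)
    show max (X 0 ω) 0 - max (-X 0 ω) 0 = X 0 ω
    rcases le_total 0 (X 0 ω) with hx | hx
    · rw [max_eq_left hx, max_eq_right (by linarith)]; ring
    · rw [max_eq_right hx, max_eq_left (by linarith)]; ring
  obtain ⟨n, hn⟩ := ((tendsto_integral_min h.int).eventually
    (lt_mem_nhds (by linarith : m' - η / 4 < m'))).exists
  set K : ℝ := (n : ℝ)
  have hK : 0 ≤ K := n.cast_nonneg
  set m'' := ∫ ω, min (max (-X 0 ω) 0) K ∂μ with hm''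
  have hm0 : 0 ≤ m'' := integral_nonneg fun ω => le_min (le_max_right _ _) hK
  obtain ⟨w₁, hw₁⟩ := eventually_atTop.1 (hF.eventually_convolution_le hanti
    (by positivity : 0 < η / 4))
  -- `F (w + K) ≥ (1 - ε) F w`, from the long-tail property at `w + K`
  obtain ⟨w₂, hw₂⟩ := eventually_atTop.1 (hF.long K (η / (4 * (m'' + 1))) (by positivity))
  refine ⟨max w₁ w₂, fun y R u hR hRu hwu => ?_⟩
  set w := y - u with hw
  have hw1 := hw₁ w ((le_max_left _ _).trans hwu)
  have hw2 := hw₂ (w + K) ((le_max_right _ _).trans (by linarith))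
  rw [add_sub_cancel_right] at hw2
  have hub : u ≤ y - R := by linarith
  have hbu : y - R - u = w - R := by rw [hw]; ring
  set g : ℝ → ℝ := (Iic (y - R - u)).indicator (fun t => F (y - u - t)) with hg
  have hgm : Measurable g :=
    (hanti.measurable.comp (measurable_const.sub measurable_id)).indicator measurableSet_Iic
  have hg0 : ∀ t, 0 ≤ g t := fun t => indicator_nonneg (fun _ _ => h0 _) _
  have hg1 : ∀ t, g t ≤ 1 := fun t => indicator_le' (fun _ _ => h1 _) (fun _ _ => zero_le_one) t
  have hgi : ∀ p q, IntervalIntegrable g volume p q := fun p q =>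
    (intervalIntegrable_const (c := (1 : ℝ))).mono_fun hgm.aestronglyMeasurable
      (ae_of_all _ fun t => by
        show ‖g t‖ ≤ ‖(1 : ℝ)‖
        rw [Real.norm_of_nonneg (hg0 t), norm_one]; exact hg1 t)
  have hψc : Continuous fun x => ∫ t in (0 : ℝ)..x, g t :=
    intervalIntegral.continuous_primitive hgi 0
  have hi1 : Integrable (fun ω => ∫ t in (0 : ℝ)..(max (X 0 ω) 0), g t) μ := by
    refine (h.int.abs).mono' (hψc.measurable.comp
      ((h.meas 0).max measurable_const)).aestronglyMeasurable (ae_of_all _ fun ω => ?_)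
    refine (intervalIntegral.norm_integral_le_of_norm_le_const (C := 1) fun t _ => ?_).trans ?_
    · rw [Real.norm_of_nonneg (hg0 t)]; exact hg1 t
    · rw [one_mul, sub_zero, abs_of_nonneg (le_max_right _ _)]
      exact max_le (le_abs_self _) (abs_nonneg _)
  have hi2 : Integrable (fun ω => F (w + K) * min (max (-X 0 ω) 0) K) μ :=
    ((h.int.neg.sup (integrable_const 0)).inf (integrable_const K)).const_mul _
  have hi0 : Integrable (fun ω => testFun F y (y - R) (u + X 0 ω) - testFun F y (y - R) u) μ := by
    refine (h.int.abs).mono' ?_ (ae_of_all _ fun ω => ?_)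
    · exact (((measurable_testFun hanti h0 h1 y _).comp ((h.meas 0).const_add u)).sub_const
        _).aestronglyMeasurable
    · have := abs_testFun_sub_le hanti h0 h1 y (y - R) (u + X 0 ω) u
      rwa [add_sub_cancel_left] at this
  have hmain : ∫ ω, (testFun F y (y - R) (u + X 0 ω) - testFun F y (y - R) u) ∂μ ≤
      (∫ t in Ioi 0, F t * g t) - F (w + K) * m'' := by
    rw [hFdef, ← integral_primitive_max (h.meas 0) hgm hg0 (fun t _ => hgi 0 t) hi1, hm'',
      ← integral_const_mul, ← integral_sub hi1 hi2]
    exact integral_mono hi0 (hi1.sub hi2) fun ω => testFun_add_sub_le hanti h0 y hub hK _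
  have hconv : ∫ t in Ioi 0, F t * g t = ∫ t in (0 : ℝ)..(w - R), F t * F (w - t) := by
    have e : ∀ t, F t * g t = (Iic (w - R)).indicator (fun t => F t * F (w - t)) t := fun t => by
      rw [hg, hbu, ← hw]
      by_cases ht : t ∈ Iic (w - R)
      · rw [indicator_of_mem ht, indicator_of_mem ht]
      · rw [indicator_of_notMem ht, indicator_of_notMem ht, mul_zero]
    simp_rw [e]
    rw [setIntegral_indicator measurableSet_Iic, Ioi_inter_Iic,
      intervalIntegral.integral_of_le (by linarith)]
  have hint : ∀ p q, IntervalIntegrable (fun t => F t * F (w - t)) volume p q := fun p q => by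
    refine (intervalIntegrable_const (c := (1 : ℝ))).mono_fun
      (hanti.measurable.mul (hanti.measurable.comp (by fun_prop))).aestronglyMeasurable
      (ae_of_all _ fun t => ?_)
    show ‖F t * F (w - t)‖ ≤ ‖(1 : ℝ)‖
    rw [Real.norm_of_nonneg (mul_nonneg (h0 _) (h0 _)), norm_one]
    exact mul_le_one₀ (h1 _) (h0 _) (h1 _)
  have hsplit : ∫ t in (0 : ℝ)..(w - R), F t * F (w - t) =
      (∫ t in (0 : ℝ)..w, F t * F (w - t)) - ∫ t in (0 : ℝ)..R, F t * F (w - t) := by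
    rw [← intervalIntegral.integral_add_adjacent_intervals (hint 0 (w - R)) (hint (w - R) w)]
    have := intervalIntegral.integral_comp_sub_left (a := 0) (b := R)
      (fun t => F t * F (w - t)) w
    rw [sub_zero] at this
    have e : ∫ t in (0 : ℝ)..R, F (w - t) * F (w - (w - t)) = ∫ t in (0 : ℝ)..R, F t * F (w - t) :=
      intervalIntegral.integral_congr fun t _ => by simp only [sub_sub_cancel]; ring
    rw [← this, e]
    ring
  have hlow : (∫ t in (0 : ℝ)..R, F t) * F w ≤ ∫ t in (0 : ℝ)..R, F t * F (w - t) := by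
    rw [← intervalIntegral.integral_mul_const]
    exact intervalIntegral.integral_mono_on hR (hanti.intervalIntegrable.mul_const _) (hint 0 R)
      fun t ht => mul_le_mul_of_nonneg_left (hanti (by linarith [ht.1])) (h0 t)
  have hneg : (m'' - η / 4) * F w ≤ F (w + K) * m'' := by
    have hδ : η / (4 * (m'' + 1)) * m'' ≤ η / 4 := by
      rw [div_mul_eq_mul_div, div_le_div_iff₀ (by positivity) (by positivity)]
      nlinarith
    have h3 : F (w + K) ≤ F w := hanti (by linarith)
    nlinarith [mul_le_mul_of_nonneg_right hw2 hm0, mul_le_mul_of_nonneg_right hδ (h0 (w + K)),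
      mul_le_mul_of_nonneg_left h3 hη.le]
  rw [hconv, hsplit] at hmain
  have h4 : m' - m'' ≤ η / 4 := by linarith
  nlinarith [h0 w, mul_le_mul_of_nonneg_right h4 (h0 w), mul_nonneg hη.le (h0 w),
    congrArg (· * F w) hmm]

end

/-! ### The tail of the maximum -/

section

variable {Ω : Type*}

/-- The increments of a sequence, kept before the exit and before the crossing of `b`, telescope:
the crossing contributes `q(b)`, and an exit without crossing at least `F(y) S_τ`. -/
lemma le_sum_testFun {X : ℕ → Ω → ℝ} {ω : Ω} {F : ℝ → ℝ} (hanti : Antitone F) (h0 : ∀ w, 0 ≤ F w)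
    (y : ℝ) {b : ℝ} (hb : 0 ≤ b) {N : ℕ} (hal : ∀ k, ω ∈ alive X k ↔ k < N)
    (hN : walk X N ω ≤ 0) :
    (⋃ k, crossing X b k).indicator (fun _ => ∫ s in (0 : ℝ)..b, F (y - s)) ω +
        F y * ∑ k ∈ Finset.range N, X k ω ≤
      ∑ k ∈ Finset.range N, (confined X b k).indicator
        (fun ω => testFun F y b (walk X (k + 1) ω) - testFun F y b (walk X k ω)) ω := by
  have hS : ∑ k ∈ Finset.range N, X k ω = walk X N ω := rfl
  rw [hS]
  by_cases hc : ω ∈ ⋃ k, crossing X b k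
  · rw [indicator_of_mem hc]
    obtain ⟨k, hk, hbk, hlt⟩ := mem_iUnion.1 hc
    have hkN : k < N := (hal k).1 hk
    have h1 : ∀ j, j < k → ω ∈ confined X b j := fun j hj =>
      ⟨alive_antitone X hj.le hk, fun i hi => hlt i (hi.trans_lt hj)⟩
    have h2 : ∀ j, k ≤ j → ω ∉ confined X b j := fun j hj hh => not_le.2 hbk (hh.2 k hj)
    rw [← Finset.sum_subset (Finset.range_subset_range.2 hkN.le) fun j _ hj =>
      indicator_of_notMem (h2 j (not_lt.1 fun h => hj (Finset.mem_range.2 h))) _]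
    rw [Finset.sum_congr rfl fun j hj => indicator_of_mem (h1 j (Finset.mem_range.1 hj)) _,
      Finset.sum_range_sub (fun j => testFun F y b (walk X j ω)), walk_zero, testFun_zero F y hb,
      testFun_of_le F y hbk.le, sub_zero]
    linarith [mul_nonpos_of_nonneg_of_nonpos (h0 y) hN]
  · rw [indicator_of_notMem hc, zero_add]
    have hle : ∀ k < N, walk X k ω ≤ b := by
      by_contra! hex
      classical
      refine hc (mem_iUnion.2 ⟨Nat.find hex, (hal _).2 (Nat.find_spec hex).1,
        (Nat.find_spec hex).2, fun j hj => ?_⟩)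
      have := Nat.find_min hex hj
      push Not at this
      exact this (hj.trans (Nat.find_spec hex).1)
    have h1 : ∀ j ∈ Finset.range N, ω ∈ confined X b j := fun j hj =>
      ⟨(hal j).2 (Finset.mem_range.1 hj), fun i hi => hle i (hi.trans_lt (Finset.mem_range.1 hj))⟩
    rw [Finset.sum_congr rfl fun j hj => indicator_of_mem (h1 j hj) _,
      Finset.sum_range_sub (fun j => testFun F y b (walk X j ω)), walk_zero, testFun_zero F y hb,
      sub_zero]
    exact mul_le_testFun hanti y hb hN

variable [MeasurableSpace Ω] {μ : Measure Ω} {X : ℕ → Ω → ℝ} {a : ℝ}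

lemma tendsto_measureReal_confined [IsFiniteMeasure μ] (X : ℕ → Ω → ℝ) (k : ℕ) :
    Tendsto (fun y => μ.real (confined X y k)) atTop (𝓝 (μ.real (alive X k))) := by
  have hmono : Monotone fun y => confined X y k := fun y y' h ω hω =>
    ⟨hω.1, fun j hj => (hω.2 j hj).trans h⟩
  have hU : ⋃ y, confined X y k = alive X k := by
    refine subset_antisymm (iUnion_subset fun y => inter_subset_left) fun ω hω => ?_
    refine mem_iUnion.2 ⟨∑ j ∈ Finset.range (k + 1), |walk X j ω|, hω, fun j hj => ?_⟩
    exact (le_abs_self _).trans (Finset.single_le_sum (f := fun j => |walk X j ω|)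
      (fun _ _ => abs_nonneg _) (Finset.mem_range.2 (by omega)))
  have := tendsto_measure_iUnion_atTop (μ := μ) hmono
  rw [hU] at this
  exact (ENNReal.tendsto_toReal (measure_ne_top _ _)).comp this

lemma integral_Ioi_sub_pos {F : ℝ → ℝ} (hanti : Antitone F) (hpos : ∀ w, 0 < F w)
    (hint : IntegrableOn F (Ioi 0)) {R : ℝ} (hR : 0 ≤ R) :
    0 < (∫ t in Ioi 0, F t) - ∫ t in (0 : ℝ)..R, F t := by
  have h1 : ∫ t in (0 : ℝ)..(R + 1), F t ≤ ∫ t in Ioi 0, F t := by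
    rw [intervalIntegral.integral_of_le (by linarith)]
    exact setIntegral_mono_set hint (ae_of_all _ fun t => (hpos t).le)
      (ae_of_all _ fun t ht => ht.1)
  have h2 : F (R + 1) ≤ ∫ t in R..(R + 1), F t := by
    calc F (R + 1) = ∫ _ in R..(R + 1), F (R + 1) := by simp
      _ ≤ _ := intervalIntegral.integral_mono_on (by linarith) (by simp)
        hanti.intervalIntegrable fun t ht => hanti ht.2
  rw [← intervalIntegral.integral_add_adjacent_intervals (b := R) hanti.intervalIntegrable
    hanti.intervalIntegrable] at h1
  linarith [hpos (R + 1)]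

lemma integrable_tsum_of_ae_finite {Z : ℕ → Ω → ℝ} (hZ : ∀ k, Integrable (Z k) μ)
    (hs : Summable fun k => ∫ ω, ‖Z k ω‖ ∂μ) (hfin : ∀ᵐ ω ∂μ, ∃ N, ∀ k, N ≤ k → Z k ω = 0) :
    Integrable (fun ω => ∑' k, Z k ω) μ := by
  constructor
  · refine aestronglyMeasurable_of_tendsto_ae atTop
      (f := fun n ω => ∑ k ∈ Finset.range n, Z k ω) (fun n => ?_) ?_
    · exact Finset.aestronglyMeasurable_fun_sum _ fun k _ => (hZ k).aestronglyMeasurable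
    · filter_upwards [hfin] with ω ⟨N, hN⟩
      exact (summable_of_ne_finset_zero (s := Finset.range N) fun k hk =>
        hN k (by simpa using hk)).hasSum.tendsto_sum_nat
  · have h1 : ∀ k, ∫⁻ ω, ‖Z k ω‖ₑ ∂μ = ENNReal.ofReal (∫ ω, ‖Z k ω‖ ∂μ) := fun k =>
      (ofReal_integral_norm_eq_lintegral_enorm (hZ k)).symm
    calc ∫⁻ ω, ‖∑' k, Z k ω‖ₑ ∂μ ≤ ∫⁻ ω, ∑' k, ‖Z k ω‖ₑ ∂μ :=
          lintegral_mono_ae (by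
            filter_upwards [hfin] with ω ⟨N, hN⟩
            exact enorm_tsum_le_tsum_enorm)
      _ = ∑' k, ∫⁻ ω, ‖Z k ω‖ₑ ∂μ :=
          lintegral_tsum fun k => (hZ k).aestronglyMeasurable.enorm
      _ < ⊤ := by
          simp_rw [h1]
          exact hs.tsum_ofReal_ne_top.lt_top

namespace NegativeDrift

lemma integrable_indicator_alive (h : NegativeDrift μ X a) (k : ℕ) :
    Integrable (fun ω => (alive X k).indicator (fun ω => |X k ω|) ω) μ :=
  (h.integrable_comp k (f := fun x => |x|) (by fun_prop) h.int.abs).indicator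
    (measurableSet_alive h.meas k)

variable [IsProbabilityMeasure μ]

lemma eventually_sum_confined (h : NegativeDrift μ X a) {η : ℝ} (hη : 0 < η) :
    ∃ N, ∀ᶠ y in atTop, (∑' k, μ.real (alive X k)) - η ≤
      ∑ k ∈ Finset.range N, μ.real (confined X y k) := by
  obtain ⟨N, hN⟩ := (h.summable_alive.hasSum.tendsto_sum_nat.eventually
    (lt_mem_nhds (by linarith : (∑' k, μ.real (alive X k)) - η < ∑' k, μ.real (alive X k)))).exists
  refine ⟨N, ?_⟩
  have := (tendsto_finsetSum (Finset.range N) fun k _ =>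
    tendsto_measureReal_confined (μ := μ) X k).eventually (lt_mem_nhds hN)
  filter_upwards [this] with y hy using hy.le

lemma summable_integral_abs (h : NegativeDrift μ X a) :
    Summable fun k => ∫ ω, (alive X k).indicator (fun ω => |X k ω|) ω ∂μ := by
  have : ∀ k, ∫ ω, (alive X k).indicator (fun ω => |X k ω|) ω ∂μ =
      μ.real (alive X k) * ∫ ω, |X 0 ω| ∂μ := fun k => by
    rw [integral_indicator (measurableSet_alive h.meas k),
      h.setIntegral_past_comp (measurableSet_alive_past X k) (f := fun x => |x|) (by fun_prop)
        h.int.abs]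
  simp_rw [this]
  exact h.summable_alive.mul_right _

/-- The optional stopping inequality for the test function, with the drift still to be bounded. -/
lemma mul_measureReal_crossing_le (h : NegativeDrift μ X a) (y : ℝ) {b : ℝ} (hb : 0 ≤ b) :
    (∫ s in (0 : ℝ)..b, tail μ X (y - s)) * μ.real (⋃ k, crossing X b k) -
        a * (∑' k, μ.real (alive X k)) * tail μ X y ≤
      ∑' k, ∫ ω in confined X b k, (∫ ω', (testFun (tail μ X) y b (walk X k ω + X 0 ω') -
        testFun (tail μ X) y b (walk X k ω)) ∂μ) ∂μ ∧
    Summable fun k => ∫ ω in confined X b k, (∫ ω', (testFun (tail μ X) y b (walk X k ω + X 0 ω') -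
        testFun (tail μ X) y b (walk X k ω)) ∂μ) ∂μ := by
  set F := tail μ X with hFdef
  have hanti : Antitone F := tail_antitone
  have h0 : ∀ w, 0 ≤ F w := tail_nonneg
  have h1 : ∀ w, F w ≤ 1 := tail_le_one
  have hqm := measurable_testFun hanti h0 h1 y b
  set Z : ℕ → Ω → ℝ := fun k => (confined X b k).indicator
    (fun ω => testFun F y b (walk X (k + 1) ω) - testFun F y b (walk X k ω)) with hZ
  set U : ℕ → Ω → ℝ := fun k => (alive X k).indicator (X k) with hU
  have hZm : ∀ k, Measurable (Z k) := fun k =>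
    ((hqm.comp (measurable_walk h.meas (k + 1))).sub
      (hqm.comp (measurable_walk h.meas k))).indicator (measurableSet_confined h.meas b k)
  have hUm : ∀ k, Measurable (U k) := fun k =>
    (h.meas k).indicator (measurableSet_alive h.meas k)
  have hZb : ∀ k ω, ‖Z k ω‖ ≤ (alive X k).indicator (fun ω => |X k ω|) ω := fun k ω => by
    by_cases hω : ω ∈ confined X b k
    · simp only [hZ]
      rw [indicator_of_mem hω, indicator_of_mem hω.1, Real.norm_eq_abs]
      refine (abs_testFun_sub_le hanti h0 h1 _ _ _ _).trans ?_
      rw [walk_succ, add_sub_cancel_left]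
    · simp only [hZ]
      rw [indicator_of_notMem hω, norm_zero]
      exact indicator_nonneg (fun _ _ => abs_nonneg _) _
  have hUb : ∀ k ω, ‖U k ω‖ = (alive X k).indicator (fun ω => |X k ω|) ω := fun k ω => by
    simp only [hU]
    by_cases hω : ω ∈ alive X k <;> simp [hω]
  have hZi : ∀ k, Integrable (Z k) μ := fun k =>
    (h.integrable_indicator_alive k).mono' (hZm k).aestronglyMeasurable (ae_of_all _ (hZb k))
  have hUi : ∀ k, Integrable (U k) μ := fun k =>
    (h.integrable_indicator_alive k).mono' (hUm k).aestronglyMeasurable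
      (ae_of_all _ fun ω => (hUb k ω).le)
  have hsum := h.summable_integral_abs
  have hZs : Summable fun k => ∫ ω, ‖Z k ω‖ ∂μ :=
    hsum.of_nonneg_of_le (fun k => integral_nonneg fun _ => norm_nonneg _) fun k =>
      integral_mono (hZi k).norm (h.integrable_indicator_alive k) (hZb k)
  have hUs : Summable fun k => ∫ ω, ‖U k ω‖ ∂μ := by simpa only [hUb] using hsum
  have hZsum := hasSum_integral_of_summable_integral_norm hZi hZs
  have hUsum := hasSum_integral_of_summable_integral_norm hUi hUs
  have hlate : ∀ᵐ ω ∂μ, ∃ N, ∀ k, N ≤ k → ω ∉ alive X k := by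
    filter_upwards [h.ae_exists_not_alive] with ω ⟨N, hN⟩
    exact ⟨N, fun k hk hh => hN (alive_antitone X hk hh)⟩
  have hZint : Integrable (fun ω => ∑' k, Z k ω) μ := by
    refine integrable_tsum_of_ae_finite hZi hZs ?_
    filter_upwards [hlate] with ω ⟨N, hN⟩
    exact ⟨N, fun k hk => indicator_of_notMem (fun hh => hN k hk hh.1) _⟩
  have hUint : Integrable (fun ω => ∑' k, U k ω) μ := by
    refine integrable_tsum_of_ae_finite hUi hUs ?_
    filter_upwards [hlate] with ω ⟨N, hN⟩
    exact ⟨N, fun k hk => indicator_of_notMem (hN k hk) _⟩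
  have hZeq : ∀ k, ∫ ω, Z k ω ∂μ = ∫ ω in confined X b k,
      (∫ ω', (testFun F y b (walk X k ω + X 0 ω') - testFun F y b (walk X k ω)) ∂μ) ∂μ := by
    intro k
    have hZk : ∀ ω, Z k ω = (confined X b k).indicator (fun ω =>
        testFun F y b (walk X k ω + X k ω) - testFun F y b (walk X k ω)) ω := fun ω => by
      simp only [hZ, walk_succ]
    rw [← h.setIntegral_past (measurableSet_confined_past X b k) (measurable_walk_past X le_rfl)
      (f := fun u x => testFun F y b (u + x) - testFun F y b u),
      ← integral_indicator (measurableSet_confined h.meas b k)]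
    · exact integral_congr_ae (ae_of_all _ hZk)
    · exact (hqm.comp (measurable_fst.add measurable_snd)).sub (hqm.comp measurable_fst)
    · exact (hZi k).congr (ae_of_all _ hZk)
  have hUeq : ∀ k, ∫ ω, U k ω ∂μ = μ.real (alive X k) * -a := fun k => by
    rw [integral_indicator (measurableSet_alive h.meas k),
      h.setIntegral_past_comp (measurableSet_alive_past X k) (f := fun x => x) measurable_id h.int,
      h.mean]
  simp_rw [hZeq] at hZsum
  simp_rw [hUeq] at hUsum
  refine ⟨?_, hZsum.summable⟩
  have hU2 : ∫ ω, ∑' k, U k ω ∂μ = (∑' k, μ.real (alive X k)) * -a := by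
    rw [← hUsum.tsum_eq, tsum_mul_right]
  have hcm : MeasurableSet (⋃ k, crossing X b k) :=
    MeasurableSet.iUnion fun k => measurableSet_crossing h.meas b k
  have hpt : ∀ᵐ ω ∂μ, (⋃ k, crossing X b k).indicator (fun _ => ∫ s in (0 : ℝ)..b, F (y - s)) ω +
      F y * ∑' k, U k ω ≤ ∑' k, Z k ω := by
    filter_upwards [h.ae_exists_not_alive] with ω hω
    obtain ⟨N, -, hal, hN, -, -⟩ := exists_exit hω
    have hN' : ∀ k ∉ Finset.range N, ω ∉ alive X k := fun k hk hh =>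
      hk (Finset.mem_range.2 ((hal k).1 hh))
    rw [tsum_eq_sum (s := Finset.range N) fun k hk => indicator_of_notMem (hN' k hk) _,
      tsum_eq_sum (s := Finset.range N) fun k hk =>
        indicator_of_notMem (fun hh => hN' k hk hh.1) _]
    rw [Finset.sum_congr rfl fun k hk =>
      indicator_of_mem ((hal k).2 (Finset.mem_range.1 hk)) (X k)]
    exact le_sum_testFun hanti h0 y hb hal hN
  have hi1 : Integrable ((⋃ k, crossing X b k).indicator
      (fun _ => ∫ s in (0 : ℝ)..b, F (y - s))) μ := (integrable_const _).indicator hcm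
  have hfin := integral_mono_ae (hi1.add (hUint.const_mul (F y))) hZint hpt
  rw [← hZsum.tsum_eq] at hfin
  rw [integral_add' hi1 (hUint.const_mul (F y)), integral_const_mul, hU2,
    integral_indicator_const _ hcm, smul_eq_mul] at hfin
  linarith

/-- The sharp upper bound for the probability that the maximum exceeds `b`. -/
lemma eventually_measureReal_crossing_le (h : NegativeDrift μ X a) (hF : HeavyTail (tail μ X))
    {δ : ℝ} (hδ : 0 < δ) :
    ∀ᶠ b in atTop, μ.real (⋃ k, crossing X b k) ≤
      ((∑' k, μ.real (alive X k)) + δ) * tail μ X b := by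
  set F := tail μ X with hFdef
  set T := ∑' k, μ.real (alive X k) with hT
  have hT0 : 0 < T := zero_lt_one.trans_le h.one_le_tsum_alive
  have hanti : Antitone F := tail_antitone
  have h0 : ∀ w, 0 ≤ F w := tail_nonneg
  have ha := h.pos
  have hFint : IntegrableOn F (Ioi 0) := integrableOn_tail h.int
  have hlimF : Tendsto (fun R => ∫ t in (0 : ℝ)..R, F t) atTop (𝓝 (∫ t in Ioi 0, F t)) :=
    intervalIntegral_tendsto_integral_Ioi 0 hFint tendsto_id
  -- `R` is fixed so that the drift is nonpositive at every distance `≥ R`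
  obtain ⟨w₀, hw₀⟩ := h.exists_drift_le hF (by positivity : 0 < a / 4)
  obtain ⟨R, hRG, hR0, hRw⟩ := ((hlimF.eventually (lt_mem_nhds
    (by linarith : (∫ t in Ioi 0, F t) - a / 4 < ∫ t in Ioi 0, F t))).and
    ((eventually_ge_atTop 0).and (eventually_ge_atTop w₀))).exists
  set G := (∫ t in Ioi 0, F t) - ∫ t in (0 : ℝ)..R, F t with hG
  have hGpos : 0 < G := integral_Ioi_sub_pos hanti hF.pos hFint hR0
  have hGa : G ≤ a / 4 := by linarith
  set η := min (a / 4) (δ * G / (2 * T + a + δ)) with hη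
  have hη0 : 0 < η := lt_min (by positivity) (by positivity)
  have hηa : η ≤ a / 4 := min_le_left _ _
  have hηG : η * (2 * T + a + δ) ≤ δ * G :=
    (le_div_iff₀ (by positivity)).1 (min_le_right _ _)
  obtain ⟨w₁, hw₁⟩ := h.exists_drift_le hF hη0
  obtain ⟨N, hN⟩ := h.eventually_sum_confined hη0
  have hhalf : Tendsto (fun b : ℝ => b / 2) atTop atTop := tendsto_id.atTop_div_const two_pos
  have hshift : Tendsto (fun b : ℝ => b + R) atTop atTop :=
    tendsto_atTop_add_const_right _ _ tendsto_id
  filter_upwards [eventually_ge_atTop 0, hhalf.eventually (eventually_ge_atTop w₁),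
    hhalf.eventually hN, (hlimF.comp hshift).eventually (lt_mem_nhds
      (by linarith : (∫ t in Ioi 0, F t) - η < ∫ t in Ioi 0, F t))] with b hb hbw hbN hbQ
  obtain ⟨hmain, hsummable⟩ := h.mul_measureReal_crossing_le (b + R) hb
  set drift : ℝ → ℝ := fun u =>
    ∫ ω', (testFun F (b + R) b (u + X 0 ω') - testFun F (b + R) b u) ∂μ with hdrift
  have hd : ∀ u, u ≤ b → drift u ≤ (-a + G + a / 4) * F (b + R - u) := fun u hu => by
    have := hw₀ (b + R) R u hR0 (by linarith) (by linarith)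
    rwa [add_sub_cancel_right] at this
  have hd' : ∀ u, u ≤ b → w₁ ≤ b + R - u → drift u ≤ (-a + G + η) * F (b + R - u) :=
      fun u hu hu' => by
    have := hw₁ (b + R) R u hR0 (by linarith) hu'
    rwa [add_sub_cancel_right] at this
  have hdneg : ∀ u, u ≤ b → drift u ≤ 0 := fun u hu =>
    (hd u hu).trans (mul_nonpos_of_nonpos_of_nonneg (by linarith) (h0 _))
  have hdm : Measurable drift := by
    have hqm := measurable_testFun hanti h0 tail_le_one (b + R) b
    have : Measurable (fun p : ℝ × Ω => testFun F (b + R) b (p.1 + X 0 p.2) -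
        testFun F (b + R) b p.1) :=
      (hqm.comp (measurable_fst.add ((h.meas 0).comp measurable_snd))).sub (hqm.comp measurable_fst)
    exact this.stronglyMeasurable.integral_prod_right.measurable
  have hdb : ∀ u, |drift u| ≤ ∫ ω, |X 0 ω| ∂μ := fun u => by
    refine abs_integral_le_integral_abs.trans (integral_mono_of_nonneg
      (ae_of_all _ fun _ => abs_nonneg _) h.int.abs (ae_of_all _ fun ω => ?_))
    have := abs_testFun_sub_le hanti h0 tail_le_one (b + R) b (u + X 0 ω) u
    rwa [add_sub_cancel_left] at this
  have hdi : ∀ k, Integrable (fun ω => drift (walk X k ω)) μ := fun k =>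
    Integrable.of_bound (hdm.comp (measurable_walk h.meas k)).aestronglyMeasurable _
      (ae_of_all _ fun ω => hdb _)
  have hterm0 : ∀ k, ∫ ω in confined X b k, drift (walk X k ω) ∂μ ≤ 0 := fun k =>
    setIntegral_nonpos (measurableSet_confined h.meas b k) fun ω hω => hdneg _ (hω.2 k le_rfl)
  have hterm : ∀ k, ∫ ω in confined X b k, drift (walk X k ω) ∂μ ≤
      -(a - G - η) * F (b + R) * μ.real (confined X (b / 2) k) := fun k => by
    have hsub : confined X (b / 2) k ⊆ confined X b k := fun ω hω =>
      ⟨hω.1, fun j hj => (hω.2 j hj).trans (by linarith)⟩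
    have e1 : ∫ ω in confined X b k, drift (walk X k ω) ∂μ ≤
        ∫ ω in confined X (b / 2) k, drift (walk X k ω) ∂μ := by
      have := setIntegral_mono_set (f := fun ω => -drift (walk X k ω)) (hdi k).neg.integrableOn
        ((ae_restrict_iff' (measurableSet_confined h.meas b k)).2 (ae_of_all _ fun ω hω => by
          show 0 ≤ -drift (walk X k ω)
          linarith [hdneg _ (hω.2 k le_rfl)])) (LE.le.eventuallyLE hsub)
      rw [integral_neg, integral_neg] at this
      linarith
    have e2 : ∫ ω in confined X (b / 2) k, drift (walk X k ω) ∂μ ≤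
        ∫ _ in confined X (b / 2) k, -(a - G - η) * F (b + R) ∂μ := by
      refine setIntegral_mono_on (hdi k).integrableOn (integrable_const _)
        (measurableSet_confined h.meas _ k) fun ω hω => ?_
      have hle := hω.2 k le_rfl
      have hge := walk_nonneg_of_alive hω.1 le_rfl
      refine (hd' _ (by linarith) (by linarith)).trans ?_
      have : F (b + R) ≤ F (b + R - walk X k ω) := hanti (by linarith)
      nlinarith
    rw [setIntegral_const, smul_eq_mul] at e2
    linarith
  have hsumle : ∑' k, ∫ ω in confined X b k, drift (walk X k ω) ∂μ ≤
      -(a - G - η) * F (b + R) * (T - η) := by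
    have e1 : ∑' k, ∫ ω in confined X b k, drift (walk X k ω) ∂μ ≤
        ∑ k ∈ Finset.range N, ∫ ω in confined X b k, drift (walk X k ω) ∂μ := by
      have := hsummable.neg.sum_le_tsum (Finset.range N) fun k _ => by
        have := hterm0 k
        show 0 ≤ -∫ ω in confined X b k, drift (walk X k ω) ∂μ
        linarith
      rw [Finset.sum_neg_distrib, tsum_neg] at this
      exact neg_le_neg_iff.1 this
    refine e1.trans ((Finset.sum_le_sum fun k _ => hterm k).trans ?_)
    rw [← Finset.mul_sum]
    refine mul_le_mul_of_nonpos_left hbN ?_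
    exact mul_nonpos_of_nonpos_of_nonneg (by linarith) (h0 _)
  have hQ : G - η ≤ ∫ s in (0 : ℝ)..b, F (b + R - s) := by
    have e1 := intervalIntegral.integral_comp_sub_left (a := 0) (b := b) F (b + R)
    rw [add_sub_cancel_left, sub_zero] at e1
    rw [e1]
    have e2 := intervalIntegral.integral_add_adjacent_intervals (a := 0) (b := R) (c := b + R)
      (μ := volume) (f := F) hanti.intervalIntegrable hanti.intervalIntegrable
    simp only [Function.comp_apply] at hbQ
    linarith
  set V := μ.real (⋃ k, crossing X b k) with hV
  have hV0 : 0 ≤ V := measureReal_nonneg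
  have hFb : F (b + R) ≤ F b := hanti (by linarith)
  have hkey : (G - η) * V ≤ F (b + R) * ((T + δ) * (G - η)) := by
    have e1 : (G - η) * V ≤ F (b + R) * (a * T - (a - G - η) * (T - η)) := by
      nlinarith [mul_le_mul_of_nonneg_right hQ hV0]
    have e2 : a * T - (a - G - η) * (T - η) ≤ (T + δ) * (G - η) := by nlinarith
    exact e1.trans (mul_le_mul_of_nonneg_left e2 (h0 _))
  have hGη : 0 < G - η := by
    have : η * (2 * T + a + δ) < G * (2 * T + a + δ) :=
      lt_of_le_of_lt hηG (by nlinarith)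
    have := lt_of_mul_lt_mul_right this (by positivity)
    linarith
  have : V ≤ F (b + R) * (T + δ) := by
    refine le_of_mul_le_mul_left ?_ hGη
    linarith
  calc V ≤ F (b + R) * (T + δ) := this
    _ ≤ F b * (T + δ) := mul_le_mul_of_nonneg_right hFb (by positivity)
    _ = (T + δ) * F b := mul_comm _ _

/-- A big jump from a confined position crosses `y`. -/
lemma measureReal_confined_mul_le (h : NegativeDrift μ X a) {y : ℝ} (hy : 0 ≤ y) (k : ℕ) :
    μ.real (confined X y k) * tail μ X y ≤ μ.real (crossing X y (k + 1)) := by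
  rw [← h.measureReal_lt k, ← measure_past_inter_future h.meas h.indep
    (measurableSet_confined_past X y k)
    (B := {ω | y < X k ω}) (measurable_future X le_rfl measurableSet_Ioi)]
  refine measureReal_mono ?_
  rintro ω ⟨⟨h1, h2⟩, h3⟩
  have h3' : y < X k ω := h3
  have h4 : y < walk X (k + 1) ω := by
    rw [walk_succ]; linarith [walk_nonneg_of_alive h1 le_rfl]
  refine ⟨fun j hj hjk => ?_, h4, fun j hj => h2 j (by omega)⟩
  rcases hjk.eq_or_lt with rfl | hlt
  · linarith
  · exact h1 j hj (by omega)

/-- Crossings at late times are negligible. -/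
lemma eventually_measureReal_late_crossing_le (h : NegativeDrift μ X a)
    (hF : HeavyTail (tail μ X)) {δ : ℝ} (hδ : 0 < δ) :
    ∃ N, ∀ᶠ y in atTop, μ.real (⋃ k ∈ Ioi N, crossing X y k) ≤ δ * tail μ X y := by
  obtain ⟨N, hN⟩ := h.eventually_sum_confined (half_pos hδ)
  refine ⟨N, ?_⟩
  filter_upwards [hN, h.eventually_measureReal_crossing_le hF (half_pos hδ),
    eventually_ge_atTop 0] with y h1 h2 hy
  have hs := hasSum_crossing (μ := μ) h.meas y
  have e0 : μ.real (⋃ k ∈ Finset.range (N + 1), crossing X y k) =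
      ∑ k ∈ Finset.range (N + 1), μ.real (crossing X y k) :=
    measureReal_biUnion_finset (fun i _ j _ hij => crossing_disjoint X y hij)
      fun k _ => measurableSet_crossing h.meas y k
  have e1 : (∑ k ∈ Finset.range N, μ.real (confined X y k)) * tail μ X y ≤
      ∑ k ∈ Finset.range (N + 1), μ.real (crossing X y k) := by
    rw [Finset.sum_range_succ', Finset.sum_mul]
    refine (Finset.sum_le_sum fun k _ => h.measureReal_confined_mul_le hy k).trans ?_
    linarith [measureReal_nonneg (μ := μ) (s := crossing X y 0)]
  have hdisj : Disjoint (⋃ k ∈ Finset.range (N + 1), crossing X y k)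
      (⋃ k ∈ Ioi N, crossing X y k) := by
    simp only [disjoint_iUnion_left, disjoint_iUnion_right]
    intro i hi j hj
    refine crossing_disjoint X y fun hij => ?_
    have := Finset.mem_range.1 hj
    have : N < i := hi
    omega
  have hm : MeasurableSet (⋃ k ∈ Ioi N, crossing X y k) :=
    MeasurableSet.biUnion (to_countable _) fun k _ => measurableSet_crossing h.meas y k
  have e2 : μ.real (⋃ k ∈ Finset.range (N + 1), crossing X y k) +
      μ.real (⋃ k ∈ Ioi N, crossing X y k) ≤ μ.real (⋃ k, crossing X y k) := by
    rw [← measureReal_union hdisj hm (measure_ne_top _ _) (measure_ne_top _ _)]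
    exact measureReal_mono (union_subset (iUnion₂_subset fun k _ => subset_iUnion _ k)
      (iUnion₂_subset fun k _ => subset_iUnion _ k))
  have := tail_nonneg (μ := μ) (X := X) y
  nlinarith

end NegativeDrift

end

/-! ### The area after a big jump -/

section

variable {Ω : Type*}

lemma sum_range_sub_mul (B a : ℝ) (n : ℕ) :
    ∑ j ∈ Finset.range n, (B - a * j) = n * B - a * (n * (n - 1) / 2) := by
  induction n with
  | zero => simp
  | succ n ih => rw [Finset.sum_range_succ, ih]; push_cast; ring

/-- A walk that stays above the line `B - a j` after time `m` has area more than `B² / (2a)`. -/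
lemma sq_div_lt_area {X : ℕ → Ω → ℝ} {ω : Ω} (hω : ∃ k, ω ∉ alive X k) {a B : ℝ} (ha : 0 < a)
    (hB : 0 < B) {m n : ℕ} (hm : ω ∈ alive X m) (hn : B ≤ a * n)
    (hS : ∀ j ≤ n, B - a * j < walk X (m + j) ω) : B ^ 2 / (2 * a) < area X ω := by
  obtain ⟨N, hN1, hal, -, harea, -⟩ := exists_exit hω
  set J := ⌊B / a⌋₊ with hJ
  have hBa : 0 ≤ B / a := by positivity
  have hJle : (J : ℝ) ≤ B / a := Nat.floor_le hBa
  have hJlt : B / a < J + 1 := Nat.lt_floor_add_one _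
  have hJn : J ≤ n := by
    have : (J : ℝ) ≤ n := hJle.trans ((div_le_iff₀ ha).2 (by linarith))
    exact_mod_cast this
  have hpos : ∀ j ≤ J, 0 ≤ B - a * j := fun j hj => by
    have : (j : ℝ) ≤ B / a := le_trans (by exact_mod_cast hj) hJle
    rw [le_div_iff₀ ha] at this
    linarith
  have hmJ : ω ∈ alive X (m + J) := fun i h1 hi => by
    rcases le_or_gt i m with him | him
    · exact hm i h1 him
    · obtain ⟨j, rfl⟩ := Nat.exists_eq_add_of_le him.le
      have hj : j ≤ J := by omega
      exact (hpos j hj).trans_lt (hS j (hj.trans hJn))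
  have hlt := (hal _).1 hmJ
  have h1 : ∑ j ∈ Finset.range (J + 1), walk X (m + j) ω ≤ area X ω := by
    rw [harea, ← Finset.sum_image (s := Finset.range (J + 1)) (g := fun j => m + j)
      (f := fun k => walk X k ω) (fun _ _ _ _ h => by simpa using h)]
    refine Finset.sum_le_sum_of_subset_of_nonneg (fun i hi => ?_) fun i hi _ => ?_
    · obtain ⟨j, hj, rfl⟩ := Finset.mem_image.1 hi
      have := Finset.mem_range.1 hj
      exact Finset.mem_range.2 (by omega)
    · exact walk_nonneg_of_alive ((hal i).2 (Finset.mem_range.1 hi)) le_rfl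
  have h2 : ∑ j ∈ Finset.range (J + 1), (B - a * j) <
      ∑ j ∈ Finset.range (J + 1), walk X (m + j) ω :=
    Finset.sum_lt_sum_of_nonempty ⟨0, by simp⟩ fun j hj =>
      hS j ((Nat.lt_succ_iff.1 (Finset.mem_range.1 hj)).trans hJn)
  rw [sum_range_sub_mul] at h2
  push_cast at h2
  refine lt_of_le_of_lt ?_ (h2.trans_le h1)
  set t := B / a with ht
  have hBt : B = a * t := by rw [ht]; field_simp
  have e : B ^ 2 / (2 * a) = a * (t ^ 2 / 2) := by rw [hBt]; field_simp
  rw [e, hBt]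
  have : t ^ 2 / 2 ≤ (J + 1) * t - (J + 1) * J / 2 := by nlinarith
  nlinarith [mul_le_mul_of_nonneg_left this ha.le]

/-- A walk that stays below the line `B - a j` after time `k`, and below `b` before, has area at
most `B² / (2a)` up to a linear error. -/
lemma area_le {X : ℕ → Ω → ℝ} {ω : Ω} (hω : ∃ k, ω ∉ alive X k) {a B b : ℝ} (ha : 0 < a)
    (hB : 0 < B) {k n : ℕ} (hn : B ≤ a * n) (hb : ∀ j < k, walk X j ω ≤ b) (hb0 : 0 ≤ b)
    (hS : ∀ j ≤ n, walk X (k + j) ω ≤ B - a * j) :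
    area X ω ≤ k * b + B ^ 2 / (2 * a) + B / 2 + a / 2 := by
  obtain ⟨N, hN1, hal, -, harea, -⟩ := exists_exit hω
  set J := ⌈B / a⌉₊ with hJ
  have hBa : 0 < B / a := by positivity
  have hJge : B / a ≤ J := Nat.le_ceil _
  have hJlt : (J : ℝ) < B / a + 1 := Nat.ceil_lt_add_one hBa.le
  have hJn : J ≤ n := Nat.ceil_le.2 ((div_le_iff₀ ha).2 (by linarith))
  have hJ1 : 1 ≤ J := Nat.ceil_pos.2 hBa
  have hNle : N ≤ k + J := by
    by_contra! hlt
    have h1 := (hal (k + J)).2 hlt (k + J) (by omega) le_rfl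
    have h2 := hS J hJn
    rw [div_le_iff₀ ha] at hJge
    linarith
  have hterm : ∀ j < J, 0 ≤ B - a * j := fun j hj => by
    have h1 : (j : ℝ) < B / a := Nat.lt_ceil.1 hj
    rw [lt_div_iff₀ ha] at h1
    linarith
  have h1 : area X ω ≤ ∑ j ∈ Finset.range k, b + ∑ j ∈ Finset.range J, (B - a * j) := by
    rw [harea]
    calc ∑ i ∈ Finset.range N, walk X i ω
        ≤ ∑ i ∈ Finset.range N, if i < k then b else B - a * (i - k : ℕ) := by
          refine Finset.sum_le_sum fun i hi => ?_
          split_ifs with h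
          · exact hb i h
          · have hiN := Finset.mem_range.1 hi
            have := hS (i - k) (by omega)
            rwa [Nat.add_sub_cancel' (not_lt.1 h)] at this
      _ ≤ ∑ i ∈ Finset.range (k + J), if i < k then b else B - a * (i - k : ℕ) := by
          refine Finset.sum_le_sum_of_subset_of_nonneg (Finset.range_subset_range.2 hNle)
            fun i hi _ => ?_
          have := Finset.mem_range.1 hi
          split_ifs with h
          · exact hb0
          · exact hterm _ (by omega)
      _ = _ := by
          rw [Finset.sum_range_add]
          congr 1
          · exact Finset.sum_congr rfl fun i hi => if_pos (Finset.mem_range.1 hi)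
          · refine Finset.sum_congr rfl fun i _ => ?_
            rw [if_neg (by omega), Nat.add_sub_cancel_left]
  rw [sum_range_sub_mul] at h1
  simp only [Finset.sum_const, Finset.card_range, nsmul_eq_mul] at h1
  refine h1.trans ?_
  set t := B / a with ht
  have hBt : B = a * t := by rw [ht]; field_simp
  have e : B ^ 2 / (2 * a) = a * (t ^ 2 / 2) := by rw [hBt]; field_simp
  rw [e, hBt]
  have : (J : ℝ) * t - J * (J - 1) / 2 ≤ t ^ 2 / 2 + t / 2 + 1 / 2 := by nlinarith
  nlinarith [mul_le_mul_of_nonneg_left this ha.le]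

/-- The gain in the square beats errors that are linear in `z`, as `s` is large. -/
lemma linear_add_sq_div_le {a z s η N : ℝ} (ha : 0 < a) (hza : a ≤ z) (hs : 0 < s)
    (hηs : η * s ≤ z / 2) (hη : 0 < η) (hN : 4 * a / η * (N + 2) ≤ s) :
    N * z + (z - η / 2 * s) ^ 2 / (2 * a) + (z - η / 2 * s) / 2 + a / 2 ≤ z ^ 2 / (2 * a) := by
  have hηs0 := mul_pos hη hs
  have hz0 := ha.trans_le hza
  have hsq : (z - η / 2 * s) ^ 2 ≤ z ^ 2 - η / 2 * s * z := by nlinarith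
  have hN' : 4 * a * (N + 2) ≤ η * s := by
    have : 4 * a / η * (N + 2) = 4 * a * (N + 2) / η := by ring
    rw [this, div_le_iff₀ hη] at hN
    linarith
  have hgain : (N + 2) * z ≤ η / 2 * s * z / (2 * a) := by
    rw [le_div_iff₀ (by positivity)]
    nlinarith
  have hdiv : (z - η / 2 * s) ^ 2 / (2 * a) ≤ z ^ 2 / (2 * a) - η / 2 * s * z / (2 * a) := by
    rw [← sub_div]
    exact div_le_div_of_nonneg_right hsq (by positivity)
  nlinarith

/-- A scale `s(z)` to which the tail `F` is insensitive: shifting the argument by a small multiple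
of `s(z)` changes `F(z)` by a factor close to one. -/
structure InsensitivityScale (F s : ℝ → ℝ) : Prop where
  pos : ∀ᶠ z in atTop, 0 < s z
  le : ∀ᶠ z in atTop, s z ≤ z
  tendsto : Tendsto s atTop atTop
  insensitive : ∀ δ : ℝ, 0 < δ → ∃ η : ℝ, 0 < η ∧ η ≤ 1 / 2 ∧ ∀ᶠ z in atTop,
    F (z - η * s z) ≤ (1 + δ) * F z ∧ F z ≤ (1 + δ) * F (z + η * s z)

lemma InsensitivityScale.long {F s : ℝ → ℝ} (hs : InsensitivityScale F s) (hanti : Antitone F)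
    (K δ : ℝ) (hδ : 0 < δ) : ∀ᶠ w in atTop, F (w - K) ≤ (1 + δ) * F w := by
  obtain ⟨η, hη, -, hF⟩ := hs.insensitive δ hδ
  filter_upwards [hF, hs.tendsto.eventually (eventually_ge_atTop (K / η))] with w hw hsw
  rw [div_le_iff₀ hη] at hsw
  exact (hanti (by linarith)).trans hw.1

lemma measurableSet_deviates_future (X : ℕ → Ω → ℝ) (k : ℕ) (a d : ℝ) (n : ℕ) :
    MeasurableSet[future X k] (deviates (fun i => X (k + i)) a d n) := by
  have hw : ∀ j, Measurable[future X k] (walk (fun i => X (k + i)) j) := fun j =>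
    @Finset.measurable_fun_sum _ _ _ _ _ _ (future X k) _ _ fun i _ =>
      measurable_future X (Nat.le_add_right k i)
  have : deviates (fun i => X (k + i)) a d n = ⋃ j ∈ Finset.Iic n,
      walk (fun i => X (k + i)) j ⁻¹' {x | d < |x + a * j|} := by
    ext ω; simp [deviates]
  rw [this]
  refine @Finset.measurableSet_biUnion _ _ (future X k) _ _ fun j _ => hw j ?_
  exact measurableSet_lt measurable_const (by fun_prop)

variable [MeasurableSpace Ω] {μ : Measure Ω} {X : ℕ → Ω → ℝ} {a : ℝ}

namespace NegativeDrift
variable [IsProbabilityMeasure μ]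

/-- The lower bound: one jump over `z + η s(z)` from a confined position, after which the walk
follows its mean. -/
lemma eventually_le_measureReal_area (h : NegativeDrift μ X a) {s : ℝ → ℝ}
    (hs : InsensitivityScale (tail μ X) s)
    (hlim : Tendsto (fun z => z * truncMoment μ X (s z)) atTop (𝓝 0)) {δ : ℝ} (hδ : 0 < δ) :
    ∀ᶠ z in atTop, ((∑' k, μ.real (alive X k)) - δ) * tail μ X z ≤
      μ.real {ω | z ^ 2 / (2 * a) < area X ω ∧ z < maximum X ω} := by
  set T := ∑' k, μ.real (alive X k) with hT
  have hT1 : 1 ≤ T := h.one_le_tsum_alive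
  have ha := h.pos
  set ε := min (1 / 2) (δ / (1 + 2 * T)) with hε
  have hε0 : 0 < ε := lt_min (by norm_num) (by positivity)
  have hε1 : ε ≤ 1 / 2 := min_le_left _ _
  have hεδ : ε * (1 + 2 * T) ≤ δ := (le_div_iff₀ (by positivity)).1 (min_le_right _ _)
  obtain ⟨η, hη, hη1, hins⟩ := hs.insensitive ε hε0
  obtain ⟨N, hN⟩ := h.eventually_sum_confined hε0
  filter_upwards [hins, hN, hs.pos, hs.le, eventually_ge_atTop a,
    h.eventually_measureReal_deviates_le hs.pos hlim (half_pos hη) (by linarith)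
      (by positivity : 0 < 3 / a) hε0] with z hz hNz hsz hsz' hza hdev
  have hz0 : 0 < z := ha.trans_le hza
  set n := ⌈2 * z / a⌉₊ with hn
  have hn1 : 2 * z ≤ a * n := by
    have : 2 * z / a ≤ n := Nat.le_ceil _
    rw [div_le_iff₀ ha] at this; linarith
  have hn2 : (n : ℝ) ≤ 3 / a * z := by
    have h1 : (n : ℝ) < 2 * z / a + 1 := Nat.ceil_lt_add_one (by positivity)
    have h2 : 1 ≤ z / a := (one_le_div ha).2 hza
    have h3 : 3 / a * z = 2 * z / a + z / a := by field_simp; ring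
    linarith
  set G : ℕ → Set Ω := fun k => (deviates (fun i => X (k + 1 + i)) a (η / 2 * s z) n)ᶜ with hG
  set L : ℕ → Set Ω := fun k => confined X z k ∩ ({ω | z + η * s z < X k ω} ∩ G k) with hL
  have hGm : ∀ k, MeasurableSet[future X (k + 1)] (G k) := fun k =>
    @MeasurableSet.compl _ _ (future X (k + 1)) (measurableSet_deviates_future X (k + 1) a _ n)
  have hGm' : ∀ k, MeasurableSet (G k) := fun k => future_le h.meas _ _ (hGm k)
  have hfut : ∀ k, future X (k + 1) ≤ future X k := fun k =>
    biSup_mono fun i hi => (Nat.le_succ k).trans hi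
  have hXm : ∀ k, MeasurableSet {ω | z + η * s z < X k ω} := fun k => h.meas k measurableSet_Ioi
  have hGP : ∀ k, 1 - ε ≤ μ.real (G k) := fun k => by
    have hm : MeasurableSet (deviates (fun i => X (k + 1 + i)) a (η / 2 * s z) n) :=
      future_le h.meas _ _ (measurableSet_deviates_future X (k + 1) a _ n)
    rw [hG, probReal_compl_eq_one_sub hm]
    linarith [hdev (k + 1) n hn2]
  have hLP : ∀ k, μ.real (confined X z k) * (tail μ X (z + η * s z) * (1 - ε)) ≤ μ.real (L k) := by
    intro k
    show _ ≤ μ.real (confined X z k ∩ ({ω | z + η * s z < X k ω} ∩ G k))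
    rw [measure_past_inter_future h.meas h.indep (measurableSet_confined_past X z k)
      (B := {ω | z + η * s z < X k ω} ∩ G k) (@MeasurableSet.inter _ (future X k) _ _
        (measurable_future X le_rfl measurableSet_Ioi) (hfut k _ (hGm k))),
      measure_past_inter_future h.meas h.indep (k := k + 1) (A := {ω | z + η * s z < X k ω})
        (measurable_past X (Nat.lt_succ_self k) measurableSet_Ioi) (hGm k), h.measureReal_lt]
    exact mul_le_mul_of_nonneg_left (mul_le_mul_of_nonneg_left (hGP k) (tail_nonneg _))
      measureReal_nonneg
  have hLsub : ∀ k, L k ⊆ crossing X z (k + 1) := fun k ω ⟨⟨h1, h2⟩, h3, _⟩ => by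
    have h3' : z + η * s z < X k ω := h3
    have h4 : z < walk X (k + 1) ω := by
      rw [walk_succ]
      linarith [walk_nonneg_of_alive h1 le_rfl, mul_pos hη hsz]
    refine ⟨fun j hj hjk => ?_, h4, fun j hj => h2 j (by omega)⟩
    rcases hjk.eq_or_lt with rfl | hlt
    · linarith
    · exact h1 j hj (by omega)
  have hLarea : ∀ᵐ ω ∂μ, ω ∈ (⋃ k ∈ Finset.range N, L k) →
      ω ∈ {ω | z ^ 2 / (2 * a) < area X ω ∧ z < maximum X ω} := by
    filter_upwards [h.ae_exists_not_alive] with ω hω hmem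
    obtain ⟨k, -, hk⟩ := mem_iUnion₂.1 hmem
    have hcr := hLsub k hk
    refine ⟨?_, (lt_maximum_iff hω z).2 ⟨_, hcr⟩⟩
    obtain ⟨⟨h1, -⟩, h3, h4⟩ := hk
    have h3' : z + η * s z < X k ω := h3
    have hηs := mul_pos hη hsz
    have hηs' : η * s z ≤ z := by nlinarith
    refine lt_of_le_of_lt ?_ (sq_div_lt_area hω ha (B := z + η / 2 * s z) (m := k + 1) (n := n)
      (by linarith) hcr.1 (by linarith) fun j hj => ?_)
    · gcongr; linarith
    · have h5 : |walk (fun i => X (k + 1 + i)) j ω + a * j| ≤ η / 2 * s z := by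
        by_contra! hlt
        exact h4 ⟨j, hj, hlt⟩
      have h6 := walk_nonneg_of_alive h1 le_rfl
      rw [walk_add, walk_succ]
      linarith [(abs_le.1 h5).1]
  have hmono : μ.real (⋃ k ∈ Finset.range N, L k) ≤
      μ.real {ω | z ^ 2 / (2 * a) < area X ω ∧ z < maximum X ω} :=
    ENNReal.toReal_mono (measure_ne_top _ _) (measure_mono_ae hLarea)
  have hLm : ∀ k, MeasurableSet (L k) := fun k =>
    (measurableSet_confined h.meas z k).inter ((hXm k).inter (hGm' k))
  rw [measureReal_biUnion_finset (fun i _ j _ hij =>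
    (crossing_disjoint X z (fun hh => hij (by omega))).mono (hLsub i) (hLsub j))
    (fun k _ => hLm k)] at hmono
  refine le_trans ?_ hmono
  refine le_trans ?_ (Finset.sum_le_sum fun k _ => hLP k)
  rw [← Finset.sum_mul]
  have hF0 : 0 ≤ tail μ X (z + η * s z) := tail_nonneg _
  have e1 : (T - δ) * (1 + ε) ≤ (T - ε) * (1 - ε) := by nlinarith
  rcases le_or_gt (T - δ) 0 with hneg | hpos
  · exact (mul_nonpos_of_nonpos_of_nonneg hneg (tail_nonneg _)).trans
      (mul_nonneg (Finset.sum_nonneg fun _ _ => measureReal_nonneg)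
        (mul_nonneg hF0 (by linarith)))
  calc (T - δ) * tail μ X z ≤ (T - δ) * ((1 + ε) * tail μ X (z + η * s z)) :=
        mul_le_mul_of_nonneg_left hz.2 hpos.le
    _ = ((T - δ) * (1 + ε)) * tail μ X (z + η * s z) := by ring
    _ ≤ ((T - ε) * (1 - ε)) * tail μ X (z + η * s z) := mul_le_mul_of_nonneg_right e1 hF0
    _ = (T - ε) * (tail μ X (z + η * s z) * (1 - ε)) := by ring
    _ ≤ _ := mul_le_mul_of_nonneg_right hNz (mul_nonneg hF0 (by linarith))

/-- The strong Markov property at the time of crossing. -/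
lemma measureReal_iUnion_crossing_inter_le (h : NegativeDrift μ X a) (y : ℝ) {D : ℕ → Set Ω}
    (hD : ∀ k, MeasurableSet[future X k] (D k)) {ε : ℝ} (hε : 0 ≤ ε) (hDε : ∀ k, μ.real (D k) ≤ ε) :
    μ.real (⋃ k, (crossing X y k ∩ D k)) ≤ ε * μ.real (⋃ k, crossing X y k) := by
  have hdisj : Pairwise (Function.onFun Disjoint fun k => crossing X y k ∩ D k) :=
    fun i j hij => (crossing_disjoint X y hij).mono inter_subset_left inter_subset_left
  have e1 : μ (⋃ k, (crossing X y k ∩ D k)) ≤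
      ENNReal.ofReal ε * μ (⋃ k, crossing X y k) := by
    rw [measure_iUnion hdisj fun k => (measurableSet_crossing h.meas _ k).inter
        (future_le h.meas k _ (hD k)),
      measure_iUnion (crossing_disjoint X y) fun k => measurableSet_crossing h.meas _ k,
      ← ENNReal.tsum_mul_left]
    refine ENNReal.tsum_le_tsum fun k => ?_
    rw [(Indep_iff _ _ _).1 (indep_past_future h.meas h.indep k) _ _
      (measurableSet_crossing_past X y k) (hD k), mul_comm]
    gcongr
    rw [← ofReal_measureReal]
    exact ENNReal.ofReal_le_ofReal (hDε k)
  have e2 := ENNReal.toReal_mono (ENNReal.mul_ne_top ENNReal.ofReal_ne_top (measure_ne_top _ _)) e1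
  rw [ENNReal.toReal_mul, ENNReal.toReal_ofReal hε] at e2
  exact e2

/-- The upper bound: given that `y(z)` is crossed, this happens early, afterwards the walk follows
its mean, and the area is too small unless the maximum is nearly `z`. -/
lemma eventually_measureReal_area_le (h : NegativeDrift μ X a) (hF : HeavyTail (tail μ X))
    {s : ℝ → ℝ} (hs : InsensitivityScale (tail μ X) s)
    (hlim : Tendsto (fun z => z * truncMoment μ X (s z)) atTop (𝓝 0)) {y : ℝ → ℝ}
    (hy : Tendsto y atTop atTop) {C : ℝ} (hC : ∀ᶠ z in atTop, tail μ X (y z) ≤ C * tail μ X z)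
    {δ : ℝ} (hδ : 0 < δ) :
    ∀ᶠ z in atTop, μ.real {ω | z ^ 2 / (2 * a) < area X ω ∧ y z < maximum X ω} ≤
      ((∑' k, μ.real (alive X k)) + δ) * tail μ X z := by
  set T := ∑' k, μ.real (alive X k) with hT
  have hT1 : 1 ≤ T := h.one_le_tsum_alive
  have ha := h.pos
  have hC0 : 0 < C := by
    obtain ⟨z, hz⟩ := hC.exists
    exact pos_of_mul_pos_left ((hF.pos _).trans_le hz) (hF.pos _).le
  set ε := min 1 (δ / (2 + T + C + (T + 1) * C)) with hε
  have hε0 : 0 < ε := lt_min one_pos (by positivity)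
  have hε1 : ε ≤ 1 := min_le_left _ _
  have hεδ : ε * (2 + T + C + (T + 1) * C) ≤ δ :=
    (le_div_iff₀ (by positivity)).1 (min_le_right _ _)
  obtain ⟨η, hη, hη1, hins⟩ := hs.insensitive ε hε0
  obtain ⟨N, hN⟩ := h.eventually_measureReal_late_crossing_le hF hε0
  have hz' : Tendsto (fun z => z - η * s z) atTop atTop := by
    refine tendsto_atTop_mono' atTop ?_ (tendsto_id.atTop_div_const two_pos)
    filter_upwards [hs.le, hs.pos] with z h1 h2
    simp only [id]
    nlinarith
  filter_upwards [hins, hy.eventually hN, hs.pos, hs.le, eventually_ge_atTop a, hC,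
    hs.tendsto.eventually (eventually_ge_atTop (4 * a / η * (N + 2))),
    hz'.eventually (h.eventually_measureReal_crossing_le hF hε0),
    hy.eventually (h.eventually_measureReal_crossing_le hF one_pos),
    h.eventually_measureReal_deviates_le hs.pos hlim (half_pos hη) (by linarith)
      (by positivity : 0 < 3 / a) hε0] with z hz hNz hsz hsz' hza hCz hsN hV hVy hdev
  have hz0 : 0 < z := ha.trans_le hza
  set n := ⌈2 * z / a⌉₊ with hn
  have hn1 : 2 * z ≤ a * n := by
    have : 2 * z / a ≤ n := Nat.le_ceil _
    rw [div_le_iff₀ ha] at this; linarith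
  have hn2 : (n : ℝ) ≤ 3 / a * z := by
    have h1 : (n : ℝ) < 2 * z / a + 1 := Nat.ceil_lt_add_one (by positivity)
    have h2 : 1 ≤ z / a := (one_le_div ha).2 hza
    have h3 : 3 / a * z = 2 * z / a + z / a := by field_simp; ring
    linarith
  set D : ℕ → Set Ω := fun k => deviates (fun i => X (k + i)) a (η / 2 * s z) n with hD
  have hηs := mul_pos hη hsz
  have hηs' : η * s z ≤ z / 2 := by nlinarith
  have hincl : ∀ᵐ ω ∂μ, ω ∈ {ω | z ^ 2 / (2 * a) < area X ω ∧ y z < maximum X ω} →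
      ω ∈ ((⋃ k, crossing X (z - η * s z) k) ∪ ⋃ k ∈ Ioi N, crossing X (y z) k) ∪
        ⋃ k, (crossing X (y z) k ∩ D k) := by
    filter_upwards [h.ae_exists_not_alive] with ω hω hmem
    obtain ⟨hA, hM⟩ := hmem
    by_contra hnot
    simp only [mem_union, not_or] at hnot
    obtain ⟨⟨hn1', hn2'⟩, hn3'⟩ := hnot
    obtain ⟨k, hk⟩ := (lt_maximum_iff hω (y z)).1 hM
    have hkN : k ≤ N := by
      by_contra! hlt
      exact hn2' (mem_iUnion₂.2 ⟨k, hlt, hk⟩)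
    have hnd : ω ∉ D k := fun hd => hn3' (mem_iUnion.2 ⟨k, hk, hd⟩)
    have hmax : ¬ z - η * s z < maximum X ω := fun hlt =>
      hn1' (mem_iUnion.2 ((lt_maximum_iff hω _).1 hlt))
    obtain ⟨M, -, hal, -, -, hmaxiff⟩ := exists_exit hω
    rw [hmaxiff] at hmax
    push Not at hmax
    have hkM := (hal k).1 hk.1
    have hle := area_le hω ha (B := z - η / 2 * s z) (b := z - η * s z) (k := k) (n := n)
      (by linarith) (by linarith) (fun j hj => hmax j (hj.trans hkM)) (by linarith) fun j hj => by
        have h5 : |walk (fun i => X (k + i)) j ω + a * j| ≤ η / 2 * s z := by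
          by_contra! hlt
          exact hnd ⟨j, hj, hlt⟩
        rw [walk_add]
        linarith [(abs_le.1 h5).2, hmax k hkM]
    have hkz : (k : ℝ) * (z - η * s z) ≤ N * z := by
      have : (k : ℝ) ≤ N := by exact_mod_cast hkN
      exact mul_le_mul this (by linarith) (by linarith) (by positivity)
    linarith [linear_add_sq_div_le ha hza hsz hηs' hη hsN]
  have hbad : μ.real (⋃ k, (crossing X (y z) k ∩ D k)) ≤ ε * ((T + 1) * tail μ X (y z)) := by
    exact (h.measureReal_iUnion_crossing_inter_le (y z)
      (fun k => measurableSet_deviates_future X k a _ n) hε0.le fun k => hdev k n hn2).trans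
      (mul_le_mul_of_nonneg_left hVy hε0.le)
  have hmono : μ.real {ω | z ^ 2 / (2 * a) < area X ω ∧ y z < maximum X ω} ≤
      μ.real (((⋃ k, crossing X (z - η * s z) k) ∪ ⋃ k ∈ Ioi N, crossing X (y z) k) ∪
        ⋃ k, (crossing X (y z) k ∩ D k)) :=
    ENNReal.toReal_mono (measure_ne_top _ _) (measure_mono_ae hincl)
  have hu := (hmono.trans (measureReal_union_le _ _)).trans
    (add_le_add_left (measureReal_union_le _ _) _)
  have hFz := hF.pos z
  have f1 : (T + ε) * tail μ X (z - η * s z) ≤ (T + ε) * ((1 + ε) * tail μ X z) :=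
    mul_le_mul_of_nonneg_left hz.1 (by positivity)
  have f2 : ε * tail μ X (y z) ≤ ε * (C * tail μ X z) := mul_le_mul_of_nonneg_left hCz hε0.le
  have f3 : ε * ((T + 1) * tail μ X (y z)) ≤ ε * ((T + 1) * (C * tail μ X z)) := by gcongr
  have f4 : (T + ε) * (1 + ε) + ε * C + ε * ((T + 1) * C) ≤ T + δ := by nlinarith
  nlinarith [mul_le_mul_of_nonneg_right f4 hFz.le]

end NegativeDrift

end

/-! ### The area asymptotics, uniformly in the level -/

section

variable {Ω : Type*} [MeasurableSpace Ω] {μ : Measure Ω} {X : ℕ → Ω → ℝ} {a : ℝ}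

lemma tendsto_sqrt_two_mul (ha : 0 < a) : Tendsto (fun x : ℝ => √(2 * a * x)) atTop atTop :=
  Real.tendsto_sqrt_atTop.comp (tendsto_id.const_mul_atTop (by positivity))

lemma sq_sqrt_div (ha : 0 < a) {x : ℝ} (hx : 0 ≤ x) : √(2 * a * x) ^ 2 / (2 * a) = x := by
  rw [Real.sq_sqrt (by positivity)]; field_simp

namespace NegativeDrift
variable [IsProbabilityMeasure μ]

/-- The asymptotics are uniform between a level `y(z)` at which the tail is of the order of `F(z)`
and `z = √(2ax)`: by monotonicity only the two end points matter. -/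
lemma uniformEquiv_area (h : NegativeDrift μ X a) (hF : HeavyTail (tail μ X)) {s : ℝ → ℝ}
    (hs : InsensitivityScale (tail μ X) s)
    (hlim : Tendsto (fun z => z * truncMoment μ X (s z)) atTop (𝓝 0)) {y : ℝ → ℝ}
    (hy : Tendsto y atTop atTop) {C : ℝ} (hC : ∀ᶠ z in atTop, tail μ X (y z) ≤ C * tail μ X z) :
    UniformEquiv (fun x y => μ.real {ω | x < area X ω ∧ y < maximum X ω})
      (fun x => (meanExitTime μ X).toReal * tail μ X (√(2 * a * x)))
      (fun x => Icc (y √(2 * a * x)) (√(2 * a * x))) := by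
  intro δ hδ
  have hz := tendsto_sqrt_two_mul h.pos
  have hT1 := h.one_le_tsum_alive
  simp only [h.toReal_meanExitTime.2]
  filter_upwards [hz.eventually (h.eventually_le_measureReal_area hs hlim (half_pos hδ)),
    hz.eventually (h.eventually_measureReal_area_le hF hs hlim hy hC (half_pos hδ)),
    eventually_ge_atTop 0] with x h1 h2 hx v hv
  rw [sq_sqrt_div h.pos hx] at h1 h2
  set T := ∑' k, μ.real (alive X k)
  have hFz := hF.pos √(2 * a * x)
  have h3 : μ.real {ω | x < area X ω ∧ √(2 * a * x) < maximum X ω} ≤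
      μ.real {ω | x < area X ω ∧ v < maximum X ω} :=
    measureReal_mono fun ω hω => ⟨hω.1, hv.2.trans_lt hω.2⟩
  have h4 : μ.real {ω | x < area X ω ∧ v < maximum X ω} ≤
      μ.real {ω | x < area X ω ∧ y √(2 * a * x) < maximum X ω} :=
    measureReal_mono fun ω hω => ⟨hω.1, hv.1.trans_lt hω.2⟩
  set P := μ.real {ω | x < area X ω ∧ v < maximum X ω}
  have hpos : 0 < T * tail μ X √(2 * a * x) := by positivity
  have hd : 0 < δ * tail μ X √(2 * a * x) := by positivity
  have hdT : δ * tail μ X √(2 * a * x) ≤ δ * (T * tail μ X √(2 * a * x)) :=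
    mul_le_mul_of_nonneg_left (le_mul_of_one_le_left hFz.le hT1) hδ.le
  rw [abs_sub_lt_iff]
  constructor
  · rw [sub_lt_iff_lt_add, div_lt_iff₀ hpos]
    linarith
  · rw [sub_lt_comm, lt_div_iff₀ hpos]
    linarith

lemma le_liminf_area (h : NegativeDrift μ X a) (hpos : ∀ w, 0 < tail μ X w) {s : ℝ → ℝ}
    (hs : InsensitivityScale (tail μ X) s)
    (hlim : Tendsto (fun z => z * truncMoment μ X (s z)) atTop (𝓝 0)) :
    ((meanExitTime μ X).toReal : EReal) ≤
      liminf (fun x : ℝ => ((μ.real {ω | x < area X ω} /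
        tail μ X (√(2 * a * x)) : ℝ) : EReal)) atTop := by
  refine le_of_forall_lt fun c hc => ?_
  obtain ⟨r, hcr, hrT⟩ := EReal.lt_iff_exists_real_btwn.1 hc
  refine hcr.trans_le (le_liminf_of_le (by isBoundedDefault) ?_)
  rw [h.toReal_meanExitTime.2, EReal.coe_lt_coe_iff] at hrT
  filter_upwards [(tendsto_sqrt_two_mul h.pos).eventually
    (h.eventually_le_measureReal_area hs hlim (sub_pos.2 hrT)), eventually_ge_atTop 0] with x h1 hx
  rw [sq_sqrt_div h.pos hx, sub_sub_cancel] at h1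
  rw [EReal.coe_le_coe_iff, le_div_iff₀ (hpos _)]
  exact h1.trans (measureReal_mono fun ω hω => hω.1)

end NegativeDrift

/-! ### Regularly varying tails -/

/-- Regular variation of the tail `F` with index `-α`. -/
structure RegularlyVaryingTail (F : ℝ → ℝ) (α : ℝ) : Prop where
  pos : ∀ w, 0 < F w
  tendsto_ratio : ∀ t : ℝ, 0 < t → Tendsto (fun x => F (t * x) / F x) atTop (𝓝 (t ^ (-α)))

lemma regularlyVaryingTail_of_eq {F L : ℝ → ℝ} (hanti : Antitone F) {α : ℝ} (hL : SlowlyVarying L)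
    (hF : ∀ᶠ x : ℝ in atTop, F x = x ^ (-α) * L x) : RegularlyVaryingTail F α where
  pos w := by
    obtain ⟨x, hx, hLx, hx0, hxw⟩ := (hF.and (hL.eventually_pos.and
      ((eventually_gt_atTop 0).and (eventually_ge_atTop w)))).exists
    have : 0 < F x := by rw [hx]; positivity
    exact this.trans_le (hanti hxw)
  tendsto_ratio t ht := by
    have h1 := (hL.tendsto_ratio t ht).const_mul (t ^ (-α))
    rw [mul_one] at h1
    refine h1.congr' ?_
    have htx : Tendsto (fun x : ℝ => t * x) atTop atTop := tendsto_id.const_mul_atTop ht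
    filter_upwards [hF, htx.eventually hF, hL.eventually_pos, eventually_gt_atTop 0]
      with x h2 h3 h4 hx
    have : 0 < x ^ (-α) := by positivity
    rw [h2, h3, Real.mul_rpow ht.le hx.le]
    field_simp

namespace RegularlyVaryingTail
variable {F : ℝ → ℝ} {α : ℝ}

lemma eventually_le (hF : RegularlyVaryingTail F α) {t c : ℝ} (ht : 0 < t) (hc : t ^ (-α) < c) :
    ∀ᶠ x in atTop, F (t * x) ≤ c * F x := by
  filter_upwards [(hF.tendsto_ratio t ht).eventually (gt_mem_nhds hc)] with x hx
  exact ((div_lt_iff₀ (hF.pos x)).1 hx).le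

lemma eventually_ge (hF : RegularlyVaryingTail F α) {t c : ℝ} (ht : 0 < t) (hc : c < t ^ (-α)) :
    ∀ᶠ x in atTop, c * F x ≤ F (t * x) := by
  filter_upwards [(hF.tendsto_ratio t ht).eventually (lt_mem_nhds hc)] with x hx
  exact ((lt_div_iff₀ (hF.pos x)).1 hx).le

lemma insensitivityScale (hF : RegularlyVaryingTail F α) : InsensitivityScale F id where
  pos := eventually_gt_atTop 0
  le := Eventually.of_forall fun _ => le_rfl
  tendsto := tendsto_id
  insensitive δ hδ := by
    have c1 : Tendsto (fun η : ℝ => (1 - η) ^ (-α)) (𝓝[>] 0) (𝓝 1) := by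
      have : ContinuousAt (fun η : ℝ => (1 - η) ^ (-α)) 0 :=
        ContinuousAt.rpow_const (by fun_prop) (by simp)
      simpa using this.tendsto.mono_left nhdsWithin_le_nhds
    have c2 : Tendsto (fun η : ℝ => (1 + η) ^ (-α)) (𝓝[>] 0) (𝓝 1) := by
      have : ContinuousAt (fun η : ℝ => (1 + η) ^ (-α)) 0 :=
        ContinuousAt.rpow_const (by fun_prop) (by simp)
      simpa using this.tendsto.mono_left nhdsWithin_le_nhds
    have hinv : (1 + δ)⁻¹ < 1 := inv_lt_one_of_one_lt₀ (by linarith)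
    obtain ⟨η, h1, h2, h3, h4⟩ := ((c1.eventually (gt_mem_nhds (by linarith : 1 < 1 + δ))).and
      ((c2.eventually (lt_mem_nhds hinv)).and
      (eventually_mem_nhdsWithin.and ((eventually_le_nhds
        (by norm_num : (0 : ℝ) < 1 / 2)).filter_mono nhdsWithin_le_nhds)))).exists
    have h3' : 0 < η := h3
    refine ⟨η, h3', h4, ?_⟩
    filter_upwards [hF.eventually_le (by linarith : 0 < 1 - η) h1,
      hF.eventually_ge (by linarith : 0 < 1 + η) h2] with z e1 e2
    simp only [id]
    constructor
    · rwa [show (1 - η) * z = z - η * z by ring] at e1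
    · rw [inv_mul_le_iff₀ (by linarith)] at e2
      rwa [show (1 + η) * z = z + η * z by ring] at e2

lemma heavyTail (hF : RegularlyVaryingTail F α) (hanti : Antitone F)
    (hint : IntegrableOn F (Ioi 0)) : HeavyTail F where
  pos := hF.pos
  long := hF.insensitivityScale.long hanti
  dom := by
    refine ⟨fun t => ((1 / 2 : ℝ) ^ (-α) + 1) * F t, hint.const_mul _, ?_⟩
    filter_upwards [hF.eventually_le (by norm_num : (0 : ℝ) < 1 / 2) (lt_add_one _)]
      with w hw t _ htw
    have h1 : F (w - t) ≤ F (1 / 2 * w) := hanti (by linarith)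
    calc F t * F (w - t) ≤ F t * (((1 / 2 : ℝ) ^ (-α) + 1) * F w) :=
          mul_le_mul_of_nonneg_left (h1.trans hw) (hF.pos t).le
      _ = _ := by ring

end RegularlyVaryingTail

/-- At the scale `s(z) = z` a finite mean suffices. -/
lemma NegativeDrift.tendsto_mul_truncMoment_id [IsProbabilityMeasure μ]
    (h : NegativeDrift μ X a) :
    Tendsto (fun z => z * truncMoment μ X (id z)) atTop (𝓝 0) := by
  have hm := h.meas 0
  have h1 : Tendsto (fun z : ℝ => ∫ ω, z * min (|X 0 ω| / z) ((X 0 ω / z) ^ 2) ∂μ) atTop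
      (𝓝 (∫ _, (0 : ℝ) ∂μ)) := by
    refine tendsto_integral_filter_of_dominated_convergence (fun ω => |X 0 ω|) ?_ ?_ h.int.abs
      (ae_of_all _ fun ω => ?_)
    · exact Eventually.of_forall fun z => Measurable.aestronglyMeasurable (by fun_prop)
    · filter_upwards [eventually_gt_atTop 0] with z hz
      refine ae_of_all _ fun ω => ?_
      rw [Real.norm_of_nonneg (by positivity)]
      calc z * min (|X 0 ω| / z) ((X 0 ω / z) ^ 2) ≤ z * (|X 0 ω| / z) := by
            gcongr; exact min_le_left _ _
        _ = |X 0 ω| := by field_simp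
    · have h2 : Tendsto (fun z : ℝ => X 0 ω ^ 2 / z) atTop (𝓝 0) :=
        tendsto_const_nhds.div_atTop tendsto_id
      refine tendsto_of_tendsto_of_tendsto_of_le_of_le' tendsto_const_nhds h2 ?_ ?_
      · filter_upwards [eventually_gt_atTop 0] with z hz
        positivity
      · filter_upwards [eventually_gt_atTop 0] with z hz
        calc z * min (|X 0 ω| / z) ((X 0 ω / z) ^ 2) ≤ z * (X 0 ω / z) ^ 2 := by
              gcongr; exact min_le_right _ _
          _ = X 0 ω ^ 2 / z := by field_simp
  rw [integral_zero] at h1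
  refine h1.congr fun z => ?_
  rw [integral_const_mul]; rfl

end

/-! ### Semi-exponential tails -/

section

variable {Ω : Type*}

/-- A semi-exponential tail: `F(x) ∼ x^{-ϰ} e^{-g(x)}` where `g → ∞`, and `g(x)/x^β` is
nonincreasing beyond some point, for some `β ∈ (0, 1)`. -/
structure SemiExponentialTail (F : ℝ → ℝ) (β ϰ x₀ : ℝ) (g : ℝ → ℝ) : Prop where
  beta_pos : 0 < β
  beta_lt : β < 1
  one_lt : 1 < ϰ
  x₀_nonneg : 0 ≤ x₀
  anti : AntitoneOn (fun x => g x / x ^ β) (Ioi x₀)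
  equiv : F ~[atTop] fun x => x ^ (-ϰ) * Real.exp (-g x)
  tendsto : Tendsto g atTop atTop

namespace SemiExponentialTail
variable {F g : ℝ → ℝ} {β ϰ x₀ : ℝ}

lemma tendsto_div (hF : SemiExponentialTail F β ϰ x₀ g) :
    Tendsto (fun x => F x / (x ^ (-ϰ) * Real.exp (-g x))) atTop (𝓝 1) := by
  refine (isEquivalent_iff_tendsto_one ?_).1 hF.equiv
  filter_upwards [eventually_gt_atTop 0] with x hx
  positivity

/-- Two-sided bounds for the tail, and the range in which `g` is positive. -/
lemma exists_bounds (hF : SemiExponentialTail F β ϰ x₀ g) {ε : ℝ} (hε : 0 < ε) :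
    ∃ x₁, 1 ≤ x₁ ∧ x₀ < x₁ ∧ ∀ x, x₁ ≤ x → 0 < g x ∧
      F x ≤ (1 + ε) * (x ^ (-ϰ) * Real.exp (-g x)) ∧
      x ^ (-ϰ) * Real.exp (-g x) ≤ (1 + ε) * F x := by
  have hinv : (1 + ε)⁻¹ < 1 := inv_lt_one_of_one_lt₀ (by linarith)
  have h1 := hF.tendsto_div.eventually (gt_mem_nhds (by linarith : 1 < 1 + ε))
  have h2 := hF.tendsto_div.eventually (lt_mem_nhds hinv)
  obtain ⟨x₁, hx₁⟩ := eventually_atTop.1 (h1.and (h2.and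
    (hF.tendsto.eventually (eventually_gt_atTop 0))))
  refine ⟨max x₁ (max 1 (x₀ + 1)), (le_max_left _ _).trans (le_max_right _ _),
    (lt_add_one x₀).trans_le ((le_max_right _ _).trans (le_max_right _ _)), fun x hx => ?_⟩
  obtain ⟨e1, e2, e3⟩ := hx₁ x ((le_max_left _ _).trans hx)
  have hx0 : 0 < x := zero_lt_one.trans_le
    (((le_max_left _ _).trans (le_max_right _ _)).trans hx)
  have hφ : 0 < x ^ (-ϰ) * Real.exp (-g x) := by positivity
  refine ⟨e3, ((div_lt_iff₀ hφ).1 e1).le, ?_⟩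
  have := (lt_div_iff₀ hφ).1 e2
  rw [inv_mul_lt_iff₀ (by linarith)] at this
  exact this.le

lemma mul_div_le (hF : SemiExponentialTail F β ϰ x₀ g) {x y : ℝ} (hx₀ : x₀ < x) (hgx : 0 < g x)
    (hxy : x ≤ y) : x / y * g y ≤ g x := by
  have hx0 : 0 < x := hF.x₀_nonneg.trans_lt hx₀
  have hy0 : 0 < y := hx0.trans_le hxy
  have h1 : g y / y ^ β ≤ g x / x ^ β := hF.anti hx₀ (hx₀.trans_le hxy) hxy
  have hxb : 0 < x ^ β := by positivity
  have hyb : 0 < y ^ β := by positivity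
  have h2 : (x / y) ^ β * g y ≤ g x := by
    rw [Real.div_rpow hx0.le hy0.le]
    rw [div_le_div_iff₀ hyb hxb] at h1
    rw [div_mul_eq_mul_div, div_le_iff₀ hyb]
    linarith
  rcases le_or_gt (g y) 0 with hg | hg
  · exact (mul_nonpos_of_nonneg_of_nonpos (by positivity) hg).trans hgx.le
  · refine (mul_le_mul_of_nonneg_right ?_ hg.le).trans h2
    calc x / y = (x / y) ^ (1 : ℝ) := (Real.rpow_one _).symm
      _ ≤ (x / y) ^ β := Real.rpow_le_rpow_of_exponent_ge (by positivity)
        ((div_le_one hy0).2 hxy) hF.beta_lt.le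

/-- Comparison of the tail at two points. -/
lemma exists_ratio_le (hF : SemiExponentialTail F β ϰ x₀ g) {ε : ℝ} (hε : 0 < ε) (hε1 : ε ≤ 1) :
    ∃ x₁, 1 ≤ x₁ ∧ x₀ < x₁ ∧ ∀ y z, x₁ ≤ y → y ≤ z →
      F y ≤ (1 + 3 * ε) * (z / y) ^ ϰ * Real.exp ((z - y) / z * g z) * F z := by
  obtain ⟨x₁, h1, hx₀, hb⟩ := hF.exists_bounds hε
  refine ⟨x₁, h1, hx₀, fun y z hy hyz => ?_⟩
  obtain ⟨hgy, hFy, -⟩ := hb y hy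
  obtain ⟨hgz, -, hFz⟩ := hb z (hy.trans hyz)
  have hy0 : 0 < y := by linarith
  have hz0 : 0 < z := by linarith
  have hg := hF.mul_div_le (hx₀.trans_le hy) hgy hyz
  have hexp : Real.exp (-g y) ≤ Real.exp ((z - y) / z * g z) * Real.exp (-g z) := by
    rw [← Real.exp_add]
    refine Real.exp_le_exp.2 ?_
    have : (z - y) / z * g z = g z - y / z * g z := by field_simp
    linarith
  have hpow : y ^ (-ϰ) = (z / y) ^ ϰ * z ^ (-ϰ) := by
    rw [Real.div_rpow hz0.le hy0.le, Real.rpow_neg hy0.le, Real.rpow_neg hz0.le]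
    field_simp
  have hFz0 : 0 ≤ F z := by
    have : 0 < (1 + ε) * F z := lt_of_lt_of_le (by positivity) hFz
    exact (pos_of_mul_pos_right this (by positivity)).le
  calc F y ≤ (1 + ε) * (y ^ (-ϰ) * Real.exp (-g y)) := hFy
    _ ≤ (1 + ε) * (((z / y) ^ ϰ * z ^ (-ϰ)) *
          (Real.exp ((z - y) / z * g z) * Real.exp (-g z))) := by rw [hpow]; gcongr
    _ = (1 + ε) * ((z / y) ^ ϰ * Real.exp ((z - y) / z * g z)) *
          (z ^ (-ϰ) * Real.exp (-g z)) := by ring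
    _ ≤ (1 + ε) * ((z / y) ^ ϰ * Real.exp ((z - y) / z * g z)) * ((1 + ε) * F z) := by gcongr
    _ = (1 + ε) ^ 2 * ((z / y) ^ ϰ * Real.exp ((z - y) / z * g z) * F z) := by ring
    _ ≤ (1 + 3 * ε) * ((z / y) ^ ϰ * Real.exp ((z - y) / z * g z) * F z) := by
        gcongr; nlinarith
    _ = _ := by ring

lemma exists_le_rpow (hF : SemiExponentialTail F β ϰ x₀ g) :
    ∃ C x₁, 0 < C ∧ 1 ≤ x₁ ∧ ∀ x, x₁ ≤ x → g x ≤ C * x ^ β := by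
  obtain ⟨x₁, h1, hx₀, hb⟩ := hF.exists_bounds one_pos
  have hx₁ : 0 < x₁ := by linarith
  refine ⟨g x₁ / x₁ ^ β, x₁, div_pos (hb x₁ le_rfl).1 (by positivity), h1, fun x hx => ?_⟩
  have hx0 : 0 < x := hx₁.trans_le hx
  have : g x / x ^ β ≤ g x₁ / x₁ ^ β := hF.anti hx₀ (hx₀.trans_le hx) hx
  exact (div_le_iff₀ (by positivity)).1 this

lemma pos (hF : SemiExponentialTail F β ϰ x₀ g) (hanti : Antitone F) (w : ℝ) : 0 < F w := by
  obtain ⟨x₁, h1, -, hb⟩ := hF.exists_bounds one_pos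
  obtain ⟨-, -, h2⟩ := hb (max x₁ w) (le_max_left _ _)
  have hx0 : 0 < max x₁ w := zero_lt_one.trans_le (h1.trans (le_max_left _ _))
  have : 0 < (1 + 1) * F (max x₁ w) := lt_of_lt_of_le (by positivity) h2
  exact (pos_of_mul_pos_right this (by norm_num)).trans_le (hanti (le_max_right _ _))

lemma insensitivityScale (hF : SemiExponentialTail F β ϰ x₀ g) (hanti : Antitone F) :
    InsensitivityScale F (fun z => z ^ (1 - β)) where
  pos := by filter_upwards [eventually_gt_atTop 0] with z hz; positivity
  le := by
    filter_upwards [eventually_ge_atTop 1] with z hz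
    calc z ^ (1 - β) ≤ z ^ (1 : ℝ) :=
          Real.rpow_le_rpow_of_exponent_le hz (by linarith [hF.beta_pos])
      _ = z := Real.rpow_one z
  tendsto := tendsto_rpow_atTop (by linarith [hF.beta_lt])
  insensitive δ hδ := by
    obtain ⟨C, x₂, hC, hx₂, hg⟩ := hF.exists_le_rpow
    set ε := min 1 (δ / 6) with hε
    have hε0 : 0 < ε := lt_min one_pos (by positivity)
    obtain ⟨x₁, hx₁, -, hr⟩ := hF.exists_ratio_le hε0 (min_le_left _ _)
    have hεδ : 1 + 3 * ε < 1 + δ := by linarith [min_le_right 1 (δ / 6)]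
    have c1 : Tendsto (fun η : ℝ => (1 + 3 * ε) * (1 / (1 - η)) ^ ϰ * Real.exp (η * C))
        (𝓝[>] 0) (𝓝 (1 + 3 * ε)) := by
      have : ContinuousAt
          (fun η : ℝ => (1 + 3 * ε) * (1 / (1 - η)) ^ ϰ * Real.exp (η * C)) 0 := by
        refine ContinuousAt.mul (continuousAt_const.mul
          (ContinuousAt.rpow_const (ContinuousAt.div (by fun_prop) (by fun_prop) (by simp))
            (by simp))) (by fun_prop)
      simpa using this.tendsto.mono_left nhdsWithin_le_nhds
    obtain ⟨η, h1, h2, h3⟩ := ((c1.eventually (gt_mem_nhds hεδ)).and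
      (eventually_mem_nhdsWithin.and ((eventually_le_nhds
        (by norm_num : (0 : ℝ) < 1 / 2)).filter_mono nhdsWithin_le_nhds))).exists
    have hη : 0 < η := h2
    have hϰ : 0 < ϰ := zero_lt_one.trans hF.one_lt
    -- both comparisons are instances of the following one
    have key : ∀ y z, max x₁ x₂ ≤ y → y ≤ z → z - y ≤ η * z ^ (1 - β) → z / y ≤ 1 / (1 - η) →
        F y ≤ (1 + δ) * F z := by
      intro y z hy hyz hd hq
      have hy0 : 0 < y := by linarith [(le_max_left _ _).trans hy]
      have hz0 : 0 < z := by linarith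
      have hgz := hg z (((le_max_right _ _).trans hy).trans hyz)
      have hexp : (z - y) / z * g z ≤ η * C := by
        calc (z - y) / z * g z ≤ (z - y) / z * (C * z ^ β) :=
              mul_le_mul_of_nonneg_left hgz (div_nonneg (by linarith) hz0.le)
          _ ≤ (η * z ^ (1 - β)) / z * (C * z ^ β) := by gcongr
          _ = η * C * (z ^ (1 - β) * z ^ β / z) := by ring
          _ = η * C := by
              rw [← Real.rpow_add hz0, sub_add_cancel, Real.rpow_one, div_self hz0.ne', mul_one]
      have hq0 : 0 < 1 / (1 - η) := one_div_pos.2 (by linarith)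
      refine (hr y z ((le_max_left _ _).trans hy) hyz).trans
        (mul_le_mul_of_nonneg_right (le_trans ?_ h1.le) (hF.pos hanti z).le)
      gcongr
    refine ⟨η, hη, h3, ?_⟩
    filter_upwards [eventually_ge_atTop (2 * max x₁ x₂)] with z hz
    have hm1 : 1 ≤ max x₁ x₂ := hx₁.trans (le_max_left _ _)
    have hz1 : 1 ≤ z := by linarith
    have hz0 : 0 < z := by linarith
    have hsz : z ^ (1 - β) ≤ z := by
      calc z ^ (1 - β) ≤ z ^ (1 : ℝ) :=
            Real.rpow_le_rpow_of_exponent_le hz1 (by linarith [hF.beta_pos])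
        _ = z := Real.rpow_one z
    have hs0 : 0 < z ^ (1 - β) := by positivity
    have hηs : η * z ^ (1 - β) ≤ η * z := mul_le_mul_of_nonneg_left hsz hη.le
    have hηz : η * z ≤ 1 / 2 * z := mul_le_mul_of_nonneg_right h3 hz0.le
    have hηs0 := mul_pos hη hs0
    constructor
    · refine key _ _ (by linarith) (by linarith) (by linarith) ?_
      rw [div_le_div_iff₀ (by linarith) (by linarith)]
      linarith
    · refine key _ _ (by linarith) (by linarith) ?_ ?_
      · rw [add_sub_cancel_left]
        gcongr
        · linarith [hF.beta_lt]
        · linarith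
      · rw [div_le_div_iff₀ hz0 (by linarith)]
        nlinarith

lemma heavyTail (hF : SemiExponentialTail F β ϰ x₀ g) (hanti : Antitone F) (h1 : ∀ w, F w ≤ 1) :
    HeavyTail F where
  pos := hF.pos hanti
  long := (hF.insensitivityScale hanti).long hanti
  dom := by
    obtain ⟨x₁, hx₁, hx₀, hb⟩ := hF.exists_bounds one_pos
    have hx10 : 0 < x₁ := by linarith
    have hϰ : 0 < ϰ := zero_lt_one.trans hF.one_lt
    refine ⟨(Iic x₁).piecewise (fun _ => 2) (fun t => 8 * 2 ^ ϰ * t ^ (-ϰ)), ?_, ?_⟩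
    · rw [← Ioc_union_Ioi_eq_Ioi hx10.le]
      refine IntegrableOn.union ?_ ?_
      · refine (integrableOn_const (C := (2 : ℝ)) (by simp)).congr_fun (fun t ht => ?_)
          measurableSet_Ioc
        exact (piecewise_eq_of_mem (Iic x₁) (fun _ => (2 : ℝ)) _ (mem_Iic.2 ht.2)).symm
      · have hint : IntegrableOn (fun t : ℝ => 8 * 2 ^ ϰ * t ^ (-ϰ)) (Ioi x₁) :=
          (integrableOn_Ioi_rpow_of_lt (by linarith [hF.one_lt] : -ϰ < -1) hx10).const_mul _
        refine hint.congr_fun (fun t ht => ?_) measurableSet_Ioi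
        exact (piecewise_eq_of_notMem (Iic x₁) (fun _ => (2 : ℝ))
          (fun t : ℝ => 8 * 2 ^ ϰ * t ^ (-ϰ)) (fun h => not_lt.2 (mem_Iic.1 h) ht)).symm
    · filter_upwards [(hF.insensitivityScale hanti).long hanti x₁ 1 one_pos,
        eventually_ge_atTop (2 * x₁)] with w hw hwx t ht htw
      by_cases hle : t ≤ x₁
      · rw [piecewise_eq_of_mem (Iic x₁) _ _ (mem_Iic.2 hle)]
        have e1 : F (w - t) ≤ F (w - x₁) := hanti (by linarith)
        have e2 := hF.pos hanti (w - t)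
        have e3 := hF.pos hanti t
        nlinarith [h1 t]
      · rw [piecewise_eq_of_notMem (Iic x₁) _ _ (fun h => hle (mem_Iic.1 h))]
        push Not at hle
        obtain ⟨hgt, hFt, -⟩ := hb t hle.le
        obtain ⟨hgv, hFv, -⟩ := hb (w - t) (by linarith)
        obtain ⟨hgw, -, hFw⟩ := hb w (by linarith)
        have hv0 : 0 < w - t := by linarith
        have hw0 : 0 < w := by linarith
        -- `g(x)/x` is nonincreasing, so `g` is subadditive
        have hsub : g w ≤ g t + g (w - t) := by
          have i1 := hF.mul_div_le (hx₀.trans hle) hgt (by linarith : t ≤ w)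
          have i2 := hF.mul_div_le (hx₀.trans_le (by linarith : x₁ ≤ w - t)) hgv
            (by linarith : w - t ≤ w)
          have i3 : t / w * g w + (w - t) / w * g w = g w := by field_simp; ring
          linarith
        have hexp : Real.exp (-g t) * Real.exp (-g (w - t)) ≤ Real.exp (-g w) := by
          rw [← Real.exp_add]
          exact Real.exp_le_exp.2 (by linarith)
        have hpow : (w - t) ^ (-ϰ) ≤ 2 ^ ϰ * w ^ (-ϰ) := by
          calc (w - t) ^ (-ϰ) ≤ (w / 2) ^ (-ϰ) :=
                Real.rpow_le_rpow_of_nonpos (by positivity) (by linarith) (by linarith)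
            _ = 2 ^ ϰ * w ^ (-ϰ) := by
                rw [Real.div_rpow hw0.le zero_le_two, Real.rpow_neg zero_le_two]
                field_simp
        calc F t * F (w - t)
            ≤ ((1 + 1) * (t ^ (-ϰ) * Real.exp (-g t))) *
                ((1 + 1) * ((w - t) ^ (-ϰ) * Real.exp (-g (w - t)))) :=
              mul_le_mul hFt hFv (hF.pos hanti _).le (by positivity)
          _ = 4 * t ^ (-ϰ) * (w - t) ^ (-ϰ) * (Real.exp (-g t) * Real.exp (-g (w - t))) := by ring
          _ ≤ 4 * t ^ (-ϰ) * (2 ^ ϰ * w ^ (-ϰ)) * Real.exp (-g w) := by gcongr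
          _ = 4 * 2 ^ ϰ * t ^ (-ϰ) * (w ^ (-ϰ) * Real.exp (-g w)) := by ring
          _ ≤ 4 * 2 ^ ϰ * t ^ (-ϰ) * ((1 + 1) * F w) := by gcongr
          _ = 8 * 2 ^ ϰ * t ^ (-ϰ) * F w := by ring

/-- The lower end point `z - R z / g(z)` of the range of levels. -/
lemma eventually_half_le_sub_div (hF : SemiExponentialTail F β ϰ x₀ g) {R : ℝ} (hR : 0 < R) :
    ∀ᶠ z in atTop, z / 2 ≤ z - R * z / g z ∧ z - R * z / g z ≤ z ∧ 0 < g z ∧ 0 < z := by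
  filter_upwards [hF.tendsto.eventually (eventually_ge_atTop (2 * R)), eventually_gt_atTop 0]
    with z hz hz0
  have hg : 0 < g z := by linarith
  have h1 : R * z / g z ≤ z / 2 := by
    rw [div_le_div_iff₀ hg two_pos]; nlinarith
  have h2 : 0 ≤ R * z / g z := by positivity
  exact ⟨by linarith, by linarith, hg, hz0⟩

lemma exists_le_mul (hF : SemiExponentialTail F β ϰ x₀ g) (hanti : Antitone F) {R : ℝ}
    (hR : 0 < R) : ∃ C, ∀ᶠ z in atTop, F (z - R * z / g z) ≤ C * F z := by
  obtain ⟨x₁, hx₁, -, hr⟩ := hF.exists_ratio_le one_pos le_rfl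
  have hϰ : 0 < ϰ := zero_lt_one.trans hF.one_lt
  refine ⟨(1 + 3 * 1) * 2 ^ ϰ * Real.exp R, ?_⟩
  filter_upwards [hF.eventually_half_le_sub_div hR, eventually_ge_atTop (2 * x₁)]
    with z ⟨h1, h2, hg, hz0⟩ hz
  set y := z - R * z / g z with hy
  have hy0 : 0 < y := by linarith
  have := hr y z (by linarith) h2
  have e : (z - y) / z * g z = R := by rw [hy]; field_simp; ring
  rw [e] at this
  refine this.trans (mul_le_mul_of_nonneg_right ?_ (hF.pos hanti z).le)
  gcongr
  rw [div_le_iff₀ hy0]; linarith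

end SemiExponentialTail

variable [MeasurableSpace Ω] {μ : Measure Ω} {X : ℕ → Ω → ℝ} {a : ℝ}

/-- A finite moment of order `ϰ` makes `x^ϰ P(X > x)` vanish at infinity. -/
lemma tendsto_rpow_mul_tail [IsProbabilityMeasure μ] (hX : Measurable (X 0)) {ϰ : ℝ} (hϰ : 0 < ϰ)
    (hmom : Integrable (fun ω => |X 0 ω| ^ ϰ) μ) :
    Tendsto (fun x : ℝ => x ^ ϰ * tail μ X x) atTop (𝓝 0) := by
  have h1 : Tendsto (fun x : ℝ => ∫ ω, {ω | x < X 0 ω}.indicator (fun ω => |X 0 ω| ^ ϰ) ω ∂μ)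
      atTop (𝓝 (∫ _, (0 : ℝ) ∂μ)) := by
    refine tendsto_integral_filter_of_dominated_convergence (fun ω => |X 0 ω| ^ ϰ) ?_ ?_ hmom
      (ae_of_all _ fun ω => ?_)
    · exact Eventually.of_forall fun x =>
        hmom.aestronglyMeasurable.indicator (measurableSet_lt measurable_const hX)
    · refine Eventually.of_forall fun x => ae_of_all _ fun ω => ?_
      rw [Real.norm_of_nonneg (indicator_nonneg (fun _ _ => by positivity) _)]
      exact indicator_le_self' (fun _ _ => by positivity) _
    · refine tendsto_const_nhds.congr' ?_
      filter_upwards [eventually_ge_atTop (X 0 ω)] with x hx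
      exact (indicator_of_notMem (s := {ω | x < X 0 ω}) (not_lt.2 hx) _).symm
  rw [integral_zero] at h1
  refine squeeze_zero' ?_ ?_ h1
  · filter_upwards [eventually_ge_atTop 0] with x hx
    exact mul_nonneg (by positivity) (tail_nonneg x)
  · filter_upwards [eventually_ge_atTop 0] with x hx
    have hm : MeasurableSet {ω | x < X 0 ω} := measurableSet_lt measurable_const hX
    calc x ^ ϰ * tail μ X x = ∫ ω, {ω | x < X 0 ω}.indicator (fun _ => x ^ ϰ) ω ∂μ := by
          rw [integral_indicator_const _ hm, smul_eq_mul, mul_comm]; rfl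
      _ ≤ _ := by
          refine integral_mono ((integrable_const _).indicator hm) (hmom.indicator hm) fun ω => ?_
          refine indicator_le_indicator' fun hω => ?_
          have hω' : x < X 0 ω := hω
          exact Real.rpow_le_rpow hx (hω'.le.trans (le_abs_self _)) hϰ.le

/-- The moment of order `ϰ` forces `g → ∞`. -/
lemma semiExponentialTail_of_isEquivalent [IsProbabilityMeasure μ] (hX : Measurable (X 0))
    {β ϰ x₀ : ℝ} {g : ℝ → ℝ} (hβ : 0 < β) (hβ1 : β < 1 / 2) (hϰ : 1 / (1 - β) < ϰ) (hx₀ : 0 ≤ x₀)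
    (hanti : AntitoneOn (fun x => g x / x ^ β) (Ioi x₀))
    (hequiv : tail μ X ~[atTop] fun x => x ^ (-ϰ) * Real.exp (-g x))
    (hmom : Integrable (fun ω => |X 0 ω| ^ ϰ) μ) :
    SemiExponentialTail (tail μ X) β ϰ x₀ g := by
  have hϰ1 : 1 < ϰ := ((one_lt_div (by linarith)).2 (by linarith)).trans hϰ
  refine ⟨hβ, by linarith, hϰ1, hx₀, hanti, hequiv, ?_⟩
  have h1 := tendsto_rpow_mul_tail hX (by linarith) hmom
  have h2 : Tendsto (fun x => tail μ X x / (x ^ (-ϰ) * Real.exp (-g x))) atTop (𝓝 1) := by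
    refine (isEquivalent_iff_tendsto_one ?_).1 hequiv
    filter_upwards [eventually_gt_atTop 0] with x hx
    positivity
  rw [tendsto_atTop]
  intro c
  filter_upwards [h2.eventually (lt_mem_nhds (by norm_num : (1 / 2 : ℝ) < 1)),
    h1.eventually (gt_mem_nhds (by positivity : 0 < Real.exp (-c) / 2)), eventually_gt_atTop 0]
    with x e1 e2 hx
  rw [lt_div_iff₀ (by positivity)] at e1
  have hpow : x ^ ϰ * x ^ (-ϰ) = 1 := by rw [← Real.rpow_add hx, add_neg_cancel, Real.rpow_zero]
  have e3 : Real.exp (-g x) < Real.exp (-c) := by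
    have hxϰ : 0 < x ^ ϰ := by positivity
    have := mul_lt_mul_of_pos_left e1 hxϰ
    have e4 : x ^ ϰ * (1 / 2 * (x ^ (-ϰ) * Real.exp (-g x))) =
        (x ^ ϰ * x ^ (-ϰ)) * (1 / 2 * Real.exp (-g x)) := by ring
    rw [e4, hpow, one_mul] at this
    linarith
  linarith [Real.exp_lt_exp.1 e3]

lemma min_le_rpow {u p : ℝ} (hu : 0 ≤ u) (hp1 : 1 ≤ p) (hp2 : p ≤ 2) : min u (u ^ 2) ≤ u ^ p := by
  rcases le_total u 1 with h | h
  · rcases hu.eq_or_lt with rfl | hu0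
    · simp [Real.zero_rpow (by linarith : p ≠ 0)]
    refine (min_le_right _ _).trans ?_
    calc u ^ 2 = u ^ (2 : ℝ) := by norm_cast
      _ ≤ u ^ p := Real.rpow_le_rpow_of_exponent_ge hu0 h hp2
  · refine (min_le_left _ _).trans ?_
    calc u = u ^ (1 : ℝ) := (Real.rpow_one u).symm
      _ ≤ u ^ p := Real.rpow_le_rpow_of_exponent_le h hp1

/-- At the scale `s(z) = z^{1-β}` a moment of order `p ∈ (1/(1-β), 2]` is needed; as `β < 1/2`, the
moment of order `ϰ` gives one. -/
lemma NegativeDrift.tendsto_mul_truncMoment_rpow [IsProbabilityMeasure μ]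
    (h : NegativeDrift μ X a) {β ϰ : ℝ} (hβ : 0 < β) (hβ1 : β < 1 / 2) (hϰ : 1 / (1 - β) < ϰ)
    (hmom : Integrable (fun ω => |X 0 ω| ^ ϰ) μ) :
    Tendsto (fun z : ℝ => z * truncMoment μ X (z ^ (1 - β))) atTop (𝓝 0) := by
  set p := min ϰ 2 with hp
  have hϰ1 : 1 < ϰ := ((one_lt_div (by linarith)).2 (by linarith)).trans hϰ
  have hp1 : 1 ≤ p := le_min hϰ1.le one_le_two
  have hp2 : p ≤ 2 := min_le_right _ _
  have hpβ : 1 < (1 - β) * p := by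
    rw [div_lt_iff₀ (by linarith)] at hϰ
    rcases min_choice ϰ 2 with hc | hc <;> rw [hp, hc] <;> linarith
  have hpm : Integrable (fun ω => |X 0 ω| ^ p) μ := by
    have hm : Measurable fun ω => |X 0 ω| ^ p := ((h.meas 0).abs).pow_const p
    refine (hmom.add (integrable_const (1 : ℝ))).mono' hm.aestronglyMeasurable
      (ae_of_all _ fun ω => ?_)
    rw [Real.norm_of_nonneg (by positivity), Pi.add_apply]
    rcases le_total |X 0 ω| 1 with hx | hx
    · have := Real.rpow_le_one (abs_nonneg (X 0 ω)) hx (by linarith : 0 ≤ p)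
      have h2 : 0 ≤ |X 0 ω| ^ ϰ := by positivity
      linarith
    · have := Real.rpow_le_rpow_of_exponent_le hx (min_le_left ϰ 2)
      linarith
  set E := ∫ ω, |X 0 ω| ^ p ∂μ with hE
  have hlim : Tendsto (fun z : ℝ => E * z ^ (-((1 - β) * p - 1))) atTop (𝓝 0) := by
    simpa using (tendsto_rpow_neg_atTop (by linarith : 0 < (1 - β) * p - 1)).const_mul E
  refine squeeze_zero' ?_ ?_ hlim
  · filter_upwards [eventually_gt_atTop 0] with z hz
    exact mul_nonneg hz.le (integral_nonneg fun ω => by positivity)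
  · filter_upwards [eventually_gt_atTop 0] with z hz
    have hs : 0 < z ^ (1 - β) := by positivity
    have h1 : truncMoment μ X (z ^ (1 - β)) ≤ E / (z ^ (1 - β)) ^ p := by
      rw [hE, ← integral_div]
      refine integral_mono (h.integrable_truncMoment hs) (hpm.div_const _) fun ω => ?_
      have := min_le_rpow (u := |X 0 ω| / z ^ (1 - β)) (by positivity) hp1 hp2
      simp only
      rwa [Real.div_rpow (abs_nonneg _) hs.le, div_pow, sq_abs, ← div_pow] at this
    calc z * truncMoment μ X (z ^ (1 - β)) ≤ z * (E / (z ^ (1 - β)) ^ p) := by gcongr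
      _ = E * z ^ (-((1 - β) * p - 1)) := by
          rw [← Real.rpow_mul hz.le, neg_sub, Real.rpow_sub hz, Real.rpow_one]
          ring

end

/-! ### Power bounds for regularly varying tails -/

section

variable {Ω : Type*}

lemma le_of_doubling {φ : ℝ → ℝ} {x₀ C : ℝ} (hx₀ : 0 < x₀) (hb : ∀ t ∈ Icc x₀ (2 * x₀), φ t ≤ C)
    (hd : ∀ t, x₀ ≤ t → φ (2 * t) ≤ φ t) {t : ℝ} (ht : x₀ ≤ t) : φ t ≤ C := by
  have key : ∀ (n : ℕ) (t : ℝ), x₀ ≤ t → t ≤ 2 ^ n * x₀ → φ t ≤ C := by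
    intro n
    induction n with
    | zero => exact fun t h1 h2 => hb t ⟨h1, by linarith⟩
    | succ n ih =>
      intro t h1 h2
      rcases le_total t (2 * x₀) with h3 | h3
      · exact hb t ⟨h1, h3⟩
      · have h4 := hd (t / 2) (by linarith)
        rw [mul_div_cancel₀ t two_ne_zero] at h4
        exact h4.trans (ih _ (by linarith) (by rw [pow_succ] at h2; linarith))
  obtain ⟨n, hn⟩ := pow_unbounded_of_one_lt (t / x₀) one_lt_two
  exact key n t ht ((div_le_iff₀ hx₀).1 hn.le)

namespace RegularlyVaryingTail
variable {F : ℝ → ℝ} {α : ℝ}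

lemma exists_le_rpow (hF : RegularlyVaryingTail F α) (h1 : ∀ w, F w ≤ 1) {q : ℝ} (hq0 : 0 < q)
    (hq : q < α) : ∃ C x₀, 0 < x₀ ∧ ∀ t, x₀ ≤ t → F t ≤ C * t ^ (-q) := by
  have hlt : (2 : ℝ) ^ (-α) < 2 ^ (-q) := Real.rpow_lt_rpow_of_exponent_lt one_lt_two (by linarith)
  obtain ⟨x₁, hx₁⟩ := eventually_atTop.1 (hF.eventually_le two_pos hlt)
  have hx0 : 0 < max x₁ 1 := zero_lt_one.trans_le (le_max_right _ _)
  refine ⟨(2 * max x₁ 1) ^ q, max x₁ 1, hx0, fun t ht => ?_⟩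
  have ht0 : 0 < t := hx0.trans_le ht
  rw [Real.rpow_neg ht0.le, ← div_eq_mul_inv, le_div_iff₀ (by positivity)]
  refine le_of_doubling (φ := fun t => F t * t ^ q) hx0 (fun s hs => ?_) (fun s hs => ?_) ht
  · have hs0 : 0 < s := hx0.trans_le hs.1
    calc F s * s ^ q ≤ 1 * (2 * max x₁ 1) ^ q :=
          mul_le_mul (h1 s) (Real.rpow_le_rpow hs0.le hs.2 hq0.le) (by positivity) zero_le_one
      _ = _ := one_mul _
  · have hs0 : 0 < s := hx0.trans_le hs
    have h2 := hx₁ s ((le_max_left _ _).trans hs)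
    calc F (2 * s) * (2 * s) ^ q ≤ (2 ^ (-q) * F s) * (2 * s) ^ q := by gcongr
      _ = (2 ^ (-q) * 2 ^ q) * (F s * s ^ q) := by rw [Real.mul_rpow two_pos.le hs0.le]; ring
      _ = F s * s ^ q := by rw [← Real.rpow_add two_pos, neg_add_cancel, Real.rpow_zero, one_mul]

lemma exists_rpow_le (hF : RegularlyVaryingTail F α) (hanti : Antitone F) {q : ℝ} (hq0 : 0 < q)
    (hq : α < q) : ∃ c x₀, 0 < c ∧ 0 < x₀ ∧ ∀ t, x₀ ≤ t → c * t ^ (-q) ≤ F t := by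
  have hlt : (2 : ℝ) ^ (-q) < 2 ^ (-α) := Real.rpow_lt_rpow_of_exponent_lt one_lt_two (by linarith)
  obtain ⟨x₁, hx₁⟩ := eventually_atTop.1 (hF.eventually_ge two_pos hlt)
  have hx0 : 0 < max x₁ 1 := zero_lt_one.trans_le (le_max_right _ _)
  have hFx := hF.pos (2 * max x₁ 1)
  refine ⟨F (2 * max x₁ 1) * max x₁ 1 ^ q, max x₁ 1, by positivity, hx0, fun t ht => ?_⟩
  have ht0 : 0 < t := hx0.trans_le ht
  rw [Real.rpow_neg ht0.le, ← div_eq_mul_inv, div_le_iff₀ (by positivity), ← neg_le_neg_iff]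
  refine le_of_doubling (φ := fun t => -(F t * t ^ q)) hx0 (fun s hs => ?_) (fun s hs => ?_) ht
  · have hs0 : 0 < s := hx0.trans_le hs.1
    exact neg_le_neg (mul_le_mul (hanti hs.2) (Real.rpow_le_rpow hx0.le hs.1 hq0.le)
      (by positivity) (hF.pos s).le)
  · have hs0 : 0 < s := hx0.trans_le hs
    have h2 := hx₁ s ((le_max_left _ _).trans hs)
    refine neg_le_neg ?_
    calc F s * s ^ q = (2 ^ (-q) * 2 ^ q) * (F s * s ^ q) := by
          rw [← Real.rpow_add two_pos, neg_add_cancel, Real.rpow_zero, one_mul]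
      _ = (2 ^ (-q) * F s) * (2 * s) ^ q := by rw [Real.mul_rpow two_pos.le hs0.le]; ring
      _ ≤ F (2 * s) * (2 * s) ^ q := by gcongr

end RegularlyVaryingTail

variable [MeasurableSpace Ω] {μ : Measure Ω} {X : ℕ → Ω → ℝ} {a : ℝ}

lemma integrable_rpow_posPart [IsProbabilityMeasure μ] (hX : Measurable (X 0)) {p q C x₀ : ℝ}
    (hp : 1 < p) (hpq : p < q) (hx₀ : 0 < x₀) (hb : ∀ t, x₀ ≤ t → tail μ X t ≤ C * t ^ (-q)) :
    Integrable (fun ω => max (X 0 ω) 0 ^ p) μ := by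
  have hint : IntegrableOn (fun t => tail μ X t * t ^ (p - 1)) (Ioi 0) := by
    have hmeas : Measurable fun t => tail μ X t * t ^ (p - 1) :=
      tail_antitone.measurable.mul (by fun_prop)
    rw [← Ioc_union_Ioi_eq_Ioi hx₀.le]
    refine IntegrableOn.union ?_ ?_
    · refine Measure.integrableOn_of_bounded (M := x₀ ^ (p - 1)) (by simp)
        hmeas.aestronglyMeasurable ?_
      filter_upwards [ae_restrict_mem measurableSet_Ioc] with t ht
      rw [Real.norm_of_nonneg (mul_nonneg (tail_nonneg _) (Real.rpow_nonneg ht.1.le _))]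
      calc tail μ X t * t ^ (p - 1) ≤ 1 * x₀ ^ (p - 1) :=
            mul_le_mul (tail_le_one _) (Real.rpow_le_rpow ht.1.le ht.2 (by linarith))
              (Real.rpow_nonneg ht.1.le _) zero_le_one
        _ = _ := one_mul _
    · refine Integrable.mono' ((integrableOn_Ioi_rpow_of_lt (a := p - 1 - q) (by linarith)
        hx₀).const_mul C) hmeas.aestronglyMeasurable ?_
      filter_upwards [ae_restrict_mem measurableSet_Ioi] with t ht
      have ht0 : 0 < t := hx₀.trans ht
      rw [Real.norm_of_nonneg (mul_nonneg (tail_nonneg _) (Real.rpow_nonneg ht0.le _))]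
      calc tail μ X t * t ^ (p - 1) ≤ C * t ^ (-q) * t ^ (p - 1) := by
            gcongr; exact hb t (le_of_lt ht)
        _ = C * t ^ (p - 1 - q) := by
            rw [mul_assoc, ← Real.rpow_add ht0]; congr 2; ring
  refine ⟨Measurable.aestronglyMeasurable (by fun_prop), ?_⟩
  rw [hasFiniteIntegral_iff_ofReal (ae_of_all _ fun ω => by positivity)]
  rw [lintegral_rpow_eq_lintegral_meas_lt_mul μ (f := fun ω => max (X 0 ω) 0)
    (ae_of_all _ fun ω => le_max_right _ _) (by fun_prop) (by linarith)]
  refine ENNReal.mul_lt_top ENNReal.ofReal_lt_top ?_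
  refine lt_of_eq_of_lt ?_ hint.2.lt_top
  refine setLIntegral_congr_fun measurableSet_Ioi fun t ht => ?_
  have ht0 : (0 : ℝ) < t := ht
  have hset : {ω | t < max (X 0 ω) 0} = {ω | t < X 0 ω} := by
    ext ω; simp [ht0.not_gt]
  simp only [hset]
  rw [← ofReal_measureReal, ← ENNReal.ofReal_mul measureReal_nonneg, Real.enorm_of_nonneg]
  · rfl
  · exact mul_nonneg (tail_nonneg _) (Real.rpow_nonneg ht0.le _)

/-! ### An exponential bound for long excursions without large increments -/

lemma exp_le_one_add_add_rpow {p Λ t : ℝ} (hp1 : 1 ≤ p) (hp2 : p ≤ 2) (hΛ : 0 ≤ Λ) (ht : t ≤ Λ) :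
    Real.exp t ≤ 1 + t + Real.exp Λ * |t| ^ p := by
  have h1 : 1 ≤ Real.exp Λ := Real.one_le_exp hΛ
  have h0 : 0 ≤ |t| ^ p := by positivity
  rcases le_total |t| 1 with h | h
  · have h2 := (abs_le.1 (Real.abs_exp_sub_one_sub_id_le h)).2
    have h3 : t ^ 2 ≤ |t| ^ p := by
      rcases (abs_nonneg t).eq_or_lt with h4 | h4
      · rw [← sq_abs, ← h4]; simp [Real.zero_rpow (by linarith : p ≠ 0)]
      · rw [← sq_abs, ← Real.rpow_two]
        exact Real.rpow_le_rpow_of_exponent_ge h4 h hp2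
    nlinarith
  · have h2 : |t| ≤ |t| ^ p := by
      simpa using Real.rpow_le_rpow_of_exponent_le h hp1
    rcases le_total t 0 with h3 | h3
    · have := Real.exp_le_one_iff.2 h3
      rw [abs_of_nonpos h3] at *
      nlinarith
    · have := Real.exp_le_exp.2 ht
      rw [abs_of_nonneg h3] at *
      nlinarith

namespace NegativeDrift
variable [IsProbabilityMeasure μ]

/-- Chernoff's bound for the increments truncated to `[-K, H]`, whose mean is at most `-b`: the
parameter `lam` is admissible as long as the second-order term of the exponential moment uses up
only half of the drift. -/
lemma measureReal_alive_inter_le (h : NegativeDrift μ X a) {K H b p lam : ℝ} (hK : 0 ≤ K)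
    (hH : 0 ≤ H) (hb : ∫ ω, max (X 0 ω) (-K) ∂μ = -b) (hp1 : 1 ≤ p) (hp2 : p ≤ 2)
    (hlam : 0 < lam) (hint : Integrable (fun ω => |max (X 0 ω) (-K)| ^ p) μ)
    (hsmall : Real.exp (lam * H) * lam ^ p * ∫ ω, |max (X 0 ω) (-K)| ^ p ∂μ ≤ lam * b / 2)
    (n : ℕ) :
    μ.real (alive X n ∩ {ω | ∀ k < n, X k ω ≤ H}) ≤ Real.exp (-(n * (lam * b / 2))) := by
  set f : ℝ → ℝ := (Iic H).indicator fun x => Real.exp (lam * max x (-K)) with hf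
  have hfm : Measurable f := Measurable.indicator (by fun_prop) measurableSet_Iic
  have hf0 : ∀ x, 0 ≤ f x := fun x => indicator_nonneg (fun _ _ => (Real.exp_pos _).le) x
  have hfle : ∀ x, f x ≤ 1 + lam * max x (-K) +
      Real.exp (lam * H) * lam ^ p * |max x (-K)| ^ p := by
    intro x
    have hrew : Real.exp (lam * H) * |lam * max x (-K)| ^ p =
        Real.exp (lam * H) * lam ^ p * |max x (-K)| ^ p := by
      rw [abs_mul, abs_of_pos hlam, Real.mul_rpow hlam.le (abs_nonneg _), mul_assoc]
    by_cases hx : x ∈ Iic H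
    · rw [hf, indicator_of_mem hx, ← hrew]
      refine exp_le_one_add_add_rpow hp1 hp2 (by positivity) ?_
      exact mul_le_mul_of_nonneg_left (max_le hx (by linarith)) hlam.le
    · rw [hf, indicator_of_notMem hx]
      have h1 : H < x := not_le.1 hx
      have h2 : 0 ≤ max x (-K) := le_max_of_le_left (by linarith)
      positivity
  have hfb : ∀ x, f x ≤ Real.exp (lam * H) := by
    intro x
    refine indicator_le' (fun x hx => ?_) (fun _ _ => (Real.exp_pos _).le) x
    exact Real.exp_le_exp.2 (mul_le_mul_of_nonneg_left (max_le hx (by linarith)) hlam.le)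
  have hfi : ∀ k, Integrable (fun ω => f (X k ω)) μ := fun k =>
    Integrable.of_bound (hfm.comp (h.meas k)).aestronglyMeasurable (Real.exp (lam * H))
      (ae_of_all _ fun ω => by rw [Real.norm_of_nonneg (hf0 _)]; exact hfb _)
  have hmean : ∫ ω, f (X 0 ω) ∂μ ≤ Real.exp (-(lam * b / 2)) := by
    have hmax := h.integrable_max K
    have hlin : Integrable (fun ω => 1 + lam * max (X 0 ω) (-K)) μ :=
      (integrable_const _).add (hmax.const_mul _)
    calc ∫ ω, f (X 0 ω) ∂μ ≤ ∫ ω, (1 + lam * max (X 0 ω) (-K) +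
          Real.exp (lam * H) * lam ^ p * |max (X 0 ω) (-K)| ^ p) ∂μ :=
          integral_mono (hfi 0) (hlin.add (hint.const_mul _)) fun ω => hfle _
      _ = 1 + lam * -b + Real.exp (lam * H) * lam ^ p * ∫ ω, |max (X 0 ω) (-K)| ^ p ∂μ := by
          rw [integral_add hlin (hint.const_mul _),
            integral_add (integrable_const _) (hmax.const_mul _), integral_const_mul,
            integral_const_mul, hb]
          simp
      _ ≤ -(lam * b / 2) + 1 := by linarith
      _ ≤ _ := Real.add_one_le_exp _
  have hprod : ∫ ω, ∏ i : Fin n, f (X i ω) ∂μ = ∏ i : Fin n, ∫ ω, f (X i ω) ∂μ :=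
    ((h.indep.precomp Fin.val_injective).comp (fun _ => f) fun _ => hfm
      ).integral_fun_prod_eq_prod_integral fun i => (hfi i).aestronglyMeasurable
  have hind : ∀ ω, (alive X n ∩ {ω | ∀ k < n, X k ω ≤ H}).indicator (fun _ => (1 : ℝ)) ω ≤
      ∏ i : Fin n, f (X i ω) := by
    intro ω
    refine indicator_le' (g := fun ω => ∏ i : Fin n, f (X i ω)) (fun ω hω => ?_)
      (fun ω _ => Finset.prod_nonneg fun i _ => hf0 _) ω
    have h1 : ∀ i : Fin n, f (X i ω) = Real.exp (lam * max (X i ω) (-K)) := fun i => by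
      rw [hf]; exact indicator_of_mem (show X i ω ∈ Iic H from hω.2 i i.2) _
    simp_rw [h1]
    rw [← Real.exp_sum, ← Finset.mul_sum]
    refine Real.one_le_exp (mul_nonneg hlam.le ?_)
    have h2 := walk_nonneg_of_alive hω.1 le_rfl
    rw [walk, ← Fin.sum_univ_eq_sum_range (fun k => X k ω)] at h2
    exact h2.trans (Finset.sum_le_sum fun i _ => le_max_left _ _)
  have hset : MeasurableSet (alive X n ∩ {ω | ∀ k < n, X k ω ≤ H}) := by
    refine (measurableSet_alive h.meas n).inter ?_
    have : {ω | ∀ k < n, X k ω ≤ H} = ⋂ k ∈ Finset.range n, {ω | X k ω ≤ H} := by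
      ext ω; simp
    rw [this]
    exact Finset.measurableSet_biInter _ fun k _ => measurableSet_le (h.meas k) measurable_const
  have hpint : Integrable (fun ω => ∏ i : Fin n, f (X i ω)) μ := by
    have hm : Measurable fun ω => ∏ i : Fin n, f (X i ω) :=
      Finset.measurable_prod _ fun i _ => hfm.comp (h.meas i)
    refine Integrable.of_bound hm.aestronglyMeasurable (∏ _i : Fin n, Real.exp (lam * H))
      (ae_of_all _ fun ω => ?_)
    rw [Real.norm_of_nonneg (Finset.prod_nonneg fun i _ => hf0 _)]
    exact Finset.prod_le_prod (fun i _ => hf0 _) fun i _ => hfb _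
  calc μ.real (alive X n ∩ {ω | ∀ k < n, X k ω ≤ H})
      = ∫ ω, (alive X n ∩ {ω | ∀ k < n, X k ω ≤ H}).indicator (fun _ => (1 : ℝ)) ω ∂μ := by
        rw [integral_indicator_const _ hset, smul_eq_mul, mul_one]
    _ ≤ ∫ ω, ∏ i : Fin n, f (X i ω) ∂μ :=
        integral_mono ((integrable_const _).indicator hset) hpint hind
    _ = ∏ i : Fin n, ∫ ω, f (X i ω) ∂μ := hprod
    _ ≤ ∏ _i : Fin n, Real.exp (-(lam * b / 2)) := by
        refine Finset.prod_le_prod (fun i _ => integral_nonneg fun ω => hf0 _) fun i _ => ?_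
        exact (h.integral_comp i hfm).trans_le hmean
    _ = Real.exp (-(n * (lam * b / 2))) := by
        rw [Finset.prod_const, Finset.card_univ, Fintype.card_fin, ← Real.exp_nat_mul]
        congr 1; ring

/-- An excursion of area above `r²` and height at most `H` lasts longer than `r² / H`, and none of
its increments exceeds `H`. -/
lemma measureReal_area_low_le (h : NegativeDrift μ X a) {r H : ℝ} (hH : 0 < H) {n : ℕ}
    (hn : n * H ≤ r ^ 2) :
    μ.real {ω | r ^ 2 < area X ω ∧ maximum X ω ≤ H} ≤
      μ.real (alive X n ∩ {ω | ∀ k < n, X k ω ≤ H}) := by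
  refine ENNReal.toReal_mono (measure_ne_top _ _) (measure_mono_ae ?_)
  filter_upwards [h.ae_exists_not_alive] with ω hω
  rintro ⟨h1, h2⟩
  obtain ⟨N, -, hal, hN, harea, hmax⟩ := exists_exit hω
  have hle : ∀ k < N, walk X k ω ≤ H := by
    intro k hk
    by_contra hcon
    exact h2.not_gt ((hmax H).2 ⟨k, hk, not_le.1 hcon⟩)
  have hnN : n < N := by
    have h3 : r ^ 2 < N * H := by
      calc r ^ 2 < area X ω := h1
        _ ≤ ∑ _k ∈ Finset.range N, H := by
          rw [harea]; exact Finset.sum_le_sum fun k hk => hle k (Finset.mem_range.1 hk)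
        _ = N * H := by simp
    exact_mod_cast lt_of_mul_lt_mul_right (hn.trans_lt h3) hH.le
  have halive : ω ∈ alive X n := (hal n).2 hnN
  refine ⟨halive, fun k hk => ?_⟩
  have h4 := walk_succ X k ω
  have h5 := walk_nonneg_of_alive halive hk.le
  have h6 := hle (k + 1) (by omega)
  linarith

/-- If the tail is regularly varying with index `-α`, `α > 1`, then for some `ε > 0` the excursions
of area above `x` and height at most `ε √x` are negligible. Their length is at least `√x / ε`, and
Chernoff's bound with parameter of order `log x / √x` gives a power of `x` that is as large as
desired when `ε` is small. -/
lemma exists_measureReal_area_low_le (h : NegativeDrift μ X a) {α : ℝ} (hα : 1 < α)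
    (hF : RegularlyVaryingTail (tail μ X) α) :
    ∃ ε, 0 < ε ∧ ∀ δ, 0 < δ → ∀ᶠ r in atTop,
      μ.real {ω | r ^ 2 < area X ω ∧ maximum X ω ≤ ε * r} ≤ δ * tail μ X (√(2 * a) * r) := by
  obtain ⟨K, hK, hneg⟩ := exists_integral_max_neg h.int (by rw [h.mean]; linarith [h.pos])
  set b := -∫ ω, max (X 0 ω) (-K) ∂μ with hb
  have hb0 : 0 < b := by linarith
  set p := min 2 ((1 + α) / 2) with hp
  have hp1 : 1 < p := lt_min one_lt_two (by linarith)
  have hp2 : p ≤ 2 := min_le_left _ _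
  have hpα : p < α := (min_le_right _ _).trans_lt (by linarith)
  obtain ⟨C, x₀, hx₀, hC⟩ := hF.exists_le_rpow (fun w => tail_le_one w)
    (q := (p + α) / 2) (by linarith) (by linarith)
  have hmom : Integrable (fun ω => |max (X 0 ω) (-K)| ^ p) μ := by
    have hX0 := h.meas 0
    refine ((integrable_rpow_posPart hX0 hp1 (by linarith : p < (p + α) / 2) hx₀ hC).add
      (integrable_const (K ^ p))).mono' (Measurable.aestronglyMeasurable (by fun_prop))
      (ae_of_all _ fun ω => ?_)
    rw [Real.norm_of_nonneg (by positivity)]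
    have hp0 : 0 ≤ p := by linarith
    have hle : |max (X 0 ω) (-K)| ≤ max (max (X 0 ω) 0) K := by
      rw [abs_le]
      constructor
      · have := le_max_right (X 0 ω) (-K)
        have := le_max_right (max (X 0 ω) 0) K
        linarith
      · refine max_le ((le_max_left _ _).trans (le_max_left _ _)) ?_
        have := le_max_right (max (X 0 ω) 0) K
        linarith
    refine (Real.rpow_le_rpow (abs_nonneg _) hle hp0).trans ?_
    simp only [Pi.add_apply]
    have e1 : 0 ≤ max (X 0 ω) 0 ^ p := by positivity
    have e2 : 0 ≤ K ^ p := by positivity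
    rcases max_choice (max (X 0 ω) 0) K with e | e <;> rw [e] <;> linarith
  set M := ∫ ω, |max (X 0 ω) (-K)| ^ p ∂μ with hM
  set c := (p - 1) / 2 with hc
  have hc0 : 0 < c := by linarith
  have hα2 : 0 < α + 2 := by linarith
  set ε := √(c * b / (4 * (α + 2))) with hε
  have hε0 : 0 < ε := Real.sqrt_pos.2 (by positivity)
  have hεsq : ε ^ 2 = c * b / (4 * (α + 2)) := Real.sq_sqrt (by positivity)
  set κ := √(2 * a) / ε with hκ
  have ha := h.pos
  have hκ0 : 0 < κ := div_pos (Real.sqrt_pos.2 (by positivity)) hε0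
  obtain ⟨c₁, x₁, hc₁, hx₁, hlow⟩ := hF.exists_rpow_le tail_antitone
    (q := α + 1) (by linarith) (by linarith)
  refine ⟨ε, hε0, fun δ hδ => ?_⟩
  -- the second-order term of the exponential moment, for the parameter `c log H / H`
  have hlim : Tendsto (fun H : ℝ => (c * (Real.log H / H ^ (1 / 2 : ℝ))) ^ (2 * c) * M) atTop
      (𝓝 0) := by
    have h1 : Tendsto (fun H : ℝ => Real.log H / H ^ (1 / 2 : ℝ)) atTop (𝓝 0) :=
      (isLittleO_log_rpow_atTop (by norm_num)).tendsto_div_nhds_zero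
    have h2 := ((h1.const_mul c).rpow_const (p := 2 * c) (Or.inr (by positivity))).mul_const M
    rwa [mul_zero, Real.zero_rpow (by positivity), zero_mul] at h2
  have hHtop : Tendsto (fun r : ℝ => ε * r) atTop atTop := tendsto_id.const_mul_atTop hε0
  have hmain : ∀ᶠ H : ℝ in atTop, ∀ r, H = ε * r →
      μ.real {ω | r ^ 2 < area X ω ∧ maximum X ω ≤ H} ≤ δ * tail μ X (√(2 * a) * r) := by
    filter_upwards [eventually_gt_atTop 1, eventually_ge_atTop (ε ^ 2),
      eventually_ge_atTop (x₁ / κ), eventually_ge_atTop (κ ^ (α + 1) / (δ * c₁)),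
      hlim.eventually (gt_mem_nhds (half_pos hb0))] with H hH1 hHε hHx hHδ hHM r hr
    have hH0 : 0 < H := by linarith
    have hlog : 0 < Real.log H := Real.log_pos hH1
    have hrH : r = H / ε := by rw [hr]; field_simp
    set lam := c * Real.log H / H with hlam
    have hlam0 : 0 < lam := by positivity
    have hsmall : Real.exp (lam * H) * lam ^ p * M ≤ lam * b / 2 := by
      have e1 : Real.exp (lam * H) = H ^ c := by
        rw [Real.rpow_def_of_pos hH0, hlam]; congr 1; field_simp
      have e2 : lam ^ p = lam * lam ^ (2 * c) := by
        rw [← Real.rpow_one_add' hlam0.le (by positivity)]; congr 1; rw [hc]; ring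
      have e3 : H ^ c * lam ^ (2 * c) = (c * (Real.log H / H ^ (1 / 2 : ℝ))) ^ (2 * c) := by
        have e4 : H ^ c = (H ^ (1 / 2 : ℝ)) ^ (2 * c) := by
          rw [← Real.rpow_mul hH0.le]; congr 1; ring
        rw [e4, ← Real.mul_rpow (by positivity) hlam0.le]
        congr 1
        have e5 : H ^ (1 / 2 : ℝ) * H ^ (1 / 2 : ℝ) = H := by
          rw [← Real.rpow_add hH0]; norm_num
        have e6 : 0 < H ^ (1 / 2 : ℝ) := by positivity
        rw [hlam]
        field_simp
        rw [pow_two, e5]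
      calc Real.exp (lam * H) * lam ^ p * M = lam * (H ^ c * lam ^ (2 * c) * M) := by
            rw [e1, e2]; ring
        _ ≤ lam * (b / 2) := by rw [e3]; exact mul_le_mul_of_nonneg_left hHM.le hlam0.le
        _ = _ := by ring
    set n := ⌊H / ε ^ 2⌋₊ with hn
    have hε2 : 0 < ε ^ 2 := by positivity
    have hnle : (n : ℝ) ≤ H / ε ^ 2 := Nat.floor_le (by positivity)
    have hnge : H / ε ^ 2 / 2 ≤ n := by
      have e1 : H / ε ^ 2 < n + 1 := Nat.lt_floor_add_one _
      have e2 : 1 ≤ H / ε ^ 2 := (one_le_div hε2).2 hHε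
      have e3 : (1 : ℝ) ≤ n := by exact_mod_cast Nat.le_floor (by simpa using e2)
      linarith
    have hnH : n * H ≤ r ^ 2 := by
      calc n * H ≤ H / ε ^ 2 * H := by gcongr
        _ = r ^ 2 := by rw [hrH]; ring
    have hexp : (α + 2) * Real.log H ≤ n * (lam * b / 2) := by
      calc (α + 2) * Real.log H = H / ε ^ 2 / 2 * (lam * b / 2) := by
            rw [hεsq, hlam]; field_simp; norm_num
        _ ≤ n * (lam * b / 2) := by gcongr
    calc μ.real {ω | r ^ 2 < area X ω ∧ maximum X ω ≤ H}
        ≤ Real.exp (-(n * (lam * b / 2))) :=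
          (h.measureReal_area_low_le hH0 hnH).trans
            (h.measureReal_alive_inter_le hK hH0.le (by rw [hb, neg_neg]) hp1.le hp2 hlam0 hmom
              hsmall n)
      _ ≤ Real.exp (-((α + 2) * Real.log H)) := Real.exp_le_exp.2 (neg_le_neg hexp)
      _ = H ^ (-(α + 1)) * H⁻¹ := by
          rw [← Real.rpow_neg_one H, ← Real.rpow_add hH0, Real.rpow_def_of_pos hH0]
          congr 1; ring
      _ ≤ H ^ (-(α + 1)) * (δ * c₁ / κ ^ (α + 1)) := by
          gcongr
          rw [← inv_div]
          exact inv_anti₀ (by positivity) hHδ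
      _ = δ * (c₁ * (κ * H) ^ (-(α + 1))) := by
          rw [Real.mul_rpow hκ0.le hH0.le, Real.rpow_neg hκ0.le]; ring
      _ ≤ δ * tail μ X (κ * H) := by
          gcongr
          exact hlow _ ((div_le_iff₀' hκ0).1 hHx)
      _ = δ * tail μ X (√(2 * a) * r) := by
          congr 2; rw [hκ, hrH]; ring
  filter_upwards [hHtop.eventually hmain] with r hr
  exact hr r rfl

/-- For `α > 1` the height of the excursion plays no role. -/
lemma isEquivalent_measureReal_area (h : NegativeDrift μ X a) {α : ℝ} (hα : 1 < α)
    (hF : RegularlyVaryingTail (tail μ X) α) :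
    (fun x : ℝ => μ.real {ω | x < area X ω}) ~[atTop]
      (fun x => (meanExitTime μ X).toReal * tail μ X (√(2 * a * x))) := by
  have ha := h.pos
  have hz := tendsto_sqrt_two_mul ha
  have hT1 := h.one_le_tsum_alive
  have hheavy := hF.heavyTail tail_antitone (integrableOn_tail h.int)
  rw [h.toReal_meanExitTime.2]
  set T := ∑' k, μ.real (alive X k) with hT
  obtain ⟨ε, hε, hlow⟩ := h.exists_measureReal_area_low_le hα hF
  have hs0 : 0 < √(2 * a) := Real.sqrt_pos.2 (by positivity)
  set t := ε / √(2 * a) with ht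
  have ht0 : 0 < t := div_pos hε hs0
  rw [isEquivalent_iff_tendsto_one (Eventually.of_forall fun x =>
    (mul_pos (by linarith) (hF.pos _)).ne')]
  refine Metric.tendsto_nhds.2 fun δ hδ => ?_
  filter_upwards [
    hz.eventually (h.eventually_le_measureReal_area hF.insensitivityScale
      h.tendsto_mul_truncMoment_id (half_pos hδ)),
    hz.eventually (h.eventually_measureReal_area_le hheavy hF.insensitivityScale
      h.tendsto_mul_truncMoment_id (y := fun z => t * z) (tendsto_id.const_mul_atTop ht0)
      (hF.eventually_le ht0 (lt_add_one _)) (half_pos (half_pos hδ))),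
    Real.tendsto_sqrt_atTop.eventually (hlow _ (half_pos (half_pos hδ))),
    eventually_ge_atTop 0] with x h1 h2 h3 hx
  rw [sq_sqrt_div ha hx] at h1 h2
  have hsq : √(2 * a * x) = √(2 * a) * √x := Real.sqrt_mul (by positivity) x
  rw [Real.sq_sqrt hx, ← hsq] at h3
  have htz : t * √(2 * a * x) = ε * √x := by rw [hsq, ht]; field_simp
  rw [htz] at h2
  have hFz := hF.pos √(2 * a * x)
  have h4 : μ.real {ω | x < area X ω ∧ √(2 * a * x) < maximum X ω} ≤ μ.real {ω | x < area X ω} :=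
    measureReal_mono fun ω hω => hω.1
  have h5 : μ.real {ω | x < area X ω} ≤ μ.real {ω | x < area X ω ∧ ε * √x < maximum X ω} +
      μ.real {ω | x < area X ω ∧ maximum X ω ≤ ε * √x} := by
    refine (measureReal_mono fun ω hω => ?_).trans (measureReal_union_le _ _)
    rcases lt_or_ge (ε * √x) (maximum X ω) with e | e
    · exact Or.inl ⟨hω, e⟩
    · exact Or.inr ⟨hω, e⟩
  simp only [Pi.div_apply]
  set P := μ.real {ω | x < area X ω}
  have hpos : 0 < T * tail μ X √(2 * a * x) := by positivity
  have hd : 0 < δ * tail μ X √(2 * a * x) := by positivity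
  have hdT : δ * tail μ X √(2 * a * x) ≤ δ * (T * tail μ X √(2 * a * x)) :=
    mul_le_mul_of_nonneg_left (le_mul_of_one_le_left hFz.le hT1) hδ.le
  rw [Real.dist_eq, abs_sub_lt_iff]
  constructor
  · rw [sub_lt_iff_lt_add, div_lt_iff₀ hpos]
    linarith
  · rw [sub_lt_comm, lt_div_iff₀ hpos]
    linarith

end NegativeDrift

end

end WalkArea

end

/-! ### Regularly varying and semi-exponential increments -/

theorem proposition1 {Ω : Type*} [MeasurableSpace Ω] (μ : Measure Ω) [IsProbabilityMeasure μ]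
    (X : ℕ → Ω → ℝ) (hmeas : ∀ k, Measurable (X k)) (hindep : iIndepFun X μ)
    (hident : ∀ k, IdentDistrib (X k) (X 0) μ μ)
    (hint : Integrable (X 0) μ) (a : ℝ) (ha : 0 < a) (hmean : ∫ ω, X 0 ω ∂μ = -a) :
    WalkArea.meanExitTime μ X ≠ ⊤ ∧
    -- (a) regularly varying tails
    (∀ (α : ℝ) (L : ℝ → ℝ), 1 ≤ α → WalkArea.SlowlyVarying L →
      (∀ᶠ x : ℝ in atTop, WalkArea.tail μ X x = x ^ (-α) * L x) →
      (∀ ε : ℝ, 0 < ε →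
        WalkArea.UniformEquiv
          (fun x y => μ.real {ω | x < WalkArea.area X ω ∧ y < WalkArea.maximum X ω})
          (fun x => (WalkArea.meanExitTime μ X).toReal * WalkArea.tail μ X (√(2 * a * x)))
          (fun x => Icc (ε * √x) (√(2 * a * x)))) ∧
      ((WalkArea.meanExitTime μ X).toReal : EReal) ≤
        liminf (fun x : ℝ => ((μ.real {ω | x < WalkArea.area X ω} /
          WalkArea.tail μ X (√(2 * a * x)) : ℝ) : EReal)) atTop ∧
      (1 < α →
        (fun x : ℝ => μ.real {ω | x < WalkArea.area X ω}) ~[atTop]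
          (fun x => (WalkArea.meanExitTime μ X).toReal * WalkArea.tail μ X (√(2 * a * x))))) ∧
    -- (b) semi-exponential tails
    (∀ (β ϰ x₀ : ℝ) (g : ℝ → ℝ), 0 < β → β < 1 / 2 → 1 / (1 - β) < ϰ → 0 ≤ x₀ →
      (MonotoneOn g (Ioi x₀) ∨ AntitoneOn g (Ioi x₀)) → ContDiffOn ℝ 1 g (Ioi x₀) →
      AntitoneOn (fun x => g x / x ^ β) (Ioi x₀) →
      WalkArea.tail μ X ~[atTop] (fun x => x ^ (-ϰ) * Real.exp (-g x)) →
      Integrable (fun ω => |X 0 ω| ^ ϰ) μ →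
      (∀ R : ℝ, 0 < R →
        WalkArea.UniformEquiv
          (fun x y => μ.real {ω | x < WalkArea.area X ω ∧ y < WalkArea.maximum X ω})
          (fun x => (WalkArea.meanExitTime μ X).toReal * WalkArea.tail μ X (√(2 * a * x)))
          (fun x => Icc (√(2 * a * x) - R * √(2 * a * x) / g (√(2 * a * x)))
            (√(2 * a * x)))) ∧
      ((WalkArea.meanExitTime μ X).toReal : EReal) ≤
        liminf (fun x : ℝ => ((μ.real {ω | x < WalkArea.area X ω} /
          WalkArea.tail μ X (√(2 * a * x)) : ℝ) : EReal)) atTop) := by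

  have h : WalkArea.NegativeDrift μ X a := ⟨hmeas, hindep, hident, hint, ha, hmean⟩
  have hs0 : 0 < √(2 * a) := Real.sqrt_pos.2 (by positivity)
  refine ⟨h.toReal_meanExitTime.1, fun α L hα hL hFL => ?_,
    fun β ϰ x₀ g hβ hβ1 hϰ hx₀ _ _ hanti hequiv hmom => ?_⟩
  · have hF := WalkArea.regularlyVaryingTail_of_eq WalkArea.tail_antitone hL hFL
    have hheavy := hF.heavyTail WalkArea.tail_antitone (WalkArea.integrableOn_tail hint)
    refine ⟨fun ε hε => ?_, h.le_liminf_area hF.pos hF.insensitivityScale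
      h.tendsto_mul_truncMoment_id, fun hα1 => h.isEquivalent_measureReal_area hα1 hF⟩
    have ht0 : 0 < ε / √(2 * a) := div_pos hε hs0
    have key := h.uniformEquiv_area hheavy hF.insensitivityScale h.tendsto_mul_truncMoment_id
      (y := fun z => ε / √(2 * a) * z) (tendsto_id.const_mul_atTop ht0)
      (hF.eventually_le ht0 (lt_add_one _))
    have hy : ∀ x : ℝ, ε / √(2 * a) * √(2 * a * x) = ε * √x := fun x => by
      rw [Real.sqrt_mul (by positivity) x]; field_simp
    simpa only [hy] using key
  · have hF := WalkArea.semiExponentialTail_of_isEquivalent (hmeas 0) hβ hβ1 hϰ hx₀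
      hanti hequiv hmom
    have hs := hF.insensitivityScale WalkArea.tail_antitone
    have hlim := h.tendsto_mul_truncMoment_rpow hβ hβ1 hϰ hmom
    refine ⟨fun R hR => ?_, h.le_liminf_area (hF.pos WalkArea.tail_antitone) hs hlim⟩
    obtain ⟨C, hC⟩ := hF.exists_le_mul WalkArea.tail_antitone hR
    refine h.uniformEquiv_area (hF.heavyTail WalkArea.tail_antitone fun w => WalkArea.tail_le_one w)
      hs hlim (y := fun z => z - R * z / g z) ?_ hC
    refine tendsto_atTop_mono' _ ?_ (tendsto_id.atTop_div_const two_pos)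
    filter_upwards [hF.eventually_half_le_sub_div hR] with z hz
    exact hz.1
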